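/- **Conventions.** A *2-digraph* is a finite directed graph (loops and parallel arcs allowed, a loop counting as an in-arc and as an out-arc) in which every vertex has (in-degree, out-degree) equal to $(0,2)$ (*entry*), $(2,0)$ (*exit*) or $(2,2)$ (*saturated*); a *2-dd* is a 2-digraph all of whose vertices are saturated. An *alternating cycle* (AC) is a cyclic sequence of $2r\ge 2$ distinct arcs $e_0,\dots,e_{2r-1}$ in which $e_i,e_{i+1}$ (indices mod $2r$) have a common end-vertex for even $i$ and a common start-vertex for odd $i$; the arcs of a 2-digraph are partitioned by its ACs. An AC is *clean* if the subgraph induced by it has no saturated vertex. $\mathcal G^6$ is the family of 2-dds all of whose ACs have exactly 6 arcs, $\mathcal G^{6,clean}$ the subfamily in which moreover all ACs are clean, and $\partial\mathcal G^6$ the family of 2-digraphs all of whose ACs have exactly 6 arcs. A *subgraph* is the 2-digraph induced by a set of ACs; its complementary subgraph is induced by the remaining ACs. A *factor* is a spanning subgraph which has exactly one out-arc at each entry or saturated vertex and exactly one in-arc at each exit or saturated vertex; its *index* is its number of directed cycles. A 2-dd is *odd* if all its factors have odd index, and two 2-dds are *H-equivalent* if both or neither are Hamiltonian. A 2-dd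 is *2-splittable* if for some two of its vertices, splitting each of them into a vertex carrying its in-arcs and a vertex carrying its out-arcs increases the number of connected components. An *open route* of a 2-digraph is the bijection from its entry to its exit vertices defined by the paths of a factor of index $0$. Labelling both the entry and the exit vertices by $1,\dots,n$ turns open routes into permutations in $S_n$. A set $P\subset S_n$ is *uniform* if it is non-empty and all its elements have the same parity. With $C_n$ the set of permutations consisting of a single $n$-cycle (including the identity for $n=1$) and $E_P=P^{-1}C_n$, the *residue* of a uniform $P$ is $R_P=(S_n\setminus A_n)\setminus E_P$ if $P$ and $n$ have the same parity and $R_P=A_n\setminus E_P$ otherwise. Let $F$ be a subgraph of a 2-dd $G$. If $F$ has a unique open route $r$, *collapsing* $F$ means identifying, in the complementary subgraph, each entry vertex $u$ of $F$ with the exit vertex $r(u)$ of $F$. *Replacing* $F$ by a 2-digraph $F'$ means forming the disjoint union of the complementary subgraph and $F'$ and identifying the entry vertices of $F'$ with those of $F$, and the exit vertices of $F'$ with those of $F$, through two bijections $\alpha,\beta$, where it is required that, labelling the entry and exit vertices of $F$ in any way and those of $F'$ accordingly through $\alpha,\beta$, the open route sets of $F$ and $F'$ are uniform and have the same residue. **Proposition.**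 Let $G\in\mathcal G^{6,clean}$ be odd, connected and not 2-splittable, and let $F$ be a subgraph of $G$ with exactly 3 ACs and with $s>4$ saturated vertices, such that no subgraph of $F$ with exactly 2 ACs has more than 2 saturated vertices. Then one of the following holds: 1. $F$ has a unique open route, and collapsing $F$ gives an odd 2-dd $G'\in\mathcal G^6$ that is H-equivalent to $G$; 2. there is $F'\in\partial\mathcal G^6$ with one or two ACs such that replacing $F$ by $F'$, through suitable bijections $\alpha,\beta$, gives an odd 2-dd $G'\in\mathcal G^6$ that is H-equivalent to $G$. Moreover, if $s=5$, then $F$ has 4 entry and 4 exit vertices, and for every labelling of them by $1,\dots,4$ its open route set is uniform and its residue has $0$ or $1$ elements. -/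

import Mathlib

/-- A directed graph with vertex set `V` and arc set `A`; loops and parallel arcs are possible.
A loop counts both as an in-arc and as an out-arc of its vertex. -/
structure MultiDigraph (V A : Type*) where
  /-- start-vertex of an arc -/
  src : A → V
  /-- end-vertex of an arc -/
  tgt : A → V

namespace MultiDigraph

universe u₁ u₂ u₃ u₄

variable {V : Type u₁} {A : Type u₂} {V' : Type u₃} {A' : Type u₄}

section Basic

variable (G : MultiDigraph V A)

/-- The number of arcs that end at `v`. -/
noncomputable def inDeg (v : V) : ℕ := {a : A | G.tgt a = v}.ncard

/-- The number of arcs that start at `v`. -/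
noncomputable def outDeg (v : V) : ℕ := {a : A | G.src a = v}.ncard

def IsEntry (k : ℕ) (v : V) : Prop := G.inDeg v = 0 ∧ G.outDeg v = k

def IsExit (k : ℕ) (v : V) : Prop := G.inDeg v = k ∧ G.outDeg v = 0

def IsSat (k : ℕ) (v : V) : Prop := G.inDeg v = k ∧ G.outDeg v = k

/-- `k`-digraphs: every vertex is an entry, an exit or a saturated vertex. -/
def IsKDigraph (k : ℕ) : Prop := ∀ v, G.IsEntry k v ∨ G.IsExit k v ∨ G.IsSat k v

/-- `k`-diregular digraphs: every vertex is saturated. -/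
def IsKDiregular (k : ℕ) : Prop := ∀ v, G.IsSat k v

/-- The entry vertices of a 2-digraph. -/
abbrev Entry : Type u₁ := {v : V // G.IsEntry 2 v}

/-- The exit vertices of a 2-digraph. -/
abbrev Exit : Type u₁ := {v : V // G.IsExit 2 v}

/-- The saturated vertices of a 2-digraph. -/
abbrev Sat : Type u₁ := {v : V // G.IsSat 2 v}

/-- The vertices incident with some arc in `B`. -/
def support (B : Set A) : Set V := {v | ∃ a ∈ B, G.src a = v ∨ G.tgt a = v}

/-- The subgraph induced by a set `B` of arcs. -/
def induced (B : Set A) : MultiDigraph (G.support B) B where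
  src a := ⟨G.src a, a, a.2, Or.inl rfl⟩
  tgt a := ⟨G.tgt a, a, a.2, Or.inr rfl⟩

/-- The spanning subgraph with arc set `B`. -/
def spanning (B : Set A) : MultiDigraph V B where
  src a := G.src a
  tgt a := G.tgt a

/-! ### Alternating cycles -/

/-- `X` is the set of arcs of an alternating cycle `e 0, e 1, …, e (2r-1)`, the sequence being
extended to all of `ℕ` with period `2r`. -/
def IsAC (X : Set A) : Prop :=
  ∃ (r : ℕ) (e : ℕ → A), 0 < r ∧ (∀ i, e (i + 2 * r) = e i) ∧
    Set.InjOn e (Set.Iio (2 * r)) ∧ Set.range e = X ∧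
    ∀ i, (Even i → G.tgt (e i) = G.tgt (e (i + 1))) ∧
      (Odd i → G.src (e i) = G.src (e (i + 1)))

/-- The set of alternating cycles (each one given by its set of arcs). -/
def acs : Set (Set A) := {X | G.IsAC X}

/-- Every alternating cycle has exactly `m` arcs. -/
def AllACsHaveSize (m : ℕ) : Prop := ∀ X ∈ G.acs, X.ncard = m

/-- Every alternating cycle is clean, that is, has no saturated vertex of its own. -/
def IsClean : Prop := ∀ X ∈ G.acs, IsEmpty (G.induced X).Sat

/-- The subgraph induced by a set `K` of alternating cycles. -/
def sub (K : Set (Set A)) : MultiDigraph (G.support (⋃₀ K)) (⋃₀ K : Set A) := G.induced (⋃₀ K)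

/-! ### Components, splitting -/

/-- The underlying undirected graph. -/
def underlying : SimpleGraph V :=
  SimpleGraph.fromRel fun u v => ∃ a, G.src a = u ∧ G.tgt a = v

noncomputable def numComponents : ℕ := Nat.card G.underlying.ConnectedComponent

open Classical in
/-- Split every vertex `v ∈ S` into `v^in = inl v`, which keeps the arcs ending at `v`, and
`v^out = inr v`, which keeps the arcs starting at `v`. -/
noncomputable def split (S : Set V) : MultiDigraph (V ⊕ S) A where
  src a := if h : G.src a ∈ S then Sum.inr ⟨G.src a, h⟩ else Sum.inl (G.src a)
  tgt a := Sum.inl (G.tgt a)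

def IsSplitSet (S : Set V) : Prop :=
  (∀ v ∈ S, G.IsSat 2 v) ∧ G.numComponents < (G.split S).numComponents

/-- `k`-splittable: there is a split-set with `k` elements. -/
def IsSplittable (k : ℕ) : Prop := ∃ S : Set V, S.ncard = k ∧ G.IsSplitSet S

/-! ### Factors, circuits, routes -/

/-- `B` is the arc set of a factor of the 2-digraph `G`: the spanning subgraph with arc set `B` is
a 1-digraph with the same entry, exit and saturated vertices as `G`. -/
def IsFactor (B : Set A) : Prop :=
  ∀ v, (G.IsEntry 2 v → (G.spanning B).IsEntry 1 v) ∧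
    (G.IsExit 2 v → (G.spanning B).IsExit 1 v) ∧
    (G.IsSat 2 v → (G.spanning B).IsSat 1 v)

/-- `X` is the set of arcs of a simple directed cycle `e 0, …, e (r-1)`, the sequence being
extended to all of `ℕ` with period `r`. -/
def IsCircuit (X : Set A) : Prop :=
  ∃ (r : ℕ) (e : ℕ → A), 0 < r ∧ (∀ i, e (i + r) = e i) ∧
    Set.InjOn (fun i => G.src (e i)) (Set.Iio r) ∧ Set.range e = X ∧
    ∀ i, G.tgt (e i) = G.src (e (i + 1))

/-- The index of a factor: its number of cycles. -/
noncomputable def index (B : Set A) : ℕ := {X : Set A | X ⊆ B ∧ G.IsCircuit X}.ncard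

def IsHamiltonian : Prop := ∃ X, G.IsCircuit X ∧ ∀ v, ∃ a ∈ X, G.src a = v

/-- All factors have odd index. -/
def IsOdd : Prop := ∀ B, G.IsFactor B → Odd (G.index B)

/-- The open routes: the bijections from the entry vertices to the exit vertices that are
defined by a factor without cycles, `r u` being the end of the path of the factor that begins
at `u`. -/
def openRoutes : Set (G.Entry ≃ G.Exit) :=
  {r | ∃ B, G.IsFactor B ∧ G.index B = 0 ∧
    ∀ u : G.Entry,
      Relation.ReflTransGen (fun v w => ∃ a ∈ B, G.src a = v ∧ G.tgt a = w) u.1 (r u).1}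

/-- The open routes as permutations, for a labelling `ε` of the entry vertices and a labelling
`δ` of the exit vertices. -/
def routePerms {n : ℕ} (ε : G.Entry ≃ Fin n) (δ : G.Exit ≃ Fin n) : Set (Equiv.Perm (Fin n)) :=
  {p | ∃ r ∈ G.openRoutes, p = ε.symm.trans (r.trans δ)}

/-- 2-digraphs all of whose alternating cycles have 6 arcs. -/
def InPartial6 : Prop := G.IsKDigraph 2 ∧ G.AllACsHaveSize 6

/-- 2-dds all of whose alternating cycles have 6 arcs. -/
def InFull6 : Prop := G.IsKDiregular 2 ∧ G.AllACsHaveSize 6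

/-- Identify vertices along a relation. -/
def identify (R : V → V → Prop) : MultiDigraph (Quot R) A where
  src a := Quot.mk R (G.src a)
  tgt a := Quot.mk R (G.tgt a)

/-- Disjoint union. -/
def disjUnion (H : MultiDigraph V' A') : MultiDigraph (V ⊕ V') (A ⊕ A') where
  src := Sum.map G.src H.src
  tgt := Sum.map G.tgt H.tgt

end Basic

end MultiDigraph

/-! ### Residues of sets of permutations -/

section Residue

variable {n : ℕ}

/-- The permutations with a single cycle and no fixed points (for `n = 1`, the identity). -/
def cyclicPerms (n : ℕ) : Set (Equiv.Perm (Fin n)) := {c | c.IsCycleOn Set.univ}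

def IsEvenSet (P : Set (Equiv.Perm (Fin n))) : Prop := ∀ p ∈ P, Equiv.Perm.sign p = 1

def IsOddSet (P : Set (Equiv.Perm (Fin n))) : Prop := ∀ p ∈ P, Equiv.Perm.sign p = -1

def IsUniformSet (P : Set (Equiv.Perm (Fin n))) : Prop :=
  P.Nonempty ∧ (IsEvenSet P ∨ IsOddSet P)

/-- The excluded set `P⁻¹ Cₙ`. -/
def excludedSet (P : Set (Equiv.Perm (Fin n))) : Set (Equiv.Perm (Fin n)) :=
  {x | ∃ p ∈ P, ∃ c ∈ cyclicPerms n, x = p⁻¹ * c}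

open Classical in
/-- The residue of a uniform set `P`: the odd permutations outside the excluded set if `P` and `n`
have the same parity, the even permutations outside the excluded set otherwise. -/
noncomputable def residue (P : Set (Equiv.Perm (Fin n))) : Set (Equiv.Perm (Fin n)) :=
  if (IsEvenSet P ↔ Even n) then {x | Equiv.Perm.sign x = -1} \ excludedSet P
  else {x | Equiv.Perm.sign x = 1} \ excludedSet P

end Residue

/-! ### Collapsing and replacing a subgraph -/

namespace MultiDigraph

universe v₁ v₂ v₃ v₄

variable {V : Type v₁} {A : Type v₂} {V' : Type v₃} {A' : Type v₄}

/-- Collapse the subgraph `F = G.sub K` along the route `r` of `F`: in the complementary subgraph,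
identify each entry vertex `u` of `F` with the exit vertex `r u` of `F`. -/
def collapse (G : MultiDigraph V A) (K : Set (Set A)) (r : (G.sub K).Entry ≃ (G.sub K).Exit) :=
  (G.sub (G.acs \ K)).identify fun x y => ∃ u, x.1 = u.1.1 ∧ y.1 = (r u).1.1

/-- Replace the subgraph `F = G.sub K` by the graph `F'`: in the disjoint union of the complementary
subgraph and `F'`, identify each entry vertex `u` of `F'` with the entry vertex `α u` of `F` and
each exit vertex `w` of `F'` with the exit vertex `β w` of `F`. -/
def replace (G : MultiDigraph V A) (K : Set (Set A)) (F' : MultiDigraph V' A')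
    (α : F'.Entry ≃ (G.sub K).Entry) (β : F'.Exit ≃ (G.sub K).Exit) :=
  ((G.sub (G.acs \ K)).disjUnion F').identify fun x y =>
    ∃ z, x = Sum.inl z ∧
      ((∃ u, y = Sum.inr u.1 ∧ z.1 = (α u).1.1) ∨ (∃ w, y = Sum.inr w.1 ∧ z.1 = (β w).1.1))

/-- `F` and `F'` have open route sets (uniform sets of permutations) with equal residues, when
their entry and exit vertices are matched through `α` and `β`. -/
def SameResidue {U B U' B' : Type*} (F : MultiDigraph U B) (F' : MultiDigraph U' B')
    (α : F'.Entry ≃ F.Entry) (β : F'.Exit ≃ F.Exit) : Prop :=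
  ∀ (n : ℕ) (ε : F.Entry ≃ Fin n) (δ : F.Exit ≃ Fin n),
    IsUniformSet (F.routePerms ε δ) ∧ IsUniformSet (F'.routePerms (α.trans ε) (β.trans δ)) ∧
      residue (F.routePerms ε δ) = residue (F'.routePerms (α.trans ε) (β.trans δ))

/-- The set `K` of alternating cycles contains two that share more than two saturated vertices,
that is, it has a 2-AC subgraph with more than two saturated vertices. -/
def HasReducibleTwoACSubgraph (G : MultiDigraph V A) (K : Set (Set A)) : Prop :=
  ∃ K' ⊆ K, K'.ncard = 2 ∧ 2 < Nat.card (G.sub K').Sat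

/-- `G'` is an odd 2-dd with 6-arc alternating cycles that is H-equivalent to `G`. -/
def IsOddHEquivalent (G : MultiDigraph V A) (G' : MultiDigraph V' A') : Prop :=
  G'.InFull6 ∧ G'.IsOdd ∧ (G.IsHamiltonian ↔ G'.IsHamiltonian)

end MultiDigraph

/-!
A 2-digraph all of whose alternating cycles have six arcs is encoded by *slots*: an alternating
cycle with six arcs has three start-vertices and three end-vertices, both numbered by the slots
`(X, k)`, `k : Fin 3`, of a row, such that the two arcs from the start-vertex of `(X, k)` lead to
the end-vertices of `(X, k)` and `(X, k + 1)` (`SlotModel`, `exists_slotModel`). The saturated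
vertices are the *links*, at which an end-vertex of one slot is a start-vertex of another. In a
2-diregular digraph the links form a permutation `c` of the slots. A factor is a choice `z`, for
every row, between the identity and the rotation of the row; together these form the permutation
`turn ρ z`, and the cycles of the factor are the orbits of `c * turn ρ z`
(`IsGluing.index_fac`). Since a rotation of a row is a 3-cycle, the parity of the index does not
depend on `z`, so that oddness is a condition on the sign of `c`.

Identifying the exit vertices of the subgraph `F` with its entry vertices extends the links of `F`
to a permutation of its slots (`IsClosing`). A permutation `x` of labels lies in the residue exactly
if the corresponding closing of `F` has the right parity but no Hamiltonian factor
(`IsClosing.mem_residue_iff`). If `F` has three alternating cycles and at least five links, all of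
them between different rows and at most two between the same two rows, then at most one even
permutation of the nine slots extends the links and has no Hamiltonian factor
(`eq_of_neverSingle`). Up to symmetry this concerns a moderate number of configurations of five links,
with twelve extensions each, and is decided by evaluation (`SlotCheck.check_eq_true`). Consequently `F` has open
routes, all of the same parity, and its residue has at most one element.

There are at most six links, and `F` has `n = 9 - s` entry and exit vertices. If `n = 4`, a
substitute is found among the pairs of alternating cycles with two links: one such pair has an empty
residue (`exists_noneBad_four`), another one has a residue with one element (`exists_oneBad_four`).
If `n = 3` and the residue is empty, a single alternating cycle is a substitute
(`exists_noneBad_three`). If `n = 3` and `x` lies in the residue, then `p * x` is an even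
permutation of three labels but not a 3-cycle for every open route `p`, hence `p = x⁻¹`
(`eq_inv_of_mem_residue`): the open route is unique and `F` can be collapsed. In the other cases,
relabelling the exit vertices of the substitute makes both residues and the parities of the open
routes agree (`AtMostOneBad.exists_sameResidue`).

The new digraph is odd because oddness depends on the parities of the open routes of the two parts
only. It is H-equivalent to the old one because a Hamiltonian circuit consists of an open route `p`
of `F` and an open route `x` of the complement with `p * x` an `n`-cycle, and by oddness `p * x` has
the parity of an `n`-cycle anyway: a Hamiltonian circuit exists exactly if some open route of the
complement is not in the residue of `F` (`IsGlue.exists_isSingleOrbit_iff_residue`).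
-/

/-! ### Orbits of a permutation and its sign -/

namespace Equiv.Perm

variable {α β : Type*}

/-- The number of orbits of a permutation, fixed points included. -/
noncomputable def numOrbits (φ : Perm α) : ℕ := Nat.card (Quotient (SameCycle.setoid φ))

/-- The permutation has at most one orbit. -/
def IsSingleOrbit (φ : Perm α) : Prop := ∀ x y, φ.SameCycle x y

/-- The sign of a permutation of a finite type, expressed by the number of its orbits, so that no
decidability instance is involved. -/
noncomputable def parity (φ : Perm α) : ℤˣ := (-1) ^ (Nat.card α + φ.numOrbits)

theorem sameCycle_apply_self (φ : Perm α) (x : α) : φ.SameCycle x (φ x) :=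
  ⟨1, by simp⟩

/-- A map that sends every step of `φ` into an orbit of `ψ` sends orbits into orbits. -/
theorem SameCycle.map_of_forall_step {φ : Perm α} {ψ : Perm β} (k : α → β)
    (hk : ∀ x, ψ.SameCycle (k x) (k (φ x))) {x y : α} (hxy : φ.SameCycle x y) :
    ψ.SameCycle (k x) (k y) := by
  obtain ⟨n, rfl⟩ := hxy
  induction n using Int.induction_on with
  | zero => exact SameCycle.refl _ _
  | succ n ih =>
    refine ih.trans ?_
    have : (φ ^ ((n : ℤ) + 1)) x = φ ((φ ^ (n : ℤ)) x) := by
      rw [add_comm, zpow_add, zpow_one, mul_apply]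
    rw [this]
    exact hk _
  | pred n ih =>
    refine ih.trans ?_
    have : (φ ^ (-(n : ℤ))) x = φ ((φ ^ (-(n : ℤ) - 1)) x) := by
      rw [← mul_apply, ← zpow_one_add]
      congr 2
      ring
    rw [this]
    exact (hk _).symm

/-- Two permutations whose orbits are matched by maps in both directions have equally many
orbits. Following a permutation until it meets a given set, for instance, gives such a pair. -/
theorem orbit_reduction {φ : Perm α} {ψ : Perm β} (i : β → α) (π : α → β)
    (h₁ : ∀ x, φ.SameCycle x (i (π x))) (h₂ : ∀ x, ψ.SameCycle (π x) (π (φ x)))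
    (h₃ : ∀ y, φ.SameCycle (i y) (i (ψ y))) (h₄ : ∀ y, ψ.SameCycle (π (i y)) y) :
    φ.numOrbits = ψ.numOrbits ∧ (φ.IsSingleOrbit ↔ ψ.IsSingleOrbit) := by
  have hπ : ∀ x y, φ.SameCycle x y → ψ.SameCycle (π x) (π y) := fun x y h =>
    h.map_of_forall_step π h₂
  have lift' : ∀ x y, ψ.SameCycle x y → φ.SameCycle (i x) (i y) := fun x y h =>
    h.map_of_forall_step i h₃
  refine ⟨?_, fun h x y => ?_, fun h x y => ?_⟩
  · refine Nat.card_congr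
      { toFun := Quotient.map π hπ
        invFun := Quotient.map i lift'
        left_inv := ?_
        right_inv := ?_ }
    · rintro ⟨x⟩
      exact Quotient.sound (h₁ x).symm
    · rintro ⟨y⟩
      exact Quotient.sound (h₄ y)
  · exact (h₄ x).symm.trans ((hπ _ _ (h _ _)).trans (h₄ y))
  · exact (h₁ x).trans ((lift' _ _ (h _ _)).trans (h₁ y).symm)

/-- Conjugate permutations have the same orbit structure. -/
theorem orbit_reduction_conj {φ : Perm α} {ψ : Perm β} (e : α ≃ β)
    (h : ∀ x, e (φ x) = ψ (e x)) :
    φ.numOrbits = ψ.numOrbits ∧ (φ.IsSingleOrbit ↔ ψ.IsSingleOrbit) := by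
  refine orbit_reduction e.symm e (fun x => ?_) (fun x => ?_) (fun y => ?_) (fun y => ?_)
  · rw [e.symm_apply_apply]
  · rw [h]
    exact sameCycle_apply_self _ _
  · have : e.symm (ψ y) = φ (e.symm y) := by
      apply e.injective
      simp [h]
    rw [this]
    exact sameCycle_apply_self _ _
  · rw [e.apply_symm_apply]

/-- It is enough that one point does not return too early. -/
theorem isSingleOrbit_of_iterate_ne [Finite α] {φ : Perm α} (x : α)
    (h : ∀ k, 0 < k → k < Nat.card α → φ^[k] x ≠ x) : φ.IsSingleOrbit := by
  have hall : ∀ y, φ.SameCycle x y := by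
    have hinj : Function.Injective fun k : Fin (Nat.card α) => φ^[(k : ℕ)] x := by
      have hlt : ∀ a b : Fin (Nat.card α), a < b → φ^[(a : ℕ)] x ≠ φ^[(b : ℕ)] x := by
        intro a b hab h'
        refine h (b - a) (by omega) (by omega) ?_
        apply (φ.injective.iterate (a : ℕ))
        rw [← Function.iterate_add_apply, Nat.add_sub_cancel' (by omega), h']
      intro a b hab
      rcases lt_trichotomy a b with h' | h' | h'
      · exact absurd hab (hlt _ _ h')
      · exact h'
      · exact absurd hab.symm (hlt _ _ h')
    have hsurj := ((Nat.bijective_iff_injective_and_card _).2 ⟨hinj, Nat.card_fin _⟩).2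
    intro y
    obtain ⟨k, hk⟩ := hsurj y
    exact ⟨(k : ℕ), by rw [← hk, zpow_natCast, ← iterate_eq_pow]⟩
  exact fun y z => (hall y).symm.trans (hall z)

theorem numOrbits_eq_one [Nonempty α] {φ : Perm α} (h : φ.IsSingleOrbit) :
    φ.numOrbits = 1 := by
  obtain ⟨a⟩ := ‹Nonempty α›
  rw [numOrbits, Nat.card_eq_one_iff_exists]
  refine ⟨Quotient.mk _ a, ?_⟩
  rintro ⟨y⟩
  exact Quotient.sound (h y a)

/-- The orbits are the nontrivial cycles and the fixed points. -/
theorem numOrbits_eq_card [Fintype α] [DecidableEq α] (φ : Perm α) :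
    φ.numOrbits = φ.cycleFactorsFinset.card + (Fintype.card α - φ.support.card) := by
  classical
  let g : α → Perm α ⊕ α := fun x => if φ x = x then Sum.inr x else Sum.inl (φ.cycleOf x)
  have hker : SameCycle.setoid φ = Setoid.ker g := by
    ext x y
    change φ.SameCycle x y ↔ g x = g y
    constructor
    · intro h
      by_cases hx : φ x = x
      · have : x = y := h.eq_of_left hx
        rw [this]
      · have hy : ¬ φ y = y := fun hy => hx (h.apply_eq_self_iff.2 hy)
        simp only [g, hx, hy, if_false, Sum.inl.injEq]
        exact h.cycleOf_eq
    · intro h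
      by_cases hx : φ x = x
      · by_cases hy : φ y = y
        · simp only [g, hx, hy, if_true, Sum.inr.injEq] at h
          exact h ▸ SameCycle.refl _ _
        · simp [g, hx, hy] at h
      · by_cases hy : φ y = y
        · simp [g, hx, hy] at h
        · simp only [g, hx, hy, if_false, Sum.inl.injEq] at h
          exact (sameCycle_iff_cycleOf_eq_of_mem_support (mem_support.2 hx)
            (mem_support.2 hy)).2 h
  have hrange : Set.range g =
      ((φ.cycleFactorsFinset.disjSum (Finset.univ \ φ.support) : Finset (Perm α ⊕ α)) :
        Set (Perm α ⊕ α)) := by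
    ext s
    rw [Finset.mem_coe]
    constructor
    · rintro ⟨x, rfl⟩
      by_cases hx : φ x = x
      · simp [g, hx]
      · simp only [g, hx, if_false, Finset.inl_mem_disjSum]
        exact cycleOf_mem_cycleFactorsFinset_iff.2 (mem_support.2 hx)
    · intro h
      rcases s with c | x
      · rw [Finset.inl_mem_disjSum] at h
        obtain ⟨x, hx⟩ := (mem_cycleFactorsFinset_iff.1 h).1.nonempty_support
        have hxs := mem_cycleFactorsFinset_support_le h hx
        refine ⟨x, ?_⟩
        rw [mem_support] at hxs
        simp only [g, hxs, if_false, Sum.inl.injEq]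
        exact (cycle_is_cycleOf hx h).symm
      · rw [Finset.inr_mem_disjSum] at h
        refine ⟨x, ?_⟩
        have : φ x = x := by simpa using h
        simp [g, this]
  rw [numOrbits, hker, Nat.card_congr (Setoid.quotientKerEquivRange g), hrange, Nat.card_coe_set_eq,
    Set.ncard_coe_finset, Finset.card_disjSum, Finset.card_sdiff_of_subset (Finset.subset_univ _),
    Finset.card_univ]

theorem parity_eq_sign [Fintype α] [DecidableEq α] (φ : Perm α) : φ.parity = sign φ := by
  have h₁ : φ.support.card ≤ Fintype.card α := Finset.card_le_univ _
  rw [parity, numOrbits_eq_card, sign_of_cycleType, sum_cycleType, Nat.card_eq_fintype_card]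
  have h₂ : Multiset.card φ.cycleType = φ.cycleFactorsFinset.card := by
    rw [cycleType_def, Multiset.card_map]
    rfl
  rw [h₂]
  obtain ⟨k, hk⟩ := Nat.exists_eq_add_of_le h₁
  rw [hk, Nat.add_sub_cancel_left]
  have : φ.support.card + k + (φ.cycleFactorsFinset.card + k) =
      (φ.support.card + φ.cycleFactorsFinset.card) + 2 * k := by ring
  rw [this, pow_add, pow_mul]
  simp

theorem parity_mul [Finite α] (φ ψ : Perm α) : (φ * ψ).parity = φ.parity * ψ.parity := by
  classical
  have := Fintype.ofFinite α
  simp only [parity_eq_sign, sign_mul]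

theorem parity_of_pow_three [Finite α] {φ : Perm α} (h : φ * φ * φ = 1) : φ.parity = 1 := by
  classical
  have := Fintype.ofFinite α
  have h' := congrArg sign h
  simp only [sign_mul, sign_one] at h'
  rw [parity_eq_sign]
  rcases Int.units_eq_one_or (sign φ) with h₁ | h₁
  · exact h₁
  · rw [h₁] at h'
    simp at h'

theorem parity_conj {φ : Perm α} {ψ : Perm β} (e : α ≃ β) (h : ∀ x, e (φ x) = ψ (e x)) :
    φ.parity = ψ.parity := by
  rw [parity, parity, (orbit_reduction_conj e h).1, Nat.card_congr e]

/-- If the number of orbits is odd, the parity is opposite to that of the degree. -/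
theorem odd_numOrbits_iff (φ : Perm α) :
    Odd φ.numOrbits ↔ φ.parity = -(-1) ^ Nat.card α := by
  rw [parity, pow_add]
  rcases Nat.even_or_odd φ.numOrbits with h | h
  · rw [h.neg_one_pow, mul_one]
    constructor
    · intro h'
      exact absurd h (Nat.not_even_iff_odd.2 h')
    · intro h'
      exact absurd h' (by rcases neg_one_pow_eq_or ℤˣ (Nat.card α) with h | h <;> rw [h] <;> decide)
  · simp [h, h.neg_one_pow]

end Equiv.Perm

theorem mem_cyclicPerms_iff {n : ℕ} (c : Equiv.Perm (Fin n)) :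
    c ∈ cyclicPerms n ↔ c.IsSingleOrbit := by
  constructor
  · intro h x y
    exact h.2 (Set.mem_univ _) (Set.mem_univ _)
  · intro h
    exact ⟨c.bijective.bijOn_univ, fun x _ y _ => h x y⟩

/-! ### Choosing a matching in every alternating cycle -/

section Turn

open Equiv

variable {S : Type*}

/-- A choice of one of two alternatives for every cycle of `ρ`. -/
abbrev CycleChoice (ρ : Perm S) : Type _ := {z : S → Bool // ∀ x, z (ρ x) = z x}

/-- The permutation that agrees with `ρ` on the chosen cycles and fixes all other points. -/
def turn (ρ : Perm S) (z : CycleChoice ρ) : Perm S where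
  toFun x := bif z.1 x then ρ x else x
  invFun x := bif z.1 x then ρ.symm x else x
  left_inv x := by
    cases h : z.1 x <;> simp [h, z.2]
  right_inv x := by
    have h' : z.1 (ρ.symm x) = z.1 x := by
      rw [← z.2 (ρ.symm x), ρ.apply_symm_apply]
    cases h : z.1 x <;> simp [h, h']

theorem turn_apply (ρ : Perm S) (z : CycleChoice ρ) (x : S) :
    turn ρ z x = bif z.1 x then ρ x else x := rfl

/-- A turn is a product of disjoint 3-cycles. -/
theorem parity_turn [Finite S] {ρ : Perm S} (hρ : ∀ x, ρ (ρ (ρ x)) = x) (z : CycleChoice ρ) :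
    (turn ρ z).parity = 1 := by
  apply Perm.parity_of_pow_three
  ext x
  cases h : z.1 x <;> simp [turn_apply, h, z.2, hρ]

theorem parity_mul_turn [Finite S] {ρ : Perm S} (hρ : ∀ x, ρ (ρ (ρ x)) = x) (c : Perm S)
    (z : CycleChoice ρ) : (c * turn ρ z).parity = c.parity := by
  rw [Perm.parity_mul, parity_turn hρ, mul_one]

/-- No choice makes `c` composed with the turns a single cycle. -/
def NeverSingle (ρ c : Perm S) : Prop := ∀ z : CycleChoice ρ, ¬ (c * turn ρ z).IsSingleOrbit

/-- The rotation of every row of a table with three columns. -/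
def rotRow (J : Type*) : Perm (J × Fin 3) where
  toFun x := (x.1, x.2 + 1)
  invFun x := (x.1, x.2 - 1)
  left_inv x := by simp
  right_inv x := by simp

@[simp]
theorem rotRow_apply {J : Type*} (x : J × Fin 3) : rotRow J x = (x.1, x.2 + 1) := rfl

theorem rotRow_three {J : Type*} (x : J × Fin 3) : rotRow J (rotRow J (rotRow J x)) = x := by
  obtain ⟨j, k⟩ := x
  simp only [rotRow_apply, Prod.mk.injEq, true_and]
  revert k
  decide

/-- A choice for every row of a table. -/
def rowChoice {J : Type*} (z : J → Bool) : CycleChoice (rotRow J) := ⟨fun x => z x.1, fun _ => rfl⟩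

end Turn

section Conj

open Equiv

variable {S S' : Type*}

theorem NeverSingle.conj {ρ c : Perm S} {ρ' c' : Perm S'} (e : S' ≃ S)
    (hρ : ∀ x, e (ρ' x) = ρ (e x)) (hc : ∀ x, e (c' x) = c (e x)) (h : NeverSingle ρ c) :
    NeverSingle ρ' c' := by
  intro z hz
  have hz' : ∀ x, z.1 (e.symm (ρ x)) = z.1 (e.symm x) := by
    intro x
    obtain ⟨x, rfl⟩ := e.surjective x
    rw [← hρ, e.symm_apply_apply, e.symm_apply_apply, z.2]
  refine h ⟨fun x => z.1 (e.symm x), hz'⟩ ?_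
  refine (Perm.orbit_reduction_conj e fun x => ?_).2.1 hz
  rw [Perm.mul_apply, Perm.mul_apply, hc, turn_apply, turn_apply]
  congr 1
  simp only [e.symm_apply_apply]
  cases z.1 x
  · rfl
  · exact hρ x

end Conj

open Equiv

/-! ### A finite check on nine slots

The slot in row `j` and column `k` is coded by the number `6 * (3 * j + k)`, and a permutation of
the nine slots by a number of 54 bits, in which the image of the slot with code `s` occupies the
six bits that begin at position `s`. Recursors and bit operations are used in place of the usual
functions because the kernel evaluates them fast. -/

namespace SlotCheck

/-- The value `k n`. The case distinction makes the kernel evaluate `n` before it unfolds `k`. -/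
def force (n : ℕ) (k : ℕ → Bool) : Bool := Nat.casesOn n (k 0) fun n => k (n + 1)

/-- The image of the slot `s` under the map with code `m`. -/
def look (m s : ℕ) : ℕ := Nat.land (Nat.shiftRight m s) 63

/-- Under repeated application of the map with code `f` followed by the map with code `m`, the given
slot is not sent to `0` in the first `fuel` rounds. -/
def walk (m f : ℕ) (fuel : ℕ) : ℕ → Bool :=
  Nat.rec (fun _ => true)
    (fun _ ih s => Nat.casesOn (look m (look f s)) false fun n => ih (n + 1)) fuel

/-- The codes of the eight turns of three rows, see `turnCodes_spec`. -/
def turnCodes : List ℕ :=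
  [13698023356416384, 10347124231815552, 13698010573750656, 10347111449149824,
    13698023356367622, 10347124231766790, 13698010573701894, 10347111449101062]

/-- The permutation with code `m` composed with any of the turns is not a single 9-cycle. -/
def noCycle (m : ℕ) : Bool := turnCodes.all fun f => !walk m f 8 0

/-- The test `g` fails for all entries of the list. -/
def noneTrue {ι : Type*} (g : ι → Bool) : List ι → Bool :=
  List.rec true fun a _ ih => bif g a then false else ih

/-- The test `g` succeeds for at most one entry of the list. -/
def atMostOne {ι : Type*} (g : ι → Bool) : List ι → Bool :=
  List.rec true fun a l ih => bif g a then noneTrue g l else ih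

/-- The even rearrangements of four objects. -/
def evens {ι : Type*} (a b c d : ι) : List (ι × ι × ι × ι) :=
  [(a, b, c, d), (a, c, d, b), (a, d, b, c), (b, a, d, c), (b, c, a, d), (b, d, c, a),
    (c, a, b, d), (c, b, d, a), (c, d, a, b), (d, a, c, b), (d, b, a, c), (d, c, b, a)]

/-- Of the bijections from the four slots of the first list to those of the second that have a given
sign, at most one completes the partial map with code `m` to a permutation without a single
9-cycle. The given sign is one of the two signs, the check does not say which. -/
def extensionsRigid (m : ℕ) : List ℕ → List ℕ → Bool
  | [y₀, y₁, y₂, y₃], [a, b, c, d] =>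
    let g := fun p : ℕ × ℕ × ℕ × ℕ =>
      force (m + Nat.shiftLeft p.1 y₀ + Nat.shiftLeft p.2.1 y₁ + Nat.shiftLeft p.2.2.1 y₂ +
        Nat.shiftLeft p.2.2.2 y₃) noCycle
    atMostOne g (evens a b c d) || atMostOne g (evens b a c d)
  | _, _ => false

/-- The codes of the nine slots. -/
def slots : List ℕ := [0, 6, 12, 18, 24, 30, 36, 42, 48]

/-- The slots that do not occur in the list. -/
def rest (l : List ℕ) : List ℕ := slots.filter fun s => l.all fun t => !Nat.beq s t

/-- The link `v` shares neither its beginning nor its end with any link of the list. -/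
def fits (l : List (ℕ × ℕ)) (v : ℕ × ℕ) : Bool :=
  l.all fun w => !Nat.beq w.1 v.1 && !Nat.beq w.2 v.2

/-- The check `extensionsRigid` for the partial map that consists of the listed links. -/
def linksRigid (l : List (ℕ × ℕ)) : Bool :=
  force (List.rec 0 (fun v _ ih => Nat.shiftLeft v.2 v.1 + ih) l) fun m =>
    extensionsRigid m (rest (l.map Prod.fst)) (rest (l.map Prod.snd))

/-- The links from a slot of `a` to a slot of `b`. -/
def links (a b : List ℕ) : List (ℕ × ℕ) := a.flatMap fun x => b.map fun y => (x, y)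

/-- The slots of the first row. -/
def blockA : List ℕ := [0, 6, 12]

/-- The slots of the second row. -/
def blockB : List ℕ := [18, 24, 30]

/-- The slots of the third row. -/
def blockC : List ℕ := [36, 42, 48]

/-- The check `linksRigid` for all sets of five links of which two join the first two rows, two join the
last two rows and one joins the outer rows. By symmetry, the first link of each of the two pairs is
assumed to use the first slot of certain rows, and to be directed towards the row with the higher
number unless both links of the pair are directed the other way. -/
def check : Bool :=
  [((0, 18), links blockA blockB ++ links blockB blockA),
    ((18, 0), links blockB blockA)].all fun q =>
    q.2.all fun v₂ => !fits [q.1] v₂ ||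
      [(links blockB [36], links blockB blockC ++ links blockC blockB),
        (links [36] blockB, links blockC blockB)].all fun r =>
        r.1.all fun v₃ => !fits [v₂, q.1] v₃ ||
          r.2.all fun v₄ => !fits [v₃, v₂, q.1] v₄ ||
            (links blockA blockC ++ links blockC blockA).all fun v₅ =>
              !fits [v₄, v₃, v₂, q.1] v₅ || linksRigid [v₅, v₄, v₃, v₂, q.1]

theorem check_eq_true : check = true := by
  decide +kernel

theorem force_eq (n : ℕ) (k : ℕ → Bool) : force n k = k n := by
  cases n <;> rfl

theorem noneTrue_spec {ι : Type*} {g : ι → Bool} {l : List ι} (h : noneTrue g l = true) :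
    ∀ a ∈ l, g a = false := by
  induction l with
  | nil => simp
  | cons b l ih =>
    change (bif g b then false else noneTrue g l) = true at h
    cases hb : g b
    · rw [hb] at h
      intro a ha
      rcases List.mem_cons.1 ha with rfl | ha
      · exact hb
      · exact ih h a ha
    · simp [hb] at h

theorem atMostOne_spec {ι : Type*} {g : ι → Bool} {l : List ι} (h : atMostOne g l = true) :
    ∀ a ∈ l, ∀ b ∈ l, g a = true → g b = true → a = b := by
  induction l with
  | nil => simp
  | cons e l ih =>
    change (bif g e then noneTrue g l else atMostOne g l) = true at h
    cases he : g e
    · rw [he] at h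
      intro a ha b hb hga hgb
      rcases List.mem_cons.1 ha with rfl | ha
      · simp [he] at hga
      rcases List.mem_cons.1 hb with rfl | hb
      · simp [he] at hgb
      exact ih h a ha b hb hga hgb
    · rw [he] at h
      have h' := noneTrue_spec h
      intro a ha b hb hga hgb
      rcases List.mem_cons.1 ha with rfl | ha
      · rcases List.mem_cons.1 hb with rfl | hb
        · rfl
        · simp [h' b hb] at hgb
      · simp [h' a ha] at hga

/-- The number that stands for a slot in the finite check. -/
def slotCode (p : Fin 3 × Fin 3) : ℕ := 6 * (3 * p.1 + p.2)

theorem slotCode_injective : Function.Injective slotCode := by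
  rintro ⟨a, b⟩ ⟨c, d⟩ h
  simp only [slotCode] at h
  ext <;> simp only <;> omega

theorem mem_slots_iff (s : ℕ) : s ∈ slots ↔ ∃ p, slotCode p = s := by
  constructor
  · intro h
    have : ∀ s ∈ slots, ∃ p, slotCode p = s := by decide
    exact this s h
  · rintro ⟨p, rfl⟩
    revert p
    decide

/-- The number that stands for a permutation of the slots in the finite check. -/
def permCode (c : Perm (Fin 3 × Fin 3)) : ℕ := ∑ y, Nat.shiftLeft (slotCode (c y)) (slotCode y)

theorem look_permCode (c : Perm (Fin 3 × Fin 3)) (y : Fin 3 × Fin 3) :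
    look (permCode c) (slotCode y) = slotCode (c y) := by
  have hlt : ∀ p, slotCode p < 64 := by decide
  have hl : ∀ m s, look m s = m / 2 ^ s % 64 := by
    intro m s
    change (m >>> s) &&& 63 = _
    rw [Nat.shiftRight_eq_div_pow]
    exact Nat.and_two_pow_sub_one_eq_mod _ 6
  have hs : ∀ a b, Nat.shiftLeft a b = a * 2 ^ b := fun a b => Nat.shiftLeft_eq a b
  rw [hl, permCode]
  simp only [hs, Fintype.sum_prod_type, Fin.sum_univ_three]
  have h := fun y => hlt (c y)
  have h00 := h (0, 0)
  have h01 := h (0, 1)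
  have h02 := h (0, 2)
  have h10 := h (1, 0)
  have h11 := h (1, 1)
  have h12 := h (1, 2)
  have h20 := h (2, 0)
  have h21 := h (2, 1)
  have h22 := h (2, 2)
  generalize hc : (fun y => slotCode (c y)) = d
  have hc' : ∀ y, slotCode (c y) = d y := fun y => congrFun hc y
  simp only [hc'] at *
  obtain ⟨j, k⟩ := y
  fin_cases j <;> fin_cases k <;> simp [slotCode] <;> omega

theorem turnCodes_spec : ∀ f ∈ turnCodes, ∃ z : Fin 3 → Bool,
    ∀ x, look f (slotCode x) = slotCode (turn (rotRow _) (rowChoice z) x) := by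
  decide +kernel

theorem walk_spec {m f : ℕ} {φ : Perm (Fin 3 × Fin 3)}
    (h : ∀ x, look m (look f (slotCode x)) = slotCode (φ x)) (n : ℕ) (x : Fin 3 × Fin 3)
    (hw : walk m f n (slotCode x) = true) : ∀ k, 0 < k → k ≤ n → (φ ^ k) x ≠ (0, 0) := by
  induction n generalizing x with
  | zero => intro k h₁ h₂; omega
  | succ n ih =>
    change (Nat.casesOn (look m (look f (slotCode x))) false fun i => walk m f n (i + 1)) = true
      at hw
    rw [h] at hw
    have h0 : slotCode (φ x) ≠ 0 := by
      intro h0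
      rw [h0] at hw
      simp at hw
    have hw' : walk m f n (slotCode (φ x)) = true := by
      obtain ⟨i, hi⟩ := Nat.exists_eq_succ_of_ne_zero h0
      rw [hi] at hw ⊢
      exact hw
    intro k hk hkn
    obtain ⟨k, rfl⟩ := Nat.exists_eq_succ_of_ne_zero hk.ne'
    rw [pow_succ, Perm.mul_apply]
    rcases Nat.eq_zero_or_pos k with rfl | hk'
    · intro h1
      apply h0
      simp only [pow_zero, Perm.one_apply] at h1
      rw [h1]
      rfl
    · exact ih _ hw' k hk' (by omega)

theorem noCycle_permCode {c : Perm (Fin 3 × Fin 3)} (hc : NeverSingle (rotRow _) c) :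
    noCycle (permCode c) = true := by
  rw [noCycle, List.all_eq_true]
  intro f hf
  obtain ⟨z, hz⟩ := turnCodes_spec f hf
  rw [Bool.not_eq_true']
  by_contra hw
  rw [Bool.not_eq_false] at hw
  refine hc (rowChoice z) (Perm.isSingleOrbit_of_iterate_ne (0, 0) fun k h0 hk => ?_)
  rw [Perm.iterate_eq_pow]
  refine walk_spec (fun x => by rw [hz, look_permCode]; rfl) 8 (0, 0) hw k h0 ?_
  rw [Nat.card_prod, Nat.card_fin] at hk
  omega

theorem mem_rest_iff (l : List ℕ) (s : ℕ) : s ∈ rest l ↔ s ∈ slots ∧ s ∉ l := by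
  simp only [rest, List.mem_filter, List.all_eq_true, Bool.not_eq_true', and_congr_right_iff]
  intro _
  constructor
  · intro h hs
    have := h s hs
    simp at this
  · intro h t ht
    have hne : s ≠ t := by
      rintro rfl
      exact h ht
    cases hb : Nat.beq s t
    · rfl
    · exact absurd (Nat.eq_of_beq_eq_true hb) hne

theorem nodup_rest (l : List ℕ) : (rest l).Nodup :=
  List.Nodup.filter _ (by decide)

theorem mem_evens_of_sign_eq_one : ∀ x : Perm (Fin 4), Perm.sign x = 1 →
    (x 0, x 1, x 2, x 3) ∈ evens (0 : Fin 4) 1 2 3 := by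
  decide +kernel

theorem mem_evens_of_sign_eq_neg_one : ∀ x : Perm (Fin 4), Perm.sign x = -1 →
    (x 0, x 1, x 2, x 3) ∈ evens (1 : Fin 4) 0 2 3 := by
  decide +kernel

theorem rec_eq_sum (l : List (ℕ × ℕ)) :
    (List.rec 0 (fun v _ ih => Nat.shiftLeft v.2 v.1 + ih) l : ℕ) =
      (l.map fun v => Nat.shiftLeft v.2 v.1).sum := by
  induction l with
  | nil => rfl
  | cons v l ih =>
    rw [List.map_cons, List.sum_cons, ← ih]

/-- Two even permutations of the slots agree if both contain the links of `l` and neither becomes a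
9-cycle by a turn. The check `extensionsRigid` is passed by one of the two classes of bijections
between the remaining slots. The class whose extensions are odd cannot be the one that passes: as a
9-cycle is even, none of the twelve extensions in that class becomes a 9-cycle. -/
theorem eq_of_linksRigid {c₁ c₂ : Perm (Fin 3 × Fin 3)} (l : List ((Fin 3 × Fin 3) × (Fin 3 × Fin 3)))
    (hl : linksRigid (l.map (Prod.map slotCode slotCode)) = true) (hnd : (l.map Prod.fst).Nodup)
    (h₁ : ∀ v ∈ l, c₁ v.1 = v.2) (h₂ : ∀ v ∈ l, c₂ v.1 = v.2)
    (hs₁ : c₁.parity = 1) (hs₂ : c₂.parity = 1)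
    (hc₁ : NeverSingle (rotRow _) c₁) (hc₂ : NeverSingle (rotRow _) c₂) : c₁ = c₂ := by
  rw [linksRigid, force_eq, rec_eq_sum, List.map_map, List.map_map, List.map_map] at hl
  generalize hY : rest (List.map (Prod.fst ∘ Prod.map slotCode slotCode) l) = Y at hl
  generalize hX : rest (List.map (Prod.snd ∘ Prod.map slotCode slotCode) l) = X at hl
  unfold extensionsRigid at hl
  split at hl
  swap
  · simp at hl
  rename_i _ _ Y₀ Y₁ Y₂ Y₃ X₀ X₁ X₂ X₃
  replace hY := hY.symm
  replace hX := hX.symm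
  have hYmem : ∀ s ∈ [Y₀, Y₁, Y₂, Y₃], ∃ p, slotCode p = s := fun s hs =>
    (mem_slots_iff s).1 ((mem_rest_iff _ _).1 (hY ▸ hs)).1
  have hXmem : ∀ s ∈ [X₀, X₁, X₂, X₃], ∃ p, slotCode p = s := fun s hs =>
    (mem_slots_iff s).1 ((mem_rest_iff _ _).1 (hX ▸ hs)).1
  obtain ⟨y₀, rfl⟩ := hYmem Y₀ (by simp)
  obtain ⟨y₁, rfl⟩ := hYmem Y₁ (by simp)
  obtain ⟨y₂, rfl⟩ := hYmem Y₂ (by simp)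
  obtain ⟨y₃, rfl⟩ := hYmem Y₃ (by simp)
  obtain ⟨x₀, rfl⟩ := hXmem X₀ (by simp)
  obtain ⟨x₁, rfl⟩ := hXmem X₁ (by simp)
  obtain ⟨x₂, rfl⟩ := hXmem X₂ (by simp)
  obtain ⟨x₃, rfl⟩ := hXmem X₃ (by simp)
  let y : Fin 4 → Fin 3 × Fin 3 := ![y₀, y₁, y₂, y₃]
  let x : Fin 4 → Fin 3 × Fin 3 := ![x₀, x₁, x₂, x₃]
  have hyl : [slotCode y₀, slotCode y₁, slotCode y₂, slotCode y₃] =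
    [y₀, y₁, y₂, y₃].map slotCode := rfl
  have hxl : [slotCode x₀, slotCode x₁, slotCode x₂, slotCode x₃] =
    [x₀, x₁, x₂, x₃].map slotCode := rfl
  have hynd : [y₀, y₁, y₂, y₃].Nodup := by
    have := nodup_rest (List.map (Prod.fst ∘ Prod.map slotCode slotCode) l)
    rw [← hY, hyl] at this
    exact this.of_map _
  have hxnd : [x₀, x₁, x₂, x₃].Nodup := by
    have := nodup_rest (List.map (Prod.snd ∘ Prod.map slotCode slotCode) l)
    rw [← hX, hxl] at this
    exact this.of_map _
  have hyinj : Function.Injective y := by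
    have : [y₀, y₁, y₂, y₃] = List.ofFn y := by simp [y, List.ofFn_succ]
    rwa [this, List.nodup_ofFn] at hynd
  have hxinj : Function.Injective x := by
    have : [x₀, x₁, x₂, x₃] = List.ofFn x := by simp [x, List.ofFn_succ]
    rwa [this, List.nodup_ofFn] at hxnd
  have hyrange : ∀ p, p ∈ [y₀, y₁, y₂, y₃] ↔ p ∉ l.map Prod.fst := by
    intro p
    rw [← List.mem_map_of_injective slotCode_injective, ← hyl, hY, mem_rest_iff, mem_slots_iff,
      ← List.map_map]
    simp only [List.map_map]
    have : List.map (Prod.fst ∘ Prod.map slotCode slotCode) l =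
        List.map slotCode (List.map Prod.fst l) := by
      rw [List.map_map]
      rfl
    rw [this, List.mem_map_of_injective slotCode_injective]
    simp
  have hxrange : ∀ p, p ∈ [x₀, x₁, x₂, x₃] ↔ p ∉ l.map Prod.snd := by
    intro p
    rw [← List.mem_map_of_injective slotCode_injective, ← hxl, hX, mem_rest_iff, mem_slots_iff]
    have : List.map (Prod.snd ∘ Prod.map slotCode slotCode) l =
        List.map slotCode (List.map Prod.snd l) := by
      rw [List.map_map]
      rfl
    rw [this, List.mem_map_of_injective slotCode_injective]
    simp
  -- the code of a permutation that extends `l`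
  have hcode : ∀ c : Perm (Fin 3 × Fin 3), (∀ v ∈ l, c v.1 = v.2) → permCode c =
      (l.map ((fun v : ℕ × ℕ => Nat.shiftLeft v.2 v.1) ∘ Prod.map slotCode slotCode)).sum +
        Nat.shiftLeft (slotCode (c y₀)) (slotCode y₀) +
        Nat.shiftLeft (slotCode (c y₁)) (slotCode y₁) +
        Nat.shiftLeft (slotCode (c y₂)) (slotCode y₂) +
        Nat.shiftLeft (slotCode (c y₃)) (slotCode y₃) := by
    intro c hc
    have hnd' : (l.map Prod.fst ++ [y₀, y₁, y₂, y₃]).Nodup := by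
      refine List.nodup_append.2 ⟨hnd, hynd, ?_⟩
      rintro a ha b hb rfl
      exact (hyrange a).1 hb ha
    have huniv : (l.map Prod.fst ++ [y₀, y₁, y₂, y₃]).toFinset = Finset.univ := by
      ext p
      simp only [List.mem_toFinset, List.mem_append, Finset.mem_univ, iff_true, hyrange p]
      exact em _
    rw [permCode, ← huniv, List.sum_toFinset _ hnd', List.map_append, List.sum_append,
      List.map_map]
    have : List.map ((fun y => Nat.shiftLeft (slotCode (c y)) (slotCode y)) ∘ Prod.fst) l =
        List.map ((fun v : ℕ × ℕ => Nat.shiftLeft v.2 v.1) ∘ Prod.map slotCode slotCode) l := by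
      apply List.map_congr_left
      intro v hv
      simp [hc v hv]
    rw [this]
    simp only [List.map_cons, List.map_nil, List.sum_cons, List.sum_nil]
    ring
  -- a permutation that extends `l` is described by a permutation of four indices
  have hrep : ∀ c : Perm (Fin 3 × Fin 3), (∀ v ∈ l, c v.1 = v.2) →
      ∃ σ : Perm (Fin 4), ∀ i, c (y i) = x (σ i) := by
    intro c hc
    have hex : ∀ i, ∃ k, c (y i) = x k := by
      intro i
      have h1 : c (y i) ∈ [x₀, x₁, x₂, x₃] := by
        rw [hxrange]
        intro hmem
        obtain ⟨v, hv, hv'⟩ := List.mem_map.1 hmem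
        have : y i = v.1 := c.injective (by rw [hc v hv, hv'])
        have h2 : y i ∈ [y₀, y₁, y₂, y₃] := by
          fin_cases i <;> simp [y]
        exact (hyrange _).1 h2 (this ▸ List.mem_map_of_mem hv)
      simp only [List.mem_cons, List.not_mem_nil, or_false] at h1
      rcases h1 with h1 | h1 | h1 | h1
      exacts [⟨0, h1⟩, ⟨1, h1⟩, ⟨2, h1⟩, ⟨3, h1⟩]
    choose σ hσ using hex
    have hinj : Function.Injective σ := by
      intro i j hij
      apply hyinj
      apply c.injective
      rw [hσ, hσ, hij]
    exact ⟨Equiv.ofBijective σ (Finite.injective_iff_bijective.1 hinj), hσ⟩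
  -- the permutations of the four indices act on the permutations that extend `l`
  let τ : Perm (Fin 4) → Perm (Fin 3 × Fin 3) := fun σ =>
    σ.extendDomain (Equiv.ofInjective y hyinj)
  have hτy : ∀ σ i, τ σ (y i) = y (σ i) := fun σ i =>
    Perm.extendDomain_apply_image σ (Equiv.ofInjective y hyinj) i
  have hτl : ∀ σ, ∀ v ∈ l, τ σ v.1 = v.1 := by
    intro σ v hv
    apply Perm.extendDomain_apply_not_subtype
    rintro ⟨i, hi⟩
    have h2 : y i ∈ [y₀, y₁, y₂, y₃] := by
      fin_cases i <;> simp [y]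
    exact (hyrange _).1 h2 (hi ▸ List.mem_map_of_mem hv)
  have hτs : ∀ σ, (τ σ).parity = Perm.sign σ := by
    intro σ
    rw [Perm.parity_eq_sign, Perm.sign_extendDomain]
  obtain ⟨σ₁, hσ₁⟩ := hrep c₁ h₁
  obtain ⟨σ₂, hσ₂⟩ := hrep c₂ h₂
  have heq : c₂ = c₁ * τ (σ₁⁻¹ * σ₂) := by
    ext1 p
    rw [Perm.mul_apply]
    by_cases hp : p ∈ [y₀, y₁, y₂, y₃]
    · have : ∃ i, p = y i := by
        simp only [List.mem_cons, List.not_mem_nil, or_false] at hp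
        rcases hp with hp | hp | hp | hp
        exacts [⟨0, hp⟩, ⟨1, hp⟩, ⟨2, hp⟩, ⟨3, hp⟩]
      obtain ⟨i, rfl⟩ := this
      rw [hσ₂, hτy, hσ₁]
      simp
    · rw [hyrange, not_not] at hp
      obtain ⟨v, hv, rfl⟩ := List.mem_map.1 hp
      rw [hτl _ v hv, h₁ v hv, h₂ v hv]
  have hsame : Perm.sign σ₁ = Perm.sign σ₂ := by
    have := congrArg Perm.parity heq
    rw [Perm.parity_mul, hs₁, hs₂, hτs, Perm.sign_mul, Perm.sign_inv, one_mul] at this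
    rcases Int.units_eq_one_or (Perm.sign σ₁) with h | h <;> rw [h] at this ⊢
    · simpa using this
    · rw [neg_one_mul] at this
      rw [this, neg_neg]
  -- `ε` is the sign of the bijections that have passed the check
  obtain ⟨ε, hε⟩ : ∃ ε : ℤˣ, ∀ (d₁ d₂ : Perm (Fin 3 × Fin 3)) (ρ₁ ρ₂ : Perm (Fin 4)),
      (∀ v ∈ l, d₁ v.1 = v.2) → (∀ v ∈ l, d₂ v.1 = v.2) →
      (∀ i, d₁ (y i) = x (ρ₁ i)) → (∀ i, d₂ (y i) = x (ρ₂ i)) →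
      NeverSingle (rotRow _) d₁ → NeverSingle (rotRow _) d₂ →
      Perm.sign ρ₁ = ε → Perm.sign ρ₂ = ε → ρ₁ = ρ₂ := by
    have key : ∀ L : List (Fin 4 × Fin 4 × Fin 4 × Fin 4),
        atMostOne (fun p : ℕ × ℕ × ℕ × ℕ =>
          force ((l.map ((fun v : ℕ × ℕ => Nat.shiftLeft v.2 v.1) ∘
              Prod.map slotCode slotCode)).sum +
            Nat.shiftLeft p.1 (slotCode y₀) + Nat.shiftLeft p.2.1 (slotCode y₁) +
            Nat.shiftLeft p.2.2.1 (slotCode y₂) +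
            Nat.shiftLeft p.2.2.2 (slotCode y₃)) noCycle)
          (L.map fun p => (slotCode (x p.1), slotCode (x p.2.1), slotCode (x p.2.2.1),
            slotCode (x p.2.2.2))) = true →
        ∀ (d₁ d₂ : Perm (Fin 3 × Fin 3)) (ρ₁ ρ₂ : Perm (Fin 4)),
          (∀ v ∈ l, d₁ v.1 = v.2) → (∀ v ∈ l, d₂ v.1 = v.2) →
          (∀ i, d₁ (y i) = x (ρ₁ i)) → (∀ i, d₂ (y i) = x (ρ₂ i)) →
          NeverSingle (rotRow _) d₁ → NeverSingle (rotRow _) d₂ →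
          (ρ₁ 0, ρ₁ 1, ρ₁ 2, ρ₁ 3) ∈ L → (ρ₂ 0, ρ₂ 1, ρ₂ 2, ρ₂ 3) ∈ L → ρ₁ = ρ₂ := by
      intro L hL d₁ d₂ ρ₁ ρ₂ hd₁ hd₂ hρ₁ hρ₂ hn₁ hn₂ hm₁ hm₂
      have h := atMostOne_spec hL _ (List.mem_map_of_mem hm₁) _ (List.mem_map_of_mem hm₂)
      have e₁ := hcode d₁ hd₁
      have e₂ := hcode d₂ hd₂
      have a₁ := fun i => hρ₁ i
      have a₂ := fun i => hρ₂ i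
      rw [show y₀ = y 0 from rfl, show y₁ = y 1 from rfl, show y₂ = y 2 from rfl,
        show y₃ = y 3 from rfl] at e₁ e₂ h
      rw [a₁ 0, a₁ 1, a₁ 2, a₁ 3] at e₁
      rw [a₂ 0, a₂ 1, a₂ 2, a₂ 3] at e₂
      simp only [force_eq] at h
      rw [← e₁, ← e₂] at h
      have h' := h (noCycle_permCode hn₁) (noCycle_permCode hn₂)
      simp only [Prod.mk.injEq, slotCode_injective.eq_iff, hxinj.eq_iff] at h'
      ext1 i
      fin_cases i
      exacts [h'.1, h'.2.1, h'.2.2.1, h'.2.2.2]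
    rw [Bool.or_eq_true] at hl
    rcases hl with hl | hl
    · refine ⟨1, fun d₁ d₂ ρ₁ ρ₂ g₁ g₂ g₃ g₄ g₅ g₆ g₇ g₈ => ?_⟩
      exact key (evens 0 1 2 3) hl d₁ d₂ ρ₁ ρ₂ g₁ g₂ g₃ g₄ g₅ g₆
        (mem_evens_of_sign_eq_one _ g₇) (mem_evens_of_sign_eq_one _ g₈)
    · refine ⟨-1, fun d₁ d₂ ρ₁ ρ₂ g₁ g₂ g₃ g₄ g₅ g₆ g₇ g₈ => ?_⟩
      exact key (evens 1 0 2 3) hl d₁ d₂ ρ₁ ρ₂ g₁ g₂ g₃ g₄ g₅ g₆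
        (mem_evens_of_sign_eq_neg_one _ g₇) (mem_evens_of_sign_eq_neg_one _ g₈)
  have hact : ∀ σ, (∀ v ∈ l, (c₁ * τ σ) v.1 = v.2) ∧ ∀ i, (c₁ * τ σ) (y i) = x ((σ₁ * σ) i) := by
    refine fun σ => ⟨fun v hv => ?_, fun i => ?_⟩
    · rw [Perm.mul_apply, hτl _ v hv, h₁ v hv]
    · rw [Perm.mul_apply, hτy, hσ₁, Perm.mul_apply]
  have hodd : ∀ σ, Perm.sign σ = -1 → NeverSingle (rotRow _) (c₁ * τ σ) := by
    intro σ hσ z hz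
    have hp : (c₁ * τ σ * turn (rotRow (Fin 3)) z).parity = -1 := by
      rw [parity_mul_turn rotRow_three, Perm.parity_mul, hs₁, hτs, hσ, one_mul]
    rw [Perm.parity, Perm.numOrbits_eq_one hz, Nat.card_eq_fintype_card] at hp
    revert hp
    decide
  by_cases hcl : Perm.sign σ₁ = ε
  · have := hε c₁ c₂ σ₁ σ₂ h₁ h₂ hσ₁ hσ₂ hc₁ hc₂ hcl (hsame ▸ hcl)
    rw [heq, this, inv_mul_cancel]
    ext1 p
    have : τ 1 = 1 := Perm.extendDomain_one _
    rw [this, mul_one]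
  · have hneg : ∀ σ : Perm (Fin 4), Perm.sign σ = -1 → Perm.sign (σ₁ * σ) = ε := by
      intro σ hσ
      rw [Perm.sign_mul, hσ]
      rcases Int.units_eq_one_or (Perm.sign σ₁) with h | h <;>
        rcases Int.units_eq_one_or ε with h' | h' <;> rw [h, h'] at hcl ⊢ <;>
        first | exact absurd rfl hcl | decide
    have s01 : Perm.sign (Equiv.swap (0 : Fin 4) 1) = -1 := Perm.sign_swap (by decide)
    have s02 : Perm.sign (Equiv.swap (0 : Fin 4) 2) = -1 := Perm.sign_swap (by decide)
    have := hε _ _ _ _ (hact (Equiv.swap 0 1)).1 (hact (Equiv.swap 0 2)).1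
      (hact (Equiv.swap 0 1)).2 (hact (Equiv.swap 0 2)).2 (hodd _ s01) (hodd _ s02)
      (hneg _ s01) (hneg _ s02)
    have h01 := congrArg (fun f => f 0) (mul_left_cancel this)
    simp at h01

theorem mem_links {a b : List ℕ} {v : ℕ × ℕ} : v ∈ links a b ↔ v.1 ∈ a ∧ v.2 ∈ b := by
  obtain ⟨x, y⟩ := v
  simp [links]

theorem slotCode_mem_blockA : ∀ p, p.1 = 0 → slotCode p ∈ blockA := by decide

theorem slotCode_mem_blockB : ∀ p, p.1 = 1 → slotCode p ∈ blockB := by decide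

theorem slotCode_mem_blockC : ∀ p, p.1 = 2 → slotCode p ∈ blockC := by decide

theorem fits_eq_true (l : List ((Fin 3 × Fin 3) × (Fin 3 × Fin 3)))
    (v : (Fin 3 × Fin 3) × (Fin 3 × Fin 3)) (h : ∀ w ∈ l, w.1 ≠ v.1 ∧ w.2 ≠ v.2) :
    fits (l.map (Prod.map slotCode slotCode)) (Prod.map slotCode slotCode v) = true := by
  have hb : ∀ p q, p ≠ q → Nat.beq (slotCode p) (slotCode q) = false := by
    intro p q hpq
    cases hb : Nat.beq (slotCode p) (slotCode q)
    · rfl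
    · exact absurd (slotCode_injective (Nat.eq_of_beq_eq_true hb)) hpq
  rw [fits, List.all_eq_true]
  intro w hw
  obtain ⟨w, hw', rfl⟩ := List.mem_map.1 hw
  simp only [Prod.map_fst, Prod.map_snd]
  rw [hb _ _ (h w hw').1, hb _ _ (h w hw').2]
  rfl

/-- The part of `check_eq_true` that concerns the five given links. -/
theorem linksRigid_eq_true {v₁ v₂ v₃ v₄ v₅ : (Fin 3 × Fin 3) × (Fin 3 × Fin 3)}
    (h12 : v₁ = ((0, 0), (1, 0)) ∧ (v₂.1.1 = 0 ∧ v₂.2.1 = 1 ∨ v₂.1.1 = 1 ∧ v₂.2.1 = 0) ∨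
      v₁ = ((1, 0), (0, 0)) ∧ v₂.1.1 = 1 ∧ v₂.2.1 = 0)
    (h34 : (v₃.1.1 = 1 ∧ v₃.2 = (2, 0)) ∧
        (v₄.1.1 = 1 ∧ v₄.2.1 = 2 ∨ v₄.1.1 = 2 ∧ v₄.2.1 = 1) ∨
      (v₃.1 = (2, 0) ∧ v₃.2.1 = 1) ∧ v₄.1.1 = 2 ∧ v₄.2.1 = 1)
    (h5 : v₅.1.1 = 0 ∧ v₅.2.1 = 2 ∨ v₅.1.1 = 2 ∧ v₅.2.1 = 0)
    (hf₂ : ∀ w ∈ [v₁], w.1 ≠ v₂.1 ∧ w.2 ≠ v₂.2)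
    (hf₃ : ∀ w ∈ [v₂, v₁], w.1 ≠ v₃.1 ∧ w.2 ≠ v₃.2)
    (hf₄ : ∀ w ∈ [v₃, v₂, v₁], w.1 ≠ v₄.1 ∧ w.2 ≠ v₄.2)
    (hf₅ : ∀ w ∈ [v₄, v₃, v₂, v₁], w.1 ≠ v₅.1 ∧ w.2 ≠ v₅.2) :
    linksRigid ([v₅, v₄, v₃, v₂, v₁].map (Prod.map slotCode slotCode)) = true := by
  have hc := check_eq_true
  have A := slotCode_mem_blockA
  have B := slotCode_mem_blockB
  have C := slotCode_mem_blockC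
  let k : (Fin 3 × Fin 3) × (Fin 3 × Fin 3) → ℕ × ℕ := Prod.map slotCode slotCode
  have hq : ∃ q ∈ [((0, 18), links blockA blockB ++ links blockB blockA),
      ((18, 0), links blockB blockA)], q.1 = k v₁ ∧ k v₂ ∈ q.2 := by
    rcases h12 with ⟨rfl, h⟩ | ⟨rfl, h⟩
    · refine ⟨_, List.mem_cons_self, rfl, ?_⟩
      rw [List.mem_append, mem_links, mem_links]
      exact h.imp (fun h => ⟨A _ h.1, B _ h.2⟩) (fun h => ⟨B _ h.1, A _ h.2⟩)
    · refine ⟨_, List.mem_cons_of_mem _ List.mem_cons_self, rfl, ?_⟩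
      rw [mem_links]
      exact ⟨B _ h.1, A _ h.2⟩
  have hr : ∃ r ∈ [(links blockB [36], links blockB blockC ++ links blockC blockB),
      (links [36] blockB, links blockC blockB)], k v₃ ∈ r.1 ∧ k v₄ ∈ r.2 := by
    rcases h34 with ⟨⟨h, h'⟩, h''⟩ | ⟨⟨h, h'⟩, h''⟩
    · refine ⟨_, List.mem_cons_self, ?_, ?_⟩
      · rw [mem_links]
        refine ⟨B _ h, ?_⟩
        change slotCode v₃.2 ∈ [36]
        rw [h']
        decide
      · rw [List.mem_append, mem_links, mem_links]
        exact h''.imp (fun h => ⟨B _ h.1, C _ h.2⟩) (fun h => ⟨C _ h.1, B _ h.2⟩)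
    · refine ⟨_, List.mem_cons_of_mem _ List.mem_cons_self, ?_, ?_⟩
      · rw [mem_links]
        refine ⟨?_, B _ h'⟩
        change slotCode v₃.1 ∈ [36]
        rw [h]
        decide
      · rw [mem_links]
        exact ⟨C _ h''.1, B _ h''.2⟩
  have h5' : k v₅ ∈ links blockA blockC ++ links blockC blockA := by
    rw [List.mem_append, mem_links, mem_links]
    exact h5.imp (fun h => ⟨A _ h.1, C _ h.2⟩) (fun h => ⟨C _ h.1, A _ h.2⟩)
  have f₂ := fits_eq_true _ _ hf₂
  have f₃ := fits_eq_true _ _ hf₃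
  have f₄ := fits_eq_true _ _ hf₄
  have f₅ := fits_eq_true _ _ hf₅
  obtain ⟨q, hq, hq1, hq2⟩ := hq
  obtain ⟨r, hr, hr1, hr2⟩ := hr
  rw [check, List.all_eq_true] at hc
  have hc := hc q hq
  rw [List.all_eq_true] at hc
  have hc := hc _ hq2
  rw [hq1] at hc
  rw [Bool.or_eq_true, Bool.not_eq_true'] at hc
  have hc := hc.resolve_left (by rw [Bool.not_eq_false]; exact f₂)
  rw [List.all_eq_true] at hc
  have hc := hc r hr
  rw [List.all_eq_true] at hc
  have hc := hc _ hr1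
  rw [Bool.or_eq_true, Bool.not_eq_true'] at hc
  have hc := hc.resolve_left (by rw [Bool.not_eq_false]; exact f₃)
  rw [List.all_eq_true] at hc
  have hc := hc _ hr2
  rw [Bool.or_eq_true, Bool.not_eq_true'] at hc
  have hc := hc.resolve_left (by rw [Bool.not_eq_false]; exact f₄)
  rw [List.all_eq_true] at hc
  have hc := hc _ h5'
  rw [Bool.or_eq_true, Bool.not_eq_true'] at hc
  exact hc.resolve_left (by rw [Bool.not_eq_false]; exact f₅)

end SlotCheck

/-- Let three alternating cycles be closed up in two ways, by even permutations of the slots that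
have no Hamiltonian choice. If the two agree in five links between different alternating cycles,
no three of which join the same two alternating cycles, they are equal. -/
theorem eq_of_neverSingle {J : Type*} [Finite J] (hJ : Nat.card J = 3) {c₁ c₂ : Perm (J × Fin 3)}
    (hs₁ : c₁.parity = 1) (hs₂ : c₂.parity = 1) (h₁ : NeverSingle (rotRow J) c₁)
    (h₂ : NeverSingle (rotRow J) c₂) (N : Set (J × Fin 3)) (hN : ∀ y ∈ N, c₂ y = c₁ y)
    (hclean : ∀ y ∈ N, (c₁ y).1 ≠ y.1) (hpair : ∀ j, {y ∈ N | y.1 ≠ j ∧ (c₁ y).1 ≠ j}.ncard ≤ 2)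
    (h5 : 5 ≤ N.ncard) : c₁ = c₂ := by
  let M : J → Set (J × Fin 3) := fun j => {y ∈ N | y.1 ≠ j ∧ (c₁ y).1 ≠ j}
  obtain ⟨π₀⟩ : Nonempty (Fin 3 ≃ J) := ⟨(Finite.equivFinOfCardEq hJ).symm⟩
  have hM2 : ∀ j, (M j).ncard ≤ 2 := hpair
  have hsum : 5 ≤ (M (π₀ 0)).ncard + (M (π₀ 1)).ncard + (M (π₀ 2)).ncard := by
    have hsub : N ⊆ M (π₀ 0) ∪ M (π₀ 1) ∪ M (π₀ 2) := by
      intro y hy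
      have h0 := hclean y hy
      have key : ∀ a b : Fin 3, b ≠ a → (a ≠ 0 ∧ b ≠ 0 ∨ a ≠ 1 ∧ b ≠ 1) ∨ a ≠ 2 ∧ b ≠ 2 := by
        decide
      obtain ⟨a, ha⟩ := π₀.surjective y.1
      obtain ⟨b, hb⟩ := π₀.surjective (c₁ y).1
      have := key a b (by rintro rfl; exact h0 (hb.symm.trans ha))
      simp only [Set.mem_union, M, Set.mem_ofPred_eq, hy, true_and, ← ha, ← hb, ne_eq,
        π₀.injective.eq_iff]
      exact this
    have hle := Set.ncard_le_ncard hsub (Set.toFinite _)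
    have u1 := Set.ncard_union_le (M (π₀ 0) ∪ M (π₀ 1)) (M (π₀ 2))
    have u2 := Set.ncard_union_le (M (π₀ 0)) (M (π₀ 1))
    omega
  -- five links in three classes with at most two links each: two classes are full, and the rows are
  -- numbered such that the third class joins the outer rows
  obtain ⟨π, hπ0, hπ1, hπ2⟩ : ∃ π : Fin 3 ≃ J, 1 < (M (π 0)).ncard ∧ 0 < (M (π 1)).ncard ∧
      1 < (M (π 2)).ncard := by
    have b0 := hM2 (π₀ 0)
    have b1 := hM2 (π₀ 1)
    have b2 := hM2 (π₀ 2)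
    by_cases g0 : 1 < (M (π₀ 0)).ncard
    · by_cases g2 : 1 < (M (π₀ 2)).ncard
      · exact ⟨π₀, g0, by omega, g2⟩
      · refine ⟨(Equiv.swap 1 2).trans π₀, ?_, ?_, ?_⟩ <;>
          simp only [Equiv.trans_apply, Equiv.swap_apply_left, Equiv.swap_apply_right] <;>
          first | omega | (rw [Equiv.swap_apply_of_ne_of_ne (by decide) (by decide)]; omega)
    · refine ⟨(Equiv.swap 0 1).trans π₀, ?_, ?_, ?_⟩ <;>
        simp only [Equiv.trans_apply, Equiv.swap_apply_left, Equiv.swap_apply_right] <;>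
        first | omega | (rw [Equiv.swap_apply_of_ne_of_ne (by decide) (by decide)]; omega)
  -- a link that avoids the row `k` joins the other two rows `i`, `j`
  have hrow : ∀ i j k : Fin 3, (∀ a : Fin 3, a ≠ k → a = i ∨ a = j) → ∀ y ∈ M (π k),
      y.1 = π i ∧ (c₁ y).1 = π j ∨ y.1 = π j ∧ (c₁ y).1 = π i := by
    intro i j k hijk y hy
    obtain ⟨hyN, hy1, hy2⟩ := hy
    have h0 := hclean y hyN
    obtain ⟨a, ha⟩ := π.surjective y.1
    obtain ⟨b, hb⟩ := π.surjective (c₁ y).1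
    rw [← ha] at hy1 h0
    rw [← hb] at hy2 h0
    rw [← ha, ← hb]
    have hab : b ≠ a := fun h => h0 (h ▸ rfl)
    rcases hijk a (fun h => hy1 (h ▸ rfl)) with rfl | rfl <;>
      rcases hijk b (fun h => hy2 (h ▸ rfl)) with rfl | rfl
    · exact absurd rfl hab
    · exact Or.inl ⟨rfl, rfl⟩
    · exact Or.inr ⟨rfl, rfl⟩
    · exact absurd rfl hab
  have hpairs : ∀ i j k : Fin 3, (∀ a : Fin 3, a ≠ k → a = i ∨ a = j) → 1 < (M (π k)).ncard →
      ∃ y ∈ N, ∃ y' ∈ N, y ≠ y' ∧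
        ((y.1 = π i ∧ (c₁ y).1 = π j) ∧
            (y'.1 = π i ∧ (c₁ y').1 = π j ∨ y'.1 = π j ∧ (c₁ y').1 = π i) ∨
          (y.1 = π j ∧ (c₁ y).1 = π i) ∧ y'.1 = π j ∧ (c₁ y').1 = π i) := by
    intro i j k hijk hk
    obtain ⟨y, y', hy, hy', hne⟩ := (Set.one_lt_ncard_iff (Set.toFinite _)).1 hk
    have r := hrow i j k hijk y hy
    have r' := hrow i j k hijk y' hy'
    rcases r with r | r
    · exact ⟨y, hy.1, y', hy'.1, hne, Or.inl ⟨r, r'⟩⟩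
    · rcases r' with r' | r'
      · exact ⟨y', hy'.1, y, hy.1, hne.symm, Or.inl ⟨r', Or.inr r⟩⟩
      · exact ⟨y, hy.1, y', hy'.1, hne, Or.inr ⟨r, r'⟩⟩
  obtain ⟨y₁, hy₁, y₂, hy₂, hne12, H12⟩ := hpairs 0 1 2 (by decide) hπ2
  obtain ⟨y₃, hy₃, y₄, hy₄, hne34, H34⟩ := hpairs 1 2 0 (by decide) hπ0
  obtain ⟨y₅, hy₅⟩ := (Set.ncard_pos (Set.toFinite _)).1 hπ1
  have H5 := hrow 0 2 1 (by decide) y₅ hy₅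
  -- the rotation of the rows that moves the ends of the first link of each pair into the first
  -- column, as far as the three rows allow it
  obtain ⟨d, hd⟩ : ∃ d : Fin 3 → Fin 3,
      ((y₁ = (π 0, d 0) ∧ c₁ y₁ = (π 1, d 1)) ∧
          (y₂.1 = π 0 ∧ (c₁ y₂).1 = π 1 ∨ y₂.1 = π 1 ∧ (c₁ y₂).1 = π 0) ∨
        (y₁ = (π 1, d 1) ∧ c₁ y₁ = (π 0, d 0)) ∧ y₂.1 = π 1 ∧ (c₁ y₂).1 = π 0) ∧
      ((y₃.1 = π 1 ∧ c₁ y₃ = (π 2, d 2)) ∧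
          (y₄.1 = π 1 ∧ (c₁ y₄).1 = π 2 ∨ y₄.1 = π 2 ∧ (c₁ y₄).1 = π 1) ∨
        (y₃ = (π 2, d 2) ∧ (c₁ y₃).1 = π 1) ∧ y₄.1 = π 2 ∧ (c₁ y₄).1 = π 1) := by
    obtain ⟨d2, hd2⟩ : ∃ d2 : Fin 3, ((y₃.1 = π 1 ∧ c₁ y₃ = (π 2, d2)) ∧
          (y₄.1 = π 1 ∧ (c₁ y₄).1 = π 2 ∨ y₄.1 = π 2 ∧ (c₁ y₄).1 = π 1) ∨
        (y₃ = (π 2, d2) ∧ (c₁ y₃).1 = π 1) ∧ y₄.1 = π 2 ∧ (c₁ y₄).1 = π 1) := by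
      rcases H34 with ⟨⟨a, b⟩, h⟩ | ⟨⟨a, b⟩, h⟩
      · exact ⟨(c₁ y₃).2, Or.inl ⟨⟨a, Prod.ext b rfl⟩, h⟩⟩
      · exact ⟨y₃.2, Or.inr ⟨⟨Prod.ext a rfl, b⟩, h⟩⟩
    rcases H12 with ⟨⟨a, b⟩, h⟩ | ⟨⟨a, b⟩, h⟩
    · exact ⟨![y₁.2, (c₁ y₁).2, d2], Or.inl ⟨⟨Prod.ext a rfl, Prod.ext b rfl⟩, h⟩, hd2⟩
    · exact ⟨![(c₁ y₁).2, y₁.2, d2], Or.inr ⟨⟨Prod.ext a rfl, Prod.ext b rfl⟩, h⟩, hd2⟩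
  let e : Fin 3 × Fin 3 ≃ J × Fin 3 :=
    { toFun := fun p => (π p.1, p.2 + d p.1)
      invFun := fun q => (π.symm q.1, q.2 - d (π.symm q.1))
      left_inv := fun p => by simp
      right_inv := fun q => by simp }
  have hes : ∀ q i, q.1 = π i → e.symm q = (i, q.2 - d i) := by
    intro q i h
    change (π.symm q.1, q.2 - d (π.symm q.1)) = _
    rw [h, π.symm_apply_apply]
  have hes' : ∀ q i, q = (π i, d i) → e.symm q = (i, 0) := by
    intro q i h
    rw [hes q i (by rw [h]), h, sub_self]
  have hes1 : ∀ q i, q.1 = π i → (e.symm q).1 = i := fun q i h => by rw [hes q i h]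
  have herot : ∀ x, e (rotRow _ x) = rotRow _ (e x) := by
    intro x
    change (π x.1, x.2 + 1 + d x.1) = (π x.1, x.2 + d x.1 + 1)
    rw [add_right_comm]
  let f : Perm (J × Fin 3) → Perm (Fin 3 × Fin 3) := fun c => (e.trans c).trans e.symm
  have hf : ∀ c x, e (f c x) = c (e x) := fun c x => by simp [f]
  have hfs : ∀ c y, f c (e.symm y) = e.symm (c y) := fun c y => by simp [f]
  let v : J × Fin 3 → (Fin 3 × Fin 3) × (Fin 3 × Fin 3) := fun y => (e.symm y, e.symm (c₁ y))
  have hv : ∀ y y', y' ≠ y → (v y').1 ≠ (v y).1 ∧ (v y').2 ≠ (v y).2 := by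
    intro y y' h
    simp only [v, ne_eq, e.symm.injective.eq_iff, c₁.injective.eq_iff]
    exact ⟨h, h⟩
  have h3 : ∀ {i j : Fin 3}, i ≠ j → π i ≠ π j := fun h => π.injective.ne h
  have n01 : π 0 ≠ π 1 := h3 (by decide)
  have n02 : π 0 ≠ π 2 := h3 (by decide)
  have n12 : π 1 ≠ π 2 := h3 (by decide)
  have r12 : ∀ y, (y.1 = π 0 ∧ (c₁ y).1 = π 1 ∨ y.1 = π 1 ∧ (c₁ y).1 = π 0) →
      ∀ y', (y'.1 = π 1 ∧ (c₁ y').1 = π 2 ∨ y'.1 = π 2 ∧ (c₁ y').1 = π 1) → y ≠ y' := by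
    rintro y h y' h' rfl
    rcases h with ⟨a, b⟩ | ⟨a, b⟩ <;> rcases h' with ⟨a', b'⟩ | ⟨a', b'⟩ <;>
      rw [a] at a' <;> rw [b] at b' <;> first | exact n01 a' | exact n02 a' | exact n02 b' | exact n12 a'
  have r25 : ∀ y, (y.1 = π 0 ∧ (c₁ y).1 = π 1 ∨ y.1 = π 1 ∧ (c₁ y).1 = π 0) → y ≠ y₅ := by
    rintro y h rfl
    rcases h with ⟨a, b⟩ | ⟨a, b⟩ <;> rcases H5 with ⟨a', b'⟩ | ⟨a', b'⟩ <;>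
      rw [a] at a' <;> rw [b] at b' <;>
      first | exact n12 b' | exact n02 a' | exact n01 a'.symm | exact n12 a'
  have r45 : ∀ y, (y.1 = π 1 ∧ (c₁ y).1 = π 2 ∨ y.1 = π 2 ∧ (c₁ y).1 = π 1) → y ≠ y₅ := by
    rintro y h rfl
    rcases h with ⟨a, b⟩ | ⟨a, b⟩ <;> rcases H5 with ⟨a', b'⟩ | ⟨a', b'⟩ <;>
      rw [a] at a' <;> rw [b] at b' <;>
      first | exact n01 a'.symm | exact n12 a' | exact n02 a'.symm | exact n01 b'.symm
  have k1 : y₁.1 = π 0 ∧ (c₁ y₁).1 = π 1 ∨ y₁.1 = π 1 ∧ (c₁ y₁).1 = π 0 :=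
    H12.imp (fun h => h.1) (fun h => h.1)
  have k2 : y₂.1 = π 0 ∧ (c₁ y₂).1 = π 1 ∨ y₂.1 = π 1 ∧ (c₁ y₂).1 = π 0 := by
    rcases H12 with h | h
    · exact h.2
    · exact Or.inr h.2
  have k3 : y₃.1 = π 1 ∧ (c₁ y₃).1 = π 2 ∨ y₃.1 = π 2 ∧ (c₁ y₃).1 = π 1 :=
    H34.imp (fun h => h.1) (fun h => h.1)
  have k4 : y₄.1 = π 1 ∧ (c₁ y₄).1 = π 2 ∨ y₄.1 = π 2 ∧ (c₁ y₄).1 = π 1 := by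
    rcases H34 with h | h
    · exact h.2
    · exact Or.inr h.2
  have hrigid := SlotCheck.linksRigid_eq_true (v₁ := v y₁) (v₂ := v y₂) (v₃ := v y₃) (v₄ := v y₄)
    (v₅ := v y₅)
    (by
      rcases hd.1 with ⟨⟨a, b⟩, h⟩ | ⟨⟨a, b⟩, h⟩
      · refine Or.inl ⟨Prod.ext (hes' _ _ a) (hes' _ _ b), ?_⟩
        exact h.imp (fun h => ⟨hes1 _ _ h.1, hes1 _ _ h.2⟩) (fun h => ⟨hes1 _ _ h.1, hes1 _ _ h.2⟩)
      · exact Or.inr ⟨Prod.ext (hes' _ _ a) (hes' _ _ b), hes1 _ _ h.1, hes1 _ _ h.2⟩)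
    (by
      rcases hd.2 with ⟨⟨a, b⟩, h⟩ | ⟨⟨a, b⟩, h⟩
      · refine Or.inl ⟨⟨hes1 _ _ a, hes' _ _ b⟩, ?_⟩
        exact h.imp (fun h => ⟨hes1 _ _ h.1, hes1 _ _ h.2⟩) (fun h => ⟨hes1 _ _ h.1, hes1 _ _ h.2⟩)
      · exact Or.inr ⟨⟨hes' _ _ a, hes1 _ _ b⟩, hes1 _ _ h.1, hes1 _ _ h.2⟩)
    (H5.imp (fun h => ⟨hes1 _ _ h.1, hes1 _ _ h.2⟩) (fun h => ⟨hes1 _ _ h.1, hes1 _ _ h.2⟩))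
    (by
      simp only [List.mem_singleton, forall_eq]
      exact hv _ _ hne12)
    (by
      simp only [List.forall_mem_cons, List.not_mem_nil, false_imp_iff, implies_true, and_true]
      exact ⟨hv _ _ (r12 _ k2 _ k3), hv _ _ (r12 _ k1 _ k3)⟩)
    (by
      simp only [List.forall_mem_cons, List.not_mem_nil, false_imp_iff, implies_true, and_true]
      exact ⟨hv _ _ hne34, hv _ _ (r12 _ k2 _ k4), hv _ _ (r12 _ k1 _ k4)⟩)
    (by
      simp only [List.forall_mem_cons, List.not_mem_nil, false_imp_iff, implies_true, and_true]
      exact ⟨hv _ _ (r45 _ k4), hv _ _ (r45 _ k3), hv _ _ (r25 _ k2), hv _ _ (r25 _ k1)⟩)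
  have hmem : ∀ w ∈ [v y₅, v y₄, v y₃, v y₂, v y₁], ∃ y ∈ N, w = v y := by
    simp only [List.forall_mem_cons, List.not_mem_nil, false_imp_iff, implies_true, and_true]
    exact ⟨⟨_, hy₅.1, rfl⟩, ⟨_, hy₄, rfl⟩, ⟨_, hy₃, rfl⟩, ⟨_, hy₂, rfl⟩, ⟨_, hy₁, rfl⟩⟩
  have hfeq : f c₁ = f c₂ := by
    refine SlotCheck.eq_of_linksRigid _ hrigid ?_ ?_ ?_ ?_ ?_ (h₁.conj e herot (hf c₁))
      (h₂.conj e herot (hf c₂))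
    · have : ([v y₅, v y₄, v y₃, v y₂, v y₁].map Prod.fst) =
          [y₅, y₄, y₃, y₂, y₁].map e.symm := rfl
      rw [this]
      refine List.Nodup.map e.symm.injective ?_
      simp only [List.nodup_cons, List.mem_cons, List.not_mem_nil, or_false, not_or,
        not_false_eq_true, List.nodup_nil, and_true]
      exact ⟨⟨(r45 _ k4).symm, (r45 _ k3).symm, (r25 _ k2).symm, (r25 _ k1).symm⟩,
        ⟨hne34.symm, (r12 _ k2 _ k4).symm, (r12 _ k1 _ k4).symm⟩,
        ⟨(r12 _ k2 _ k3).symm, (r12 _ k1 _ k3).symm⟩, hne12.symm⟩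
    · intro w hw
      obtain ⟨y, -, rfl⟩ := hmem w hw
      exact hfs c₁ y
    · intro w hw
      obtain ⟨y, hy, rfl⟩ := hmem w hw
      change f c₂ (e.symm y) = e.symm (c₁ y)
      rw [hfs, hN y hy]
    · rw [Perm.parity_conj e (hf c₁), hs₁]
    · rw [Perm.parity_conj e (hf c₂), hs₂]
  ext1 x
  have := congrArg (fun g => e (g (e.symm x))) hfeq
  simpa [hf] using this

/-! ### Slot models of 2-digraphs -/

namespace MultiDigraph

universe w₁ w₂ w₃

variable {V : Type w₁} {A : Type w₂} {S : Type w₃}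

/-- A coordinate system for a 2-digraph all of whose alternating cycles have six arcs. The slots,
that is, the points of `S`, number the vertices with out-arcs as well as those with in-arcs, and
every orbit of `ρ` is an alternating cycle: both arcs that leave `out x` enter `inn x` and
`inn (ρ x)`, respectively. A saturated vertex is `out x` for one slot `x` and `inn y` for one
slot `y`. -/
structure SlotModel (G : MultiDigraph V A) (ρ : Perm S) where
  /-- the vertices with out-arcs -/
  out : S → V
  /-- the vertices with in-arcs -/
  inn : S → V
  /-- the numbering of the arcs -/
  arc : S × Bool ≃ A
  rot_three : ∀ x, ρ (ρ (ρ x)) = x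
  rot_ne : ∀ x, ρ x ≠ x
  out_injective : Function.Injective out
  inn_injective : Function.Injective inn
  src_arc : ∀ x b, G.src (arc (x, b)) = out x
  tgt_arc : ∀ x b, G.tgt (arc (x, b)) = inn (bif b then ρ x else x)
  cover : ∀ v, v ∈ Set.range out ∨ v ∈ Set.range inn

namespace SlotModel

variable {G : MultiDigraph V A} {ρ : Perm S} (M : SlotModel G ρ)

theorem src_eq_out_iff (a : A) (x : S) :
    G.src a = M.out x ↔ a = M.arc (x, false) ∨ a = M.arc (x, true) := by
  constructor
  · intro h
    obtain ⟨⟨y, b⟩, rfl⟩ := M.arc.surjective a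
    rw [M.src_arc] at h
    rw [M.out_injective h]
    cases b <;> simp
  · rintro (rfl | rfl) <;> rw [M.src_arc]

theorem tgt_eq_inn_iff (a : A) (y : S) :
    G.tgt a = M.inn y ↔ a = M.arc (y, false) ∨ a = M.arc (ρ.symm y, true) := by
  constructor
  · intro h
    obtain ⟨⟨x, b⟩, rfl⟩ := M.arc.surjective a
    rw [M.tgt_arc] at h
    rw [← M.inn_injective h]
    cases b <;> simp
  · rintro (rfl | rfl) <;> rw [M.tgt_arc] <;> simp

theorem src_mem_range (a : A) : G.src a ∈ Set.range M.out := by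
  obtain ⟨⟨x, b⟩, rfl⟩ := M.arc.surjective a
  exact ⟨x, (M.src_arc x b).symm⟩

theorem tgt_mem_range (a : A) : G.tgt a ∈ Set.range M.inn := by
  obtain ⟨⟨x, b⟩, rfl⟩ := M.arc.surjective a
  exact ⟨_, (M.tgt_arc x b).symm⟩

theorem outDeg_out (x : S) : G.outDeg (M.out x) = 2 := by
  have : {a | G.src a = M.out x} = {M.arc (x, false), M.arc (x, true)} := by
    ext a
    exact M.src_eq_out_iff a x
  rw [outDeg, this, Set.ncard_pair]
  simp

theorem inDeg_inn (y : S) : G.inDeg (M.inn y) = 2 := by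
  have : {a | G.tgt a = M.inn y} = {M.arc (y, false), M.arc (ρ.symm y, true)} := by
    ext a
    exact M.tgt_eq_inn_iff a y
  rw [inDeg, this, Set.ncard_pair]
  simp

theorem outDeg_eq_zero {v : V} (h : v ∉ Set.range M.out) : G.outDeg v = 0 := by
  have : {a | G.src a = v} = ∅ := by
    ext a
    simp only [Set.mem_ofPred_eq, Set.mem_empty_iff_false, iff_false]
    rintro rfl
    exact h (M.src_mem_range a)
  rw [outDeg, this, Set.ncard_empty]

theorem inDeg_eq_zero {v : V} (h : v ∉ Set.range M.inn) : G.inDeg v = 0 := by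
  have : {a | G.tgt a = v} = ∅ := by
    ext a
    simp only [Set.mem_ofPred_eq, Set.mem_empty_iff_false, iff_false]
    rintro rfl
    exact h (M.tgt_mem_range a)
  rw [inDeg, this, Set.ncard_empty]

theorem outDeg_eq_two_iff (v : V) : G.outDeg v = 2 ↔ v ∈ Set.range M.out := by
  by_cases h : v ∈ Set.range M.out
  · obtain ⟨x, rfl⟩ := h
    simp [M.outDeg_out]
  · simp [M.outDeg_eq_zero h, h]

theorem inDeg_eq_two_iff (v : V) : G.inDeg v = 2 ↔ v ∈ Set.range M.inn := by
  by_cases h : v ∈ Set.range M.inn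
  · obtain ⟨x, rfl⟩ := h
    simp [M.inDeg_inn]
  · simp [M.inDeg_eq_zero h, h]

theorem outDeg_eq_zero_iff (v : V) : G.outDeg v = 0 ↔ v ∉ Set.range M.out := by
  refine ⟨?_, M.outDeg_eq_zero⟩
  rintro h ⟨x, rfl⟩
  rw [M.outDeg_out] at h
  exact absurd h (by decide)

theorem inDeg_eq_zero_iff (v : V) : G.inDeg v = 0 ↔ v ∉ Set.range M.inn := by
  refine ⟨?_, M.inDeg_eq_zero⟩
  rintro h ⟨x, rfl⟩
  rw [M.inDeg_inn] at h
  exact absurd h (by decide)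

theorem isEntry_iff (v : V) :
    G.IsEntry 2 v ↔ v ∉ Set.range M.inn ∧ v ∈ Set.range M.out := by
  rw [IsEntry, M.inDeg_eq_zero_iff, M.outDeg_eq_two_iff]

theorem isExit_iff (v : V) :
    G.IsExit 2 v ↔ v ∈ Set.range M.inn ∧ v ∉ Set.range M.out := by
  rw [IsExit, M.inDeg_eq_two_iff, M.outDeg_eq_zero_iff]

theorem isSat_iff (v : V) : G.IsSat 2 v ↔ v ∈ Set.range M.inn ∧ v ∈ Set.range M.out := by
  rw [IsSat, M.inDeg_eq_two_iff, M.outDeg_eq_two_iff]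

theorem isKDigraph (M : SlotModel G ρ) : G.IsKDigraph 2 := by
  intro v
  rw [M.isEntry_iff, M.isExit_iff, M.isSat_iff]
  have := M.cover v
  tauto

theorem exit_or_out (y : S) : (∃ d : G.Exit, M.inn y = d.1) ∨ ∃ x, M.inn y = M.out x := by
  by_cases h : M.inn y ∈ Set.range M.out
  · obtain ⟨x, hx⟩ := h
    exact Or.inr ⟨x, hx.symm⟩
  · exact Or.inl ⟨⟨M.inn y, (M.isExit_iff _).2 ⟨⟨y, rfl⟩, h⟩⟩, rfl⟩

theorem exit_ne_out (d : G.Exit) (x : S) : d.1 ≠ M.out x := fun h =>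
  ((M.isExit_iff _).1 d.2).2 ⟨x, h.symm⟩

theorem entry_ne_inn (u : G.Entry) (y : S) : u.1 ≠ M.inn y := fun h =>
  ((M.isEntry_iff _).1 u.2).1 ⟨y, h.symm⟩

/-- The slot of an entry vertex. -/
noncomputable def entrySlot (u : G.Entry) : S := ((M.isEntry_iff _).1 u.2).2.choose

theorem out_entrySlot (u : G.Entry) : M.out (M.entrySlot u) = u.1 :=
  ((M.isEntry_iff _).1 u.2).2.choose_spec

/-- The slot of an exit vertex. -/
noncomputable def exitSlot (d : G.Exit) : S := ((M.isExit_iff _).1 d.2).1.choose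

theorem inn_exitSlot (d : G.Exit) : M.inn (M.exitSlot d) = d.1 :=
  ((M.isExit_iff _).1 d.2).1.choose_spec

theorem entrySlot_injective : Function.Injective M.entrySlot := fun u u' h =>
  Subtype.ext (by rw [← M.out_entrySlot, h, M.out_entrySlot])

theorem exitSlot_injective : Function.Injective M.exitSlot := fun u u' h =>
  Subtype.ext (by rw [← M.inn_exitSlot, h, M.inn_exitSlot])

/-- The number of slots that are glued. -/
theorem card_sat (M : SlotModel G ρ) [Finite S] :
    Nat.card G.Sat = {y | M.inn y ∈ Set.range M.out}.ncard := by
  rw [← Nat.card_coe_set_eq]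
  refine (Nat.card_congr (Equiv.ofBijective
    (fun y : {y | M.inn y ∈ Set.range M.out} =>
      (⟨M.inn y.1, (M.isSat_iff _).2 ⟨⟨_, rfl⟩, y.2⟩⟩ : G.Sat)) ⟨?_, ?_⟩)).symm
  · intro y y' h
    exact Subtype.ext (M.inn_injective (congrArg Subtype.val h))
  · rintro ⟨v, hv⟩
    obtain ⟨⟨y, rfl⟩, h⟩ := (M.isSat_iff v).1 hv
    exact ⟨⟨y, h⟩, rfl⟩

theorem card_exit_add_card_sat (M : SlotModel G ρ) [Finite S] :
    Nat.card G.Exit + Nat.card G.Sat = Nat.card S := by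
  have h : Nat.card G.Exit = {y | M.inn y ∈ Set.range M.out}ᶜ.ncard := by
    rw [← Nat.card_coe_set_eq]
    refine (Nat.card_congr (Equiv.ofBijective
      (fun y : ↑{y | M.inn y ∈ Set.range M.out}ᶜ =>
        (⟨M.inn y.1, (M.isExit_iff _).2 ⟨⟨_, rfl⟩, y.2⟩⟩ : G.Exit)) ⟨?_, ?_⟩)).symm
    · intro y y' h
      exact Subtype.ext (M.inn_injective (congrArg Subtype.val h))
    · rintro ⟨v, hv⟩
      obtain ⟨⟨y, rfl⟩, h⟩ := (M.isExit_iff v).1 hv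
      exact ⟨⟨y, h⟩, rfl⟩
  rw [h, M.card_sat, add_comm, Set.ncard_add_ncard_compl]

theorem card_entry_add_card_sat (M : SlotModel G ρ) [Finite S] :
    Nat.card G.Entry + Nat.card G.Sat = Nat.card S := by
  have h : Nat.card G.Entry = {x | M.out x ∈ Set.range M.inn}ᶜ.ncard := by
    rw [← Nat.card_coe_set_eq]
    refine (Nat.card_congr (Equiv.ofBijective
      (fun y : ↑{x | M.out x ∈ Set.range M.inn}ᶜ =>
        (⟨M.out y.1, (M.isEntry_iff _).2 ⟨y.2, ⟨_, rfl⟩⟩⟩ : G.Entry)) ⟨?_, ?_⟩)).symm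
    · intro y y' h
      exact Subtype.ext (M.out_injective (congrArg Subtype.val h))
    · rintro ⟨v, hv⟩
      obtain ⟨h, ⟨y, rfl⟩⟩ := (M.isEntry_iff v).1 hv
      exact ⟨⟨y, h⟩, rfl⟩
  have h' : Nat.card G.Sat = {x | M.out x ∈ Set.range M.inn}.ncard := by
    rw [← Nat.card_coe_set_eq]
    refine (Nat.card_congr (Equiv.ofBijective
      (fun y : {x | M.out x ∈ Set.range M.inn} =>
        (⟨M.out y.1, (M.isSat_iff _).2 ⟨y.2, ⟨_, rfl⟩⟩⟩ : G.Sat)) ⟨?_, ?_⟩)).symm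
    · intro y y' h
      exact Subtype.ext (M.out_injective (congrArg Subtype.val h))
    · rintro ⟨v, hv⟩
      obtain ⟨h, ⟨y, rfl⟩⟩ := (M.isSat_iff v).1 hv
      exact ⟨⟨y, h⟩, rfl⟩
  rw [h, h', add_comm, Set.ncard_add_ncard_compl]

/-! ### Factors -/

/-- The factor given by choosing one of the two perfect matchings in every alternating cycle. -/
def fac (z : CycleChoice ρ) : Set A := {a | ∃ x, a = M.arc (x, z.1 x)}

theorem arc_mem_fac (z : CycleChoice ρ) (x : S) (b : Bool) :
    M.arc (x, b) ∈ M.fac z ↔ b = z.1 x := by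
  constructor
  · rintro ⟨y, hy⟩
    have := M.arc.injective hy
    simp only [Prod.mk.injEq] at this
    rw [this.2, this.1]
  · rintro rfl
    exact ⟨x, rfl⟩

theorem tgt_arc_choice (z : CycleChoice ρ) (x : S) :
    G.tgt (M.arc (x, z.1 x)) = M.inn (turn ρ z x) := M.tgt_arc _ _

theorem _root_.MultiDigraph.outDeg_spanning_eq_one_iff (B : Set A) (v : V) :
    (G.spanning B).outDeg v = 1 ↔ ∃! a, a ∈ B ∧ G.src a = v := by
  rw [outDeg, Set.ncard_eq_one]
  constructor
  · rintro ⟨a, ha⟩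
    refine ⟨a.1, ⟨a.2, ?_⟩, fun b hb => ?_⟩
    · have : a ∈ {a | (G.spanning B).src a = v} := by rw [ha]; rfl
      exact this
    · have : (⟨b, hb.1⟩ : B) ∈ {a | (G.spanning B).src a = v} := hb.2
      rw [ha] at this
      exact congrArg Subtype.val this
  · rintro ⟨a, ⟨ha, hav⟩, h⟩
    refine ⟨⟨a, ha⟩, ?_⟩
    ext b
    constructor
    · intro hb
      exact Subtype.ext (h b.1 ⟨b.2, hb⟩)
    · rintro rfl
      exact hav

theorem _root_.MultiDigraph.inDeg_spanning_eq_one_iff (B : Set A) (v : V) :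
    (G.spanning B).inDeg v = 1 ↔ ∃! a, a ∈ B ∧ G.tgt a = v := by
  rw [inDeg, Set.ncard_eq_one]
  constructor
  · rintro ⟨a, ha⟩
    refine ⟨a.1, ⟨a.2, ?_⟩, fun b hb => ?_⟩
    · have : a ∈ {a | (G.spanning B).tgt a = v} := by rw [ha]; rfl
      exact this
    · have : (⟨b, hb.1⟩ : B) ∈ {a | (G.spanning B).tgt a = v} := hb.2
      rw [ha] at this
      exact congrArg Subtype.val this
  · rintro ⟨a, ⟨ha, hav⟩, h⟩
    refine ⟨⟨a, ha⟩, ?_⟩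
    ext b
    constructor
    · intro hb
      exact Subtype.ext (h b.1 ⟨b.2, hb⟩)
    · rintro rfl
      exact hav

theorem outDeg_spanning_eq_zero (B : Set A) {v : V} (h : v ∉ Set.range M.out) :
    (G.spanning B).outDeg v = 0 := by
  have : {a | (G.spanning B).src a = v} = ∅ := by
    ext a
    simp only [Set.mem_ofPred_eq, Set.mem_empty_iff_false, iff_false]
    rintro rfl
    exact h (M.src_mem_range a.1)
  rw [outDeg, this, Set.ncard_empty]

theorem inDeg_spanning_eq_zero (B : Set A) {v : V} (h : v ∉ Set.range M.inn) :
    (G.spanning B).inDeg v = 0 := by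
  have : {a | (G.spanning B).tgt a = v} = ∅ := by
    ext a
    simp only [Set.mem_ofPred_eq, Set.mem_empty_iff_false, iff_false]
    rintro rfl
    exact h (M.tgt_mem_range a.1)
  rw [inDeg, this, Set.ncard_empty]

theorem isFactor_iff_existsUnique (B : Set A) :
    G.IsFactor B ↔ (∀ x, ∃! a, a ∈ B ∧ G.src a = M.out x) ∧
      ∀ y, ∃! a, a ∈ B ∧ G.tgt a = M.inn y := by
  constructor
  · intro h
    constructor
    · intro x
      rw [← outDeg_spanning_eq_one_iff]
      obtain ⟨h1, -, h3⟩ := h (M.out x)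
      by_cases hx : M.out x ∈ Set.range M.inn
      · exact (h3 ((M.isSat_iff _).2 ⟨hx, ⟨x, rfl⟩⟩)).2
      · exact (h1 ((M.isEntry_iff _).2 ⟨hx, ⟨x, rfl⟩⟩)).2
    · intro y
      rw [← inDeg_spanning_eq_one_iff]
      obtain ⟨-, h2, h3⟩ := h (M.inn y)
      by_cases hy : M.inn y ∈ Set.range M.out
      · exact (h3 ((M.isSat_iff _).2 ⟨⟨y, rfl⟩, hy⟩)).1
      · exact (h2 ((M.isExit_iff _).2 ⟨⟨y, rfl⟩, hy⟩)).1
  · rintro ⟨ho, hi⟩ v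
    refine ⟨fun h => ?_, fun h => ?_, fun h => ?_⟩
    · obtain ⟨h1, x, rfl⟩ := (M.isEntry_iff _).1 h
      exact ⟨M.inDeg_spanning_eq_zero B h1, (outDeg_spanning_eq_one_iff _ _).2 (ho x)⟩
    · obtain ⟨⟨y, rfl⟩, h1⟩ := (M.isExit_iff _).1 h
      exact ⟨(inDeg_spanning_eq_one_iff _ _).2 (hi y), M.outDeg_spanning_eq_zero B h1⟩
    · obtain ⟨⟨y, hy⟩, ⟨x, rfl⟩⟩ := (M.isSat_iff _).1 h
      exact ⟨(inDeg_spanning_eq_one_iff _ _).2 (hy ▸ hi y),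
        (outDeg_spanning_eq_one_iff _ _).2 (ho x)⟩

/-- At every vertex with out-arcs or in-arcs, a factor contains one of the two; so it contains every
second arc of each alternating cycle. -/
theorem isFactor_iff (B : Set A) : G.IsFactor B ↔ ∃ z : CycleChoice ρ, B = M.fac z := by
  classical
  rw [M.isFactor_iff_existsUnique]
  constructor
  · rintro ⟨ho, hi⟩
    have ho' : ∀ x, M.arc (x, true) ∈ B ↔ M.arc (x, false) ∉ B := by
      intro x
      obtain ⟨a, ⟨ha, hax⟩, hu⟩ := ho x
      constructor
      · intro h1 h2
        have := (hu _ ⟨h1, M.src_arc _ _⟩).trans (hu _ ⟨h2, M.src_arc _ _⟩).symm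
        simp at this
      · intro h
        rcases (M.src_eq_out_iff a x).1 hax with rfl | rfl
        · exact absurd ha h
        · exact ha
    have hi' : ∀ y, M.arc (ρ.symm y, true) ∈ B ↔ M.arc (y, false) ∉ B := by
      intro y
      obtain ⟨a, ⟨ha, hay⟩, hu⟩ := hi y
      constructor
      · intro h1 h2
        have := (hu _ ⟨h1, (M.tgt_eq_inn_iff _ _).2 (Or.inr rfl)⟩).trans
          (hu _ ⟨h2, (M.tgt_eq_inn_iff _ _).2 (Or.inl rfl)⟩).symm
        simp at this
      · intro h
        rcases (M.tgt_eq_inn_iff a y).1 hay with rfl | rfl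
        · exact absurd ha h
        · exact ha
    refine ⟨⟨fun x => decide (M.arc (x, true) ∈ B), fun x => ?_⟩, ?_⟩
    · have := (ho' (ρ x)).trans (hi' (ρ x)).symm
      rw [ρ.symm_apply_apply] at this
      simp only [this]
    · ext a
      obtain ⟨⟨x, b⟩, rfl⟩ := M.arc.surjective a
      rw [M.arc_mem_fac]
      cases b
      · have := ho' x
        simp only [eq_comm (a := false), decide_eq_false_iff_not]
        tauto
      · simp [eq_comm (a := true)]
  · rintro ⟨z, rfl⟩
    constructor
    · intro x
      refine ⟨M.arc (x, z.1 x), ⟨⟨x, rfl⟩, M.src_arc _ _⟩, ?_⟩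
      rintro a ⟨⟨y, rfl⟩, h⟩
      rw [M.src_arc] at h
      rw [M.out_injective h]
    · intro y
      refine ⟨M.arc ((turn ρ z).symm y, z.1 ((turn ρ z).symm y)), ⟨⟨_, rfl⟩, ?_⟩, ?_⟩
      · rw [M.tgt_arc_choice, Equiv.apply_symm_apply]
      · rintro a ⟨⟨x, rfl⟩, h⟩
        rw [M.tgt_arc_choice] at h
        rw [← M.inn_injective h, Equiv.symm_apply_apply]

/-! ### The paths of a factor -/

/-- The path of the factor `z` that passes through the slot `x` ends at the exit vertex `d`. -/
inductive Ends (z : CycleChoice ρ) : S → G.Exit → Prop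
  | last {x : S} {d : G.Exit} : M.inn (turn ρ z x) = d.1 → Ends z x d
  | step {x x' : S} {d : G.Exit} : M.inn (turn ρ z x) = M.out x' → Ends z x' d → Ends z x d

/-- Every slot lies on a path of the factor that ends at an exit vertex, that is, the factor has no
cycles. -/
def IsOpen (z : CycleChoice ρ) : Prop := ∀ x, ∃ d, M.Ends z x d

theorem Ends.unique {M : SlotModel G ρ} {z : CycleChoice ρ} {x : S} {d d' : G.Exit}
    (h : M.Ends z x d) (h' : M.Ends z x d') : d = d' := by
  induction h with
  | last h =>
    cases h' with
    | last h' => exact Subtype.ext (h.symm.trans h')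
    | step h' _ => exact absurd (h.symm.trans h') (M.exit_ne_out _ _)
  | step h _ ih =>
    cases h' with
    | last h' => exact absurd (h'.symm.trans h) (M.exit_ne_out _ _)
    | step h' h'' => exact ih (M.out_injective (h.symm.trans h') ▸ h'')

theorem Ends.of_step {M : SlotModel G ρ} {z : CycleChoice ρ} {x x' : S} {d : G.Exit}
    (h : M.Ends z x d) (hx : M.inn (turn ρ z x) = M.out x') : M.Ends z x' d := by
  cases h with
  | last h => exact absurd (h.symm.trans hx) (M.exit_ne_out _ _)
  | step h' h'' => exact M.out_injective (hx.symm.trans h') ▸ h''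

theorem Ends.eq_of_exit {M : SlotModel G ρ} {z : CycleChoice ρ} {x : S} {d d' : G.Exit}
    (h : M.Ends z x d) (hx : M.inn (turn ρ z x) = d'.1) : d = d' :=
  h.unique (Ends.last hx)

theorem reach_iff (z : CycleChoice ρ) (x : S) (d : G.Exit) :
    Relation.ReflTransGen (fun v w => ∃ a ∈ M.fac z, G.src a = v ∧ G.tgt a = w) (M.out x) d.1 ↔
      M.Ends z x d := by
  constructor
  · intro h
    have key : ∀ v, Relation.ReflTransGen (fun v w => ∃ a ∈ M.fac z, G.src a = v ∧ G.tgt a = w)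
        v d.1 → v = d.1 ∨ ∀ x, v = M.out x → M.Ends z x d := by
      intro v hv
      induction hv using Relation.ReflTransGen.head_induction_on with
      | refl => exact Or.inl rfl
      | head hab _ ih =>
        obtain ⟨_, ⟨y, rfl⟩, rfl, rfl⟩ := hab
        right
        intro x hx
        rw [M.src_arc] at hx
        obtain rfl := M.out_injective hx
        rw [M.tgt_arc_choice] at ih
        rcases ih with ih | ih
        · exact Ends.last ih
        · rcases M.exit_or_out (turn ρ z y) with ⟨d', hd'⟩ | ⟨x', hx'⟩
          · -- an exit vertex has no out-arcs, hence it is the end of the path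
            rename_i hrest
            rw [M.tgt_arc_choice, hd'] at hrest
            rcases Relation.ReflTransGen.cases_head hrest with h' | ⟨_, ⟨_, ⟨w, rfl⟩, h', -⟩, -⟩
            · exact Ends.last (hd'.trans h')
            · rw [M.src_arc] at h'
              exact absurd h'.symm (M.exit_ne_out _ _)
          · exact Ends.step hx' (ih x' hx')
    rcases key _ h with h' | h'
    · exact absurd h'.symm (M.exit_ne_out _ _)
    · exact h' x rfl
  · intro h
    induction h with
    | @last x d h =>
      exact Relation.ReflTransGen.single ⟨_, ⟨x, rfl⟩, M.src_arc _ _, by rw [M.tgt_arc_choice, h]⟩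
    | @step x x' d h _ ih =>
      exact Relation.ReflTransGen.head
        ⟨_, ⟨x, rfl⟩, M.src_arc _ _, by rw [M.tgt_arc_choice, h]⟩ ih

end SlotModel
end MultiDigraph

theorem exists_perm_of_rel {S : Type*} [Finite S] (C : S → S → Prop) (htot : ∀ y, ∃ x, C y x)
    (hinj : ∀ y y' x, C y x → C y' x → y = y') : ∃ c : Perm S, ∀ y, C y (c y) := by
  choose f hf using htot
  have hf' : Function.Injective f := fun y y' h => hinj y y' _ (hf y) (h ▸ hf y')
  exact ⟨Equiv.ofBijective f (Finite.injective_iff_bijective.1 hf'), hf⟩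

theorem Equiv.Perm.IsSingleOrbit.exists_pow_eq {T : Type*} [Finite T] {Φ : Perm T}
    (h : Φ.IsSingleOrbit) (x y : T) : ∃ n : ℕ, (Φ ^ n) x = y := by
  obtain ⟨i, -, hi⟩ := (h x y).exists_pow_eq'
  exact ⟨i, hi⟩

namespace MultiDigraph

universe w₁ w₂ w₃ w₄ w₅ w₆

variable {V : Type w₁} {A : Type w₂} {S : Type w₃} {V' : Type w₄} {A' : Type w₅} {T : Type w₆}

namespace SlotModel

variable {G : MultiDigraph V A} {ρ : Perm S} (M : SlotModel G ρ)

/-! ### Closing up the exits -/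

/-- The permutation `c` of the slots sends every in-slot to the out-slot at the same vertex, where
every exit vertex `d` is regarded as identified with the entry vertex `b d`. -/
def IsClosing (b : G.Exit ≃ G.Entry) (c : Perm S) : Prop :=
  ∀ y, M.inn y = M.out (c y) ∨ ∃ d : G.Exit, M.inn y = d.1 ∧ M.out (c y) = (b d).1

theorem exists_isClosing [Finite S] (b : G.Exit ≃ G.Entry) : ∃ c, M.IsClosing b c := by
  refine exists_perm_of_rel
    (fun y x => M.inn y = M.out x ∨ ∃ d : G.Exit, M.inn y = d.1 ∧ M.out x = (b d).1)
    (fun y => ?_) (fun y y' x h h' => ?_)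
  · rcases M.exit_or_out y with ⟨d, hd⟩ | ⟨x, hx⟩
    · exact ⟨M.entrySlot (b d), Or.inr ⟨d, hd, M.out_entrySlot _⟩⟩
    · exact ⟨x, Or.inl hx⟩
  · rcases h with h | ⟨d, h, hd⟩ <;> rcases h' with h' | ⟨d', h', hd'⟩
    · exact M.inn_injective (h.trans h'.symm)
    · exact absurd (h.trans hd').symm (M.entry_ne_inn _ _)
    · exact absurd (h'.trans hd).symm (M.entry_ne_inn _ _)
    · have : d = d' := b.injective (Subtype.ext (hd.symm.trans hd'))
      exact M.inn_injective (h.trans (this ▸ h'.symm))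

variable {M}

theorem IsClosing.apply_of_eq {b : G.Exit ≃ G.Entry} {c : Perm S} (h : M.IsClosing b c) {y x : S}
    (hy : M.inn y = M.out x) : c y = x := by
  rcases h y with h | ⟨d, h, -⟩
  · exact M.out_injective (h.symm.trans hy)
  · exact absurd (h.symm.trans hy) (M.exit_ne_out _ _)

theorem IsClosing.apply_of_exit {b : G.Exit ≃ G.Entry} {c : Perm S} (h : M.IsClosing b c) {y : S}
    {d : G.Exit} (hy : M.inn y = d.1) : c y = M.entrySlot (b d) := by
  apply M.out_injective
  rw [M.out_entrySlot]
  rcases h y with h | ⟨d', h, hd'⟩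
  · exact absurd (hy.symm.trans h) (M.exit_ne_out _ _)
  · have : d' = d := Subtype.ext (h.symm.trans hy)
    rw [hd', this]

theorem IsClosing.eq_of_apply_eq {b b' : G.Exit ≃ G.Entry} {c : Perm S} (h : M.IsClosing b c)
    (h' : M.IsClosing b' c) : b = b' := by
  ext1 d
  apply M.entrySlot_injective
  rw [← h.apply_of_exit (M.inn_exitSlot d), h'.apply_of_exit (M.inn_exitSlot d)]

/-- The parities of two closings differ by that of the change of the identification. -/
theorem IsClosing.parity_eq [Finite S] {b b' : G.Exit ≃ G.Entry} {c c' : Perm S}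
    (h : M.IsClosing b c) (h' : M.IsClosing b' c') :
    c'.parity = Perm.parity (b'.trans b.symm) * c.parity := by
  classical
  have := Fintype.ofFinite S
  have : Finite G.Exit := Finite.of_injective _ M.exitSlot_injective
  have := Fintype.ofFinite G.Exit
  let k := Equiv.ofInjective M.exitSlot M.exitSlot_injective
  have hc : c' = c * Perm.extendDomain (b'.trans b.symm) k := by
    ext1 y
    rw [Perm.mul_apply]
    rcases M.exit_or_out y with ⟨d, hd⟩ | ⟨x, hx⟩
    · have hy : y = k d := M.inn_injective (hd.trans (M.inn_exitSlot d).symm)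
      rw [h'.apply_of_exit hd, hy, Perm.extendDomain_apply_image]
      have : c (k ((b'.trans b.symm) d)) = M.entrySlot (b ((b'.trans b.symm) d)) :=
        h.apply_of_exit (M.inn_exitSlot _)
      rw [this]
      simp
    · rw [h'.apply_of_eq hx, Perm.extendDomain_apply_not_subtype, h.apply_of_eq hx]
      rintro ⟨d, rfl⟩
      rw [M.inn_exitSlot] at hx
      exact M.exit_ne_out _ _ hx
  rw [hc, Perm.parity_mul, mul_comm, Perm.parity_eq_sign (Perm.extendDomain _ k),
    Perm.sign_extendDomain, Perm.parity_eq_sign (b'.trans b.symm)]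

variable (M)

theorem nonempty_exit_equiv_entry (M : SlotModel G ρ) [Finite S] : Nonempty (G.Exit ≃ G.Entry) := by
  have h₁ := M.card_exit_add_card_sat
  have h₂ := M.card_entry_add_card_sat
  have : Finite G.Exit := Finite.of_injective _ M.exitSlot_injective
  have : Finite G.Entry := Finite.of_injective _ M.entrySlot_injective
  exact ⟨(Finite.equivFinOfCardEq rfl).trans (Finite.equivFinOfCardEq (by omega)).symm⟩

/-! ### Circuits -/

/-- An orbit of a permutation of the slots that follows the arcs of a factor is a circuit. -/
theorem isCircuit_of_perm [Finite S] (z : CycleChoice ρ) (Φ : Perm S) (x : S)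
    (h : ∀ i : ℕ, M.inn (turn ρ z ((Φ ^ i) x)) = M.out ((Φ ^ (i + 1)) x)) :
    G.IsCircuit (Set.range fun i : ℕ => M.arc ((Φ ^ i) x, z.1 ((Φ ^ i) x))) := by
  have hper : 0 < Function.minimalPeriod Φ x :=
    Function.minimalPeriod_pos_of_mem_periodicPts
      (Function.Injective.mem_periodicPts Φ.injective x)
  have hpow : ∀ i : ℕ, (Φ ^ i) x = Φ^[i] x := fun i => by rw [Perm.iterate_eq_pow]
  refine ⟨Function.minimalPeriod Φ x, fun i => M.arc ((Φ ^ i) x, z.1 ((Φ ^ i) x)), hper, ?_, ?_,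
    rfl, ?_⟩
  · intro i
    have : (Φ ^ (i + Function.minimalPeriod Φ x)) x = (Φ ^ i) x := by
      rw [hpow, hpow, Function.iterate_add_minimalPeriod_eq]
    simp only [this]
  · intro i hi j hj hij
    simp only [M.src_arc] at hij
    have := M.out_injective hij
    rw [hpow, hpow] at this
    exact (Function.iterate_eq_iterate_iff_of_lt_minimalPeriod hi hj).1 this
  · intro i
    rw [M.tgt_arc_choice, M.src_arc]
    exact h i

theorem not_isCircuit_of_isOpen {z : CycleChoice ρ} (hz : M.IsOpen z) {X : Set A}
    (hX : X ⊆ M.fac z) : ¬ G.IsCircuit X := by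
  rintro ⟨r, e, hr, -, -, rfl, hstep⟩
  have hex : ∀ i, ∃ x, e i = M.arc (x, z.1 x) := fun i => hX ⟨i, rfl⟩
  choose x hx using hex
  have hs : ∀ i, M.inn (turn ρ z (x i)) = M.out (x (i + 1)) := by
    intro i
    have := hstep i
    rwa [hx i, hx (i + 1), M.tgt_arc_choice, M.src_arc] at this
  have key : ∀ y d, M.Ends z y d → ∀ i, y ≠ x i := by
    intro y d h
    induction h with
    | last h =>
      rintro i rfl
      exact absurd (h.symm.trans (hs i)) (M.exit_ne_out _ _)
    | step h _ ih =>
      rintro i rfl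
      exact ih (i + 1) (M.out_injective (h.symm.trans (hs i)))
  obtain ⟨d, hd⟩ := hz (x 0)
  exact key _ _ hd 0 rfl

/-- A factor has index `0` exactly if all its paths end at exit vertices. -/
theorem index_fac_eq_zero_iff [Finite S] (z : CycleChoice ρ) :
    G.index (M.fac z) = 0 ↔ M.IsOpen z := by
  have : Finite A := Finite.of_equiv _ M.arc
  rw [index, Set.ncard_eq_zero (Set.toFinite _)]
  constructor
  · intro h
    by_contra hz
    simp only [IsOpen, not_forall, not_exists] at hz
    obtain ⟨x, hx⟩ := hz
    obtain ⟨b⟩ := M.nonempty_exit_equiv_entry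
    obtain ⟨c, hc⟩ := M.exists_isClosing b
    -- a slot from which no exit vertex is reached lies on a cycle of every closing
    have hstep : ∀ y, (∀ d, ¬ M.Ends z y d) →
        M.inn (turn ρ z y) = M.out ((c * turn ρ z) y) := by
      intro y hy
      rcases hc (turn ρ z y) with h | ⟨d, h, -⟩
      · exact h
      · exact absurd (Ends.last h) (hy d)
    have hall : ∀ i : ℕ, ∀ d, ¬ M.Ends z (((c * turn ρ z) ^ i) x) d := by
      intro i
      induction i with
      | zero => exact hx
      | succ i ih =>
        intro d hd
        rw [pow_succ', Perm.mul_apply] at hd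
        exact ih d (Ends.step (hstep _ ih) hd)
    have hcirc := M.isCircuit_of_perm z (c * turn ρ z) x fun i => by
      rw [hstep _ (hall i), pow_succ', Perm.mul_apply _ (_ ^ i)]
    have hmem : _ ∈ {X | X ⊆ M.fac z ∧ G.IsCircuit X} := ⟨?_, hcirc⟩
    · rw [h] at hmem
      exact hmem
    · rintro _ ⟨i, rfl⟩
      exact ⟨_, rfl⟩
  · intro hz
    rw [Set.eq_empty_iff_forall_notMem]
    rintro X ⟨hX, hc⟩
    exact M.not_isCircuit_of_isOpen hz hX hc

/-! ### Open routes -/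

/-- The bijection `r` is the open route of the factor `z`. -/
def IsRoute (z : CycleChoice ρ) (r : G.Entry ≃ G.Exit) : Prop :=
  M.IsOpen z ∧ ∀ u, M.Ends z (M.entrySlot u) (r u)

/-- Open routes in terms of slots. -/
theorem mem_openRoutes_iff [Finite S] (r : G.Entry ≃ G.Exit) :
    r ∈ G.openRoutes ↔ ∃ z, M.IsRoute z r := by
  constructor
  · rintro ⟨B, hB, h0, h⟩
    obtain ⟨z, rfl⟩ := (M.isFactor_iff B).1 hB
    refine ⟨z, (M.index_fac_eq_zero_iff z).1 h0, fun u => ?_⟩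
    rw [← M.reach_iff, M.out_entrySlot]
    exact h u
  · rintro ⟨z, hz, h⟩
    refine ⟨M.fac z, (M.isFactor_iff _).2 ⟨z, rfl⟩, (M.index_fac_eq_zero_iff z).2 hz, fun u => ?_⟩
    have := h u
    rwa [← M.reach_iff, M.out_entrySlot] at this

variable {M}

/-- The paths of a factor from two entry vertices to the same exit vertex are the same path. -/
theorem Ends.entry_unique {z : CycleChoice ρ} {u u' : G.Entry} {d : G.Exit}
    (h : M.Ends z (M.entrySlot u) d) (h' : M.Ends z (M.entrySlot u') d) : u = u' := by
  let R : S → S → Prop := fun x x' => M.inn (turn ρ z x) = M.out x'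
  have hR : ∀ x x' y, R x y → R x' y → x = x' := fun x x' y hx hx' =>
    (turn ρ z).injective (M.inn_injective (hx.trans hx'.symm))
  have hlast : ∀ x x' d, M.Ends z x' d → M.inn (turn ρ z x) = d.1 →
      Relation.ReflTransGen R x' x := by
    intro x x' d hx' hx
    induction hx' with
    | last h =>
      rw [(turn ρ z).injective (M.inn_injective (h.trans hx.symm))]
    | step h _ ih => exact Relation.ReflTransGen.head h (ih hx)
  have hcomp : ∀ x x' d, M.Ends z x d → M.Ends z x' d →
      Relation.ReflTransGen R x x' ∨ Relation.ReflTransGen R x' x := by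
    intro x x' d hx hx'
    induction hx with
    | last h => exact Or.inr (hlast _ _ _ hx' h)
    | step h _ ih =>
      rcases ih hx' with h' | h'
      · exact Or.inl (Relation.ReflTransGen.head h h')
      · rcases Relation.ReflTransGen.cases_tail h' with h'' | ⟨y, h1, h2⟩
        · exact Or.inl (Relation.ReflTransGen.single (h''.symm ▸ h))
        · rw [hR _ _ _ h h2]
          exact Or.inr h1
  have hentry : ∀ x u, Relation.ReflTransGen R x (M.entrySlot u) → x = M.entrySlot u := by
    intro x u hx
    rcases Relation.ReflTransGen.cases_tail hx with h | ⟨y, -, h⟩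
    · exact h.symm
    · have h : M.inn (turn ρ z y) = M.out (M.entrySlot u) := h
      rw [M.out_entrySlot] at h
      exact absurd h.symm (M.entry_ne_inn _ _)
  rcases hcomp _ _ _ h h' with h | h
  · exact M.entrySlot_injective (hentry _ _ h)
  · exact (M.entrySlot_injective (hentry _ _ h)).symm

theorem IsOpen.exists_isRoute [Finite S] {z : CycleChoice ρ} (hz : M.IsOpen z) :
    ∃ r, M.IsRoute z r := by
  choose f hf using fun u : G.Entry => hz (M.entrySlot u)
  have hinj : Function.Injective f := fun u u' h => (hf u).entry_unique (h ▸ hf u')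
  have : Finite G.Exit := Finite.of_injective _ M.exitSlot_injective
  have : Finite G.Entry := Finite.of_injective _ M.entrySlot_injective
  obtain ⟨b⟩ := M.nonempty_exit_equiv_entry
  have hbij : Function.Bijective f :=
    hinj.bijective_of_nat_card_le (Nat.card_congr b).le
  exact ⟨Equiv.ofBijective f hbij, hz, hf⟩

/-- A factor whose slots are traversed by a single cycle of some permutation is open, provided
there is an exit vertex. -/
theorem isOpen_of_isSingleOrbit [Finite T] {z : CycleChoice ρ} {Φ : Perm T}
    (hΦ : Φ.IsSingleOrbit) (j : S → T) (hj : Function.Injective j)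
    (hstep : ∀ x x', M.inn (turn ρ z x) = M.out x' → Φ (j x) = j x') (d : G.Exit) :
    M.IsOpen z := by
  by_contra hz
  simp only [IsOpen, not_forall, not_exists] at hz
  obtain ⟨x, hx⟩ := hz
  have hall : ∀ i : ℕ, ∃ y, (Φ ^ i) (j x) = j y ∧ ∀ d, ¬ M.Ends z y d := by
    intro i
    induction i with
    | zero => exact ⟨x, rfl, hx⟩
    | succ i ih =>
      obtain ⟨y, hy, hyd⟩ := ih
      rcases M.exit_or_out (turn ρ z y) with ⟨d, hd⟩ | ⟨x', hx'⟩
      · exact absurd (Ends.last hd) (hyd d)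
      · refine ⟨x', ?_, fun d hd => hyd d (Ends.step hx' hd)⟩
        rw [pow_succ', Perm.mul_apply, hy, hstep _ _ hx']
  obtain ⟨n, hn⟩ := hΦ.exists_pow_eq (j x) (j ((turn ρ z).symm (M.exitSlot d)))
  obtain ⟨y, hy, hyd⟩ := hall n
  rw [hn] at hy
  rw [← hj hy] at hyd
  exact hyd d (Ends.last (by rw [Equiv.apply_symm_apply, M.inn_exitSlot]))

theorem IsClosing.isOpen [Finite S] {b : G.Exit ≃ G.Entry} {c : Perm S} (hc : M.IsClosing b c)
    {z : CycleChoice ρ} (h : (c * turn ρ z).IsSingleOrbit) (d : G.Exit) : M.IsOpen z :=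
  isOpen_of_isSingleOrbit h id Function.injective_id (fun _ _ hx => hc.apply_of_eq hx) d

theorem Ends.sameCycle {z : CycleChoice ρ} {Φ : Perm T} (j : S → T)
    (hstep : ∀ x x', M.inn (turn ρ z x) = M.out x' → Φ (j x) = j x') (k : G.Exit → T)
    (hlast : ∀ x d, M.inn (turn ρ z x) = d.1 → Φ (j x) = k d) {x : S} {d : G.Exit}
    (h : M.Ends z x d) : Φ.SameCycle (j x) (k d) := by
  induction h with
  | last h =>
    rw [← hlast _ _ h]
    exact Perm.sameCycle_apply_self _ _
  | step h _ ih =>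
    refine (Perm.sameCycle_apply_self Φ _).trans ?_
    rw [hstep _ _ h]
    exact ih

/-- The cycles of a closing of an open factor are those of the route composed with the
identification of the exit vertices with the entry vertices. -/
theorem IsClosing.orbit_reduction {b : G.Exit ≃ G.Entry} {c : Perm S} (hc : M.IsClosing b c)
    {z : CycleChoice ρ} {r : G.Entry ≃ G.Exit} (hr : M.IsRoute z r) :
    (c * turn ρ z).numOrbits = Perm.numOrbits (b.trans r) ∧
      ((c * turn ρ z).IsSingleOrbit ↔ Perm.IsSingleOrbit (b.trans r)) := by
  choose X hX using hr.1
  have hstep : ∀ x x', M.inn (turn ρ z x) = M.out x' → (c * turn ρ z) x = x' := fun x x' h =>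
    hc.apply_of_eq h
  have hlast : ∀ x d, M.inn (turn ρ z x) = d.1 → (c * turn ρ z) x = M.entrySlot (b d) :=
    fun x d h => hc.apply_of_exit h
  have h₁ : ∀ x, (c * turn ρ z).SameCycle x (M.entrySlot (b (X x))) := fun x =>
    (hX x).sameCycle id hstep (fun d => M.entrySlot (b d)) hlast
  refine Perm.orbit_reduction (fun d => M.entrySlot (b d)) X h₁ (fun x => ?_) (fun d => ?_)
    (fun d => ?_)
  · rcases M.exit_or_out (turn ρ z x) with ⟨d, hd⟩ | ⟨x', hx'⟩
    · rw [hlast x d hd, (hX x).eq_of_exit hd, (hX _).unique (hr.2 (b d))]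
      exact Perm.sameCycle_apply_self (b.trans r) d
    · rw [hstep x x' hx', (hX x').unique ((hX x).of_step hx')]
  · have := h₁ (M.entrySlot (b d))
    rwa [(hX _).unique (hr.2 (b d))] at this
  · rw [(hX _).unique (hr.2 (b d))]
    exact (Perm.sameCycle_apply_self (b.trans r) d).symm

end SlotModel
end MultiDigraph

namespace MultiDigraph

universe w₁ w₂ w₃ w₄ w₅ w₆

variable {V : Type w₁} {A : Type w₂} {S : Type w₃} {V' : Type w₄} {A' : Type w₅} {T : Type w₆}

namespace SlotModel

variable {G : MultiDigraph V A} {ρ : Perm S} (M : SlotModel G ρ)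

/-! ### Alternating cycles of a slot model -/

/-- The arcs of the alternating cycle through the slot `x`. -/
def block (x : S) : Set A := {a | ∃ y b, (y = x ∨ y = ρ x ∨ y = ρ (ρ x)) ∧ a = M.arc (y, b)}

theorem ncard_block (x : S) : (M.block x).ncard = 6 := by
  have h : M.block x = M.arc '' (({x, ρ x, ρ (ρ x)} : Set S) ×ˢ Set.univ) := by
    ext a
    constructor
    · rintro ⟨y, b, h, rfl⟩
      exact ⟨(y, b), ⟨by simpa using h, Set.mem_univ _⟩, rfl⟩
    · rintro ⟨⟨y, b⟩, ⟨h, -⟩, rfl⟩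
      exact ⟨y, b, by simpa using h, rfl⟩
  have h1 : x ≠ ρ x := (M.rot_ne x).symm
  have h2 : x ≠ ρ (ρ x) := fun h => M.rot_ne (ρ (ρ x)) (by rw [M.rot_three, ← h])
  have h3 : ρ x ≠ ρ (ρ x) := (M.rot_ne (ρ x)).symm
  rw [h, Set.ncard_image_of_injective _ M.arc.injective, Set.ncard_prod, Set.ncard_univ,
    Set.ncard_eq_three.2 ⟨x, ρ x, ρ (ρ x), h1, h2, h3, rfl⟩]
  simp

theorem rot_symm (M : SlotModel G ρ) (x : S) : ρ.symm x = ρ (ρ x) := by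
  rw [Equiv.symm_apply_eq, M.rot_three]

/-- An alternating cycle is determined by its first arc. -/
theorem eq_block_of_isAC {X : Set A} (hX : G.IsAC X) : ∃ x, X = M.block x := by
  obtain ⟨r, e, hr, hper, hinj, rfl, halt⟩ := hX
  have hper' : Function.Periodic e (2 * r) := hper
  have hne : ∀ i, e (i + 1) ≠ e i := by
    intro i h
    rw [← hper'.map_mod_nat (i + 1), ← hper'.map_mod_nat i] at h
    have h' := hinj (Nat.mod_lt _ (by omega)) (Nat.mod_lt _ (by omega)) h
    have h'' : 1 ≡ 0 [MOD 2 * r] := Nat.ModEq.add_left_cancel' i (h' : i + 1 ≡ i + 0 [MOD 2 * r])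
    have := (Nat.modEq_zero_iff_dvd.1 h'')
    have := Nat.le_of_dvd one_pos this
    omega
  have hodd : ∀ i, Odd i → ∀ x b, e i = M.arc (x, b) → e (i + 1) = M.arc (x, !b) := by
    intro i hi x b h
    have h1 := (halt i).2 hi
    rw [h, M.src_arc, eq_comm, M.src_eq_out_iff] at h1
    have h2 := hne i
    rw [h] at h2
    cases b <;> rcases h1 with h1 | h1 <;> first | exact h1 | exact absurd h1 h2
  have heven : ∀ i, Even i → ∀ x, (e i = M.arc (x, true) → e (i + 1) = M.arc (ρ x, false)) ∧
      (e i = M.arc (x, false) → e (i + 1) = M.arc (ρ (ρ x), true)) := by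
    intro i hi x
    have h1 := (halt i).1 hi
    have h2 := hne i
    constructor
    · intro h
      rw [h, M.tgt_arc, eq_comm] at h1
      rw [h] at h2
      rcases (M.tgt_eq_inn_iff _ _).1 h1 with h1 | h1
      · exact h1
      · rw [h1] at h2
        simp at h2
    · intro h
      rw [h, M.tgt_arc, eq_comm] at h1
      rw [h] at h2
      rcases (M.tgt_eq_inn_iff _ _).1 h1 with h1 | h1
      · exact absurd h1 h2
      · rw [h1, ← M.rot_symm]
        rfl
  obtain ⟨⟨x, b⟩, h0⟩ := M.arc.surjective (e 0)
  refine ⟨x, Set.Subset.antisymm ?_ ?_⟩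
  · rintro _ ⟨i, rfl⟩
    induction i with
    | zero => exact ⟨x, b, Or.inl rfl, h0.symm⟩
    | succ i ih =>
      obtain ⟨y, b', hy, h⟩ := ih
      rcases Nat.even_or_odd i with hi | hi
      · cases b'
        · refine ⟨ρ (ρ y), true, ?_, (heven i hi y).2 h⟩
          rcases hy with rfl | rfl | rfl <;> simp [M.rot_three]
        · refine ⟨ρ y, false, ?_, (heven i hi y).1 h⟩
          rcases hy with rfl | rfl | rfl <;> simp [M.rot_three]
      · exact ⟨y, !b', hy, hodd i hi y b' h⟩
  · have o : ∀ i x b, Odd i → e i = M.arc (x, b) → e (i + 1) = M.arc (x, !b) :=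
      fun i x b hi h => hodd i hi x b h
    cases b
    · have h1 := (heven 0 (by decide) x).2 h0.symm
      have h2 := o 1 _ _ (by decide) h1
      have h3 := (heven 2 (by decide) _).2 h2
      have h4 := o 3 _ _ (by decide) h3
      have h5 := (heven 4 (by decide) _).2 h4
      rw [M.rot_three] at h3 h4 h5
      rw [M.rot_three] at h5
      rintro a ⟨y, b, hy, rfl⟩
      rcases hy with rfl | rfl | rfl <;> cases b
      exacts [⟨0, h0.symm⟩, ⟨5, h5⟩, ⟨4, h4⟩, ⟨3, h3⟩, ⟨2, h2⟩, ⟨1, h1⟩]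
    · have h1 := (heven 0 (by decide) x).1 h0.symm
      have h2 := o 1 _ _ (by decide) h1
      have h3 := (heven 2 (by decide) _).1 h2
      have h4 := o 3 _ _ (by decide) h3
      have h5 := (heven 4 (by decide) _).1 h4
      rw [M.rot_three] at h5
      rintro a ⟨y, b, hy, rfl⟩
      rcases hy with rfl | rfl | rfl <;> cases b
      exacts [⟨5, h5⟩, ⟨0, h0.symm⟩, ⟨1, h1⟩, ⟨2, h2⟩, ⟨3, h3⟩, ⟨4, h4⟩]

theorem isAC_block (x : S) : G.IsAC (M.block x) := by
  have h3 : ∀ k, ρ^[k + 3] x = ρ^[k] x := by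
    intro k
    rw [Function.iterate_add_apply]
    congr 1
    exact M.rot_three x
  have h1 : ∀ y, ρ y ≠ y := M.rot_ne
  have h2 : ∀ y, ρ (ρ y) ≠ y := fun y h => M.rot_ne (ρ (ρ y)) (by rw [M.rot_three, h])
  have hmem : ∀ k, ρ^[k] x = x ∨ ρ^[k] x = ρ x ∨ ρ^[k] x = ρ (ρ x) := by
    intro k
    induction k with
    | zero => exact Or.inl rfl
    | succ k ih =>
      rw [Function.iterate_succ_apply']
      rcases ih with h | h | h <;> rw [h] <;> simp [M.rot_three]
  let e : ℕ → A := fun i => M.arc (ρ^[(i + 1) / 2] x, decide (i % 2 = 0))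
  refine ⟨3, e, by decide, fun i => ?_, ?_, ?_, fun i => ⟨fun hi => ?_, fun hi => ?_⟩⟩
  · have e1 : (i + 2 * 3 + 1) / 2 = (i + 1) / 2 + 3 := by omega
    have e2 : (i + 2 * 3) % 2 = i % 2 := by omega
    simp only [e, e1, e2, h3]
  · intro i hi j hj hij
    have h := M.arc.injective hij
    simp only [Prod.mk.injEq, decide_eq_decide] at h
    obtain ⟨ha, hb⟩ := h
    have hi : i < 6 := hi
    have hj : j < 6 := hj
    interval_cases i <;> interval_cases j <;> simp_all [M.rot_three, (h1 _).symm, (h2 _).symm]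
  · ext a
    constructor
    · rintro ⟨i, rfl⟩
      exact ⟨_, _, hmem _, rfl⟩
    · rintro ⟨y, b, hy, rfl⟩
      rcases hy with rfl | rfl | rfl <;> cases b
      · exact ⟨5, by simp [e, M.rot_three]⟩
      · exact ⟨0, by simp [e]⟩
      · exact ⟨1, by simp [e]⟩
      · exact ⟨2, by simp [e]⟩
      · exact ⟨3, by simp [e]⟩
      · exact ⟨4, by simp [e]⟩
  · obtain ⟨k, rfl⟩ := hi
    have e1 : (k + k + 1) / 2 = k := by omega
    have e2 : (k + k + 1 + 1) / 2 = k + 1 := by omega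
    have e3 : (k + k) % 2 = 0 := by omega
    have e4 : (k + k + 1) % 2 = 1 := by omega
    simp only [e, M.tgt_arc, e1, e2, e3, e4, Function.iterate_succ_apply']
    simp
  · obtain ⟨k, rfl⟩ := hi
    have e1 : (2 * k + 1 + 1) / 2 = k + 1 := by omega
    have e2 : (2 * k + 1 + 1 + 1) / 2 = k + 1 := by omega
    simp only [e, M.src_arc, e1, e2]

theorem allACsHaveSize (M : SlotModel G ρ) : G.AllACsHaveSize 6 := by
  intro X hX
  obtain ⟨x, rfl⟩ := M.eq_block_of_isAC hX
  exact M.ncard_block x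

theorem inPartial6 (M : SlotModel G ρ) : G.InPartial6 := ⟨M.isKDigraph, M.allACsHaveSize⟩

theorem ncard_acs {J : Type*} (M : SlotModel G (rotRow J)) : G.acs.ncard = Nat.card J := by
  have h : G.acs = Set.range fun j => M.block (j, 0) := by
    ext X
    constructor
    · intro hX
      obtain ⟨⟨j, k⟩, rfl⟩ := M.eq_block_of_isAC hX
      refine ⟨j, ?_⟩
      have hk : ∀ k l : Fin 3, l = k ∨ l = k + 1 ∨ l = k + 1 + 1 := by decide
      ext a
      constructor
      · rintro ⟨y, b, hy, rfl⟩
        refine ⟨y, b, ?_, rfl⟩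
        have : y.1 = j := by rcases hy with rfl | rfl | rfl <;> rfl
        simp only [rotRow_apply, Prod.ext_iff, this, true_and]
        exact hk _ _
      · rintro ⟨y, b, hy, rfl⟩
        refine ⟨y, b, ?_, rfl⟩
        have : y.1 = j := by rcases hy with rfl | rfl | rfl <;> rfl
        simp only [rotRow_apply, Prod.ext_iff, this, true_and]
        exact hk _ _
    · rintro ⟨j, rfl⟩
      exact M.isAC_block _
  rw [h, ← Nat.card_coe_set_eq, Nat.card_range_of_injective]
  intro i j hij
  have : M.arc ((i, 0), true) ∈ M.block (j, 0) := by
    rw [show M.block (j, 0) = M.block (i, 0) from hij.symm]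
    exact ⟨_, _, Or.inl rfl, rfl⟩
  obtain ⟨y, b, hy, h⟩ := this
  have h' := M.arc.injective h
  have : y.1 = j := by rcases hy with rfl | rfl | rfl <;> rfl
  rw [← this, ← congrArg (fun p => p.1.1) h']

/-! ### 2-diregular digraphs -/

/-- All slots are glued, by the permutation `c`. -/
def IsGluing (c : Perm S) : Prop := ∀ y, M.inn y = M.out (c y)

variable {M} {c : Perm S}

theorem IsGluing.exists_out (hc : M.IsGluing c) (v : V) : ∃ x, M.out x = v := by
  rcases M.cover v with ⟨x, rfl⟩ | ⟨y, rfl⟩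
  · exact ⟨x, rfl⟩
  · exact ⟨c y, (hc y).symm⟩

theorem IsGluing.exists_inn (hc : M.IsGluing c) (v : V) : ∃ y, M.inn y = v := by
  obtain ⟨x, rfl⟩ := hc.exists_out v
  exact ⟨c.symm x, by rw [hc, Equiv.apply_symm_apply]⟩

theorem IsGluing.isKDiregular (hc : M.IsGluing c) : G.IsKDiregular 2 := fun v =>
  (M.isSat_iff v).2 ⟨hc.exists_inn v, hc.exists_out v⟩

theorem IsGluing.inFull6 (hc : M.IsGluing c) : G.InFull6 := ⟨hc.isKDiregular, M.allACsHaveSize⟩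

theorem exists_isGluing [Finite S] (M : SlotModel G ρ) (hG : G.IsKDiregular 2) :
    ∃ c, M.IsGluing c := by
  refine exists_perm_of_rel (fun y x => M.inn y = M.out x) (fun y => ?_) (fun y y' x h h' => ?_)
  · obtain ⟨x, hx⟩ := ((M.isSat_iff _).1 (hG (M.inn y))).2
    exact ⟨x, hx.symm⟩
  · exact M.inn_injective (h.trans h'.symm)

/-- The arcs of a factor that leave the slots of an orbit. -/
def orbitArcs (M : SlotModel G ρ) (z : CycleChoice ρ) (Φ : Perm S) (x : S) : Set A :=
  {a | ∃ y, Φ.SameCycle x y ∧ a = M.arc (y, z.1 y)}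

theorem IsGluing.isCircuit_orbitArcs [Finite S] (hc : M.IsGluing c) (z : CycleChoice ρ) (x : S) :
    G.IsCircuit (M.orbitArcs z (c * turn ρ z) x) := by
  have h := M.isCircuit_of_perm z (c * turn ρ z) x fun i => by
    rw [hc, pow_succ', Perm.mul_apply _ (_ ^ i)]
    rfl
  convert h using 1
  ext a
  constructor
  · rintro ⟨y, hy, rfl⟩
    obtain ⟨i, -, rfl⟩ := hy.exists_pow_eq'
    exact ⟨i, rfl⟩
  · rintro ⟨i, rfl⟩
    exact ⟨_, ⟨i, by simp⟩, rfl⟩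

theorem IsGluing.eq_orbitArcs [Finite S] (hc : M.IsGluing c) {z : CycleChoice ρ} {X : Set A}
    (hX : X ⊆ M.fac z) (hX' : G.IsCircuit X) : ∃ x, X = M.orbitArcs z (c * turn ρ z) x := by
  obtain ⟨r, e, hr, -, -, rfl, hstep⟩ := hX'
  have hex : ∀ i, ∃ x, e i = M.arc (x, z.1 x) := fun i => hX ⟨i, rfl⟩
  choose x hx using hex
  have hs : ∀ i, x (i + 1) = (c * turn ρ z) (x i) := by
    intro i
    have := hstep i
    rw [hx i, hx (i + 1), M.tgt_arc_choice, M.src_arc, hc] at this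
    exact (M.out_injective this).symm
  have hp : ∀ i : ℕ, x i = ((c * turn ρ z) ^ i) (x 0) := by
    intro i
    induction i with
    | zero => rfl
    | succ i ih => rw [hs, ih, pow_succ', Perm.mul_apply _ (_ ^ i)]
  refine ⟨x 0, ?_⟩
  ext a
  constructor
  · rintro ⟨i, rfl⟩
    exact ⟨x i, ⟨i, by rw [hp i]; simp⟩, hx i⟩
  · rintro ⟨y, hy, rfl⟩
    obtain ⟨i, -, rfl⟩ := hy.exists_pow_eq'
    exact ⟨i, by rw [hx i, hp i]⟩

/-- The cycles of a factor are the orbits of the permutation that follows an arc of the factor and then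
passes to the slot of the next arc. -/
theorem IsGluing.index_fac [Finite S] (hc : M.IsGluing c) (z : CycleChoice ρ) :
    G.index (M.fac z) = (c * turn ρ z).numOrbits := by
  rw [index, ← Nat.card_coe_set_eq, Perm.numOrbits]
  symm
  let Φ := c * turn ρ z
  have hlift : ∀ x y, Φ.SameCycle x y → M.orbitArcs z Φ x = M.orbitArcs z Φ y := by
    intro x y h
    ext a
    exact ⟨fun ⟨w, hw, ha⟩ => ⟨w, h.symm.trans hw, ha⟩, fun ⟨w, hw, ha⟩ => ⟨w, h.trans hw, ha⟩⟩
  refine Nat.card_congr (Equiv.ofBijective (fun q : Quotient (Perm.SameCycle.setoid Φ) =>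
    (⟨Quotient.lift (fun x => M.orbitArcs z Φ x) hlift q, ?_⟩ :
      {X | X ⊆ M.fac z ∧ G.IsCircuit X})) ⟨?_, ?_⟩)
  · induction q using Quotient.inductionOn with
    | h x =>
      refine ⟨?_, hc.isCircuit_orbitArcs z x⟩
      rintro a ⟨y, -, rfl⟩
      exact ⟨y, rfl⟩
  · rintro ⟨x⟩ ⟨y⟩ h
    have h : M.orbitArcs z Φ x = M.orbitArcs z Φ y := congrArg Subtype.val h
    have : M.arc (x, z.1 x) ∈ M.orbitArcs z Φ y := by
      rw [← h]
      exact ⟨x, Perm.SameCycle.refl _ _, rfl⟩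
    obtain ⟨w, hw, ha⟩ := this
    have := M.arc.injective ha
    simp only [Prod.mk.injEq] at this
    rw [← this.1] at hw
    exact Quotient.sound hw.symm
  · rintro ⟨X, hX, hX'⟩
    obtain ⟨x, rfl⟩ := hc.eq_orbitArcs hX hX'
    exact ⟨Quotient.mk _ x, rfl⟩

theorem IsGluing.isOdd_iff_forall [Finite S] (hc : M.IsGluing c) :
    G.IsOdd ↔ ∀ z : CycleChoice ρ, Odd (c * turn ρ z).numOrbits := by
  constructor
  · intro h z
    rw [← hc.index_fac]
    exact h _ ((M.isFactor_iff _).2 ⟨z, rfl⟩)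
  · intro h B hB
    obtain ⟨z, rfl⟩ := (M.isFactor_iff B).1 hB
    rw [hc.index_fac]
    exact h z

theorem IsGluing.isHamiltonian_iff [Finite S] [Nonempty S] (hc : M.IsGluing c) :
    G.IsHamiltonian ↔ ∃ z : CycleChoice ρ, (c * turn ρ z).IsSingleOrbit := by
  constructor
  · rintro ⟨X, hX, hcov⟩
    have hfac : G.IsFactor X := by
      obtain ⟨r, e, hr, hper, hinj, rfl, hstep⟩ := hX
      have hper' : Function.Periodic e r := hper
      have hmod : ∀ i j, G.src (e i) = G.src (e j) → i ≡ j [MOD r] := by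
        intro i j h
        rw [← hper'.map_mod_nat i, ← hper'.map_mod_nat j] at h
        exact hinj (Nat.mod_lt _ hr) (Nat.mod_lt _ hr) h
      have heq : ∀ i j, i ≡ j [MOD r] → e i = e j := by
        intro i j h
        rw [← hper'.map_mod_nat i, ← hper'.map_mod_nat j]
        exact congrArg e h
      rw [M.isFactor_iff_existsUnique]
      constructor
      · intro x
        obtain ⟨_, ⟨i, rfl⟩, hi⟩ := hcov (M.out x)
        refine ⟨e i, ⟨⟨i, rfl⟩, hi⟩, ?_⟩
        rintro _ ⟨⟨j, rfl⟩, hj⟩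
        exact heq _ _ (hmod _ _ (hj.trans hi.symm))
      · intro y
        obtain ⟨_, ⟨i, rfl⟩, hi⟩ := hcov (M.inn y)
        obtain ⟨k, hk⟩ : ∃ k, i + r = k + 1 := ⟨i + r - 1, by omega⟩
        have hk' : G.tgt (e k) = M.inn y := by rw [hstep, ← hk, hper, hi]
        refine ⟨e k, ⟨⟨k, rfl⟩, hk'⟩, ?_⟩
        rintro _ ⟨⟨j, rfl⟩, hj⟩
        have : G.src (e (j + 1)) = G.src (e (k + 1)) := by rw [← hstep, ← hstep, hj, hk']
        exact heq _ _ (Nat.ModEq.add_right_cancel' 1 (hmod _ _ this))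
    obtain ⟨z, rfl⟩ := (M.isFactor_iff X).1 hfac
    refine ⟨z, ?_⟩
    obtain ⟨x, hx⟩ := hc.eq_orbitArcs subset_rfl hX
    have hall : ∀ y, (c * turn ρ z).SameCycle x y := by
      intro y
      have : M.arc (y, z.1 y) ∈ M.fac z := ⟨y, rfl⟩
      rw [hx] at this
      obtain ⟨w, hw, ha⟩ := this
      have := M.arc.injective ha
      simp only [Prod.mk.injEq] at this
      rwa [this.1]
    exact fun y y' => (hall y).symm.trans (hall y')
  · rintro ⟨z, hz⟩
    obtain ⟨x⟩ := ‹Nonempty S›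
    refine ⟨_, hc.isCircuit_orbitArcs z x, fun v => ?_⟩
    obtain ⟨y, rfl⟩ := hc.exists_out v
    exact ⟨_, ⟨y, hz x y, rfl⟩, M.src_arc _ _⟩

end SlotModel
end MultiDigraph

namespace MultiDigraph

universe w₁ w₂ w₃ w₄ w₅ w₆

variable {V : Type w₁} {A : Type w₂} {S : Type w₃} {V' : Type w₄} {A' : Type w₅} {T : Type w₆}

/-! ### Gluing two 2-digraphs -/

namespace SlotModel

variable {F : MultiDigraph V A} {ρ : Perm S} (M : SlotModel F ρ)
variable {H : MultiDigraph V' A'} {σ : Perm T} (N : SlotModel H σ)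
variable (ι : F.Entry ≃ H.Exit) (κ : F.Exit ≃ H.Entry)

/-- The in-slot on the left lies at the same vertex as the out-slot on the right, once the entry
vertices of `F` are identified with the exit vertices of `H` through `ι` and the exit vertices of
`F` with the entry vertices of `H` through `κ`. -/
def GlueRel : T ⊕ S → T ⊕ S → Prop
  | .inr y, .inr x => M.inn y = M.out x
  | .inr y, .inl x => ∃ d : F.Exit, M.inn y = d.1 ∧ N.out x = (κ d).1
  | .inl y, .inl x => N.inn y = N.out x
  | .inl y, .inr x => ∃ u : F.Entry, N.inn y = (ι u).1 ∧ M.out x = u.1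

/-- The permutation of the slots that describes the 2-diregular digraph glued from `H` and `F`. -/
def IsGlue (c : Perm (T ⊕ S)) : Prop := ∀ y, GlueRel M N ι κ y (c y)

theorem GlueRel.unique_right {y x x' : T ⊕ S} (h : GlueRel M N ι κ y x)
    (h' : GlueRel M N ι κ y x') : x = x' := by
  rcases y with y | y <;> rcases x with x | x <;> rcases x' with x' | x'
  · exact congrArg _ (N.out_injective (Eq.trans (Eq.symm h) h'))
  · obtain ⟨u, hu, -⟩ := h'
    exact absurd (hu.symm.trans h) (N.exit_ne_out _ _)
  · obtain ⟨u, hu, -⟩ := h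
    exact absurd (hu.symm.trans h') (N.exit_ne_out _ _)
  · obtain ⟨u, hu, hx⟩ := h
    obtain ⟨u', hu', hx'⟩ := h'
    have : u = u' := ι.injective (Subtype.ext (hu.symm.trans hu'))
    exact congrArg _ (M.out_injective (by rw [hx, hx', this]))
  · obtain ⟨u, hu, hx⟩ := h
    obtain ⟨u', hu', hx'⟩ := h'
    have : u = u' := Subtype.ext (hu.symm.trans hu')
    exact congrArg _ (N.out_injective (by rw [hx, hx', this]))
  · obtain ⟨u, hu, -⟩ := h
    exact absurd (hu.symm.trans h') (M.exit_ne_out _ _)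
  · obtain ⟨u, hu, -⟩ := h'
    exact absurd (hu.symm.trans h) (M.exit_ne_out _ _)
  · exact congrArg _ (M.out_injective (Eq.trans (Eq.symm h) h'))

theorem GlueRel.unique_left {y y' x : T ⊕ S} (h : GlueRel M N ι κ y x)
    (h' : GlueRel M N ι κ y' x) : y = y' := by
  rcases x with x | x <;> rcases y with y | y <;> rcases y' with y' | y'
  · exact congrArg _ (N.inn_injective (Eq.trans h (Eq.symm h')))
  · obtain ⟨d, -, hd⟩ := h'
    exact absurd (hd.symm.trans (Eq.symm h)) (N.entry_ne_inn _ _)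
  · obtain ⟨d, -, hd⟩ := h
    exact absurd (hd.symm.trans (Eq.symm h')) (N.entry_ne_inn _ _)
  · obtain ⟨d, hy, hd⟩ := h
    obtain ⟨d', hy', hd'⟩ := h'
    have : d = d' := κ.injective (Subtype.ext (hd.symm.trans hd'))
    exact congrArg _ (M.inn_injective (by rw [hy, hy', this]))
  · obtain ⟨d, hy, hd⟩ := h
    obtain ⟨d', hy', hd'⟩ := h'
    have : d = d' := Subtype.ext (hd.symm.trans hd')
    exact congrArg _ (N.inn_injective (by rw [hy, hy', this]))
  · obtain ⟨d, -, hd⟩ := h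
    exact absurd (hd.symm.trans (Eq.symm h')) (M.entry_ne_inn _ _)
  · obtain ⟨d, -, hd⟩ := h'
    exact absurd (hd.symm.trans (Eq.symm h)) (M.entry_ne_inn _ _)
  · exact congrArg _ (M.inn_injective (Eq.trans h (Eq.symm h')))

theorem exists_isGlue [Finite S] [Finite T] : ∃ c, IsGlue M N ι κ c := by
  refine exists_perm_of_rel (GlueRel M N ι κ) (fun y => ?_)
    fun y y' x h h' => GlueRel.unique_left M N ι κ h h'
  rcases y with y | y
  · rcases N.exit_or_out y with ⟨d, hd⟩ | ⟨x, hx⟩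
    · refine ⟨.inr (M.entrySlot (ι.symm d)), ι.symm d, ?_, M.out_entrySlot _⟩
      rw [hd, ι.apply_symm_apply]
    · exact ⟨.inl x, hx⟩
  · rcases M.exit_or_out y with ⟨d, hd⟩ | ⟨x, hx⟩
    · exact ⟨.inl (N.entrySlot (κ d)), d, hd, N.out_entrySlot _⟩
    · exact ⟨.inr x, hx⟩

/-- Choices for two 2-digraphs, taken together. -/
def _root_.sumChoice {ρ : Perm S} {σ : Perm T} (w : CycleChoice σ) (z : CycleChoice ρ) :
    CycleChoice (Equiv.sumCongr σ ρ) :=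
  ⟨Sum.elim w.1 z.1, by rintro (x | x) <;> simp [w.2, z.2]⟩

theorem _root_.exists_eq_sumChoice {ρ : Perm S} {σ : Perm T}
    (z : CycleChoice (Equiv.sumCongr σ ρ)) :
    ∃ (w : CycleChoice σ) (z' : CycleChoice ρ), z = sumChoice w z' := by
  refine ⟨⟨fun x => z.1 (.inl x), fun x => z.2 (.inl x)⟩,
    ⟨fun x => z.1 (.inr x), fun x => z.2 (.inr x)⟩, Subtype.ext (funext ?_)⟩
  rintro (x | x) <;> rfl

theorem _root_.turn_sumChoice_inl {ρ : Perm S} {σ : Perm T} (w : CycleChoice σ)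
    (z : CycleChoice ρ) (x : T) :
    turn (Equiv.sumCongr σ ρ) (sumChoice w z) (.inl x) = .inl (turn σ w x) := by
  simp only [turn_apply, sumChoice, Sum.elim_inl]
  cases w.1 x <;> rfl

theorem _root_.turn_sumChoice_inr {ρ : Perm S} {σ : Perm T} (w : CycleChoice σ)
    (z : CycleChoice ρ) (x : S) :
    turn (Equiv.sumCongr σ ρ) (sumChoice w z) (.inr x) = .inr (turn ρ z x) := by
  simp only [turn_apply, sumChoice, Sum.elim_inr]
  cases z.1 x <;> rfl

variable {M N ι κ}

theorem IsGlue.apply_eq {c : Perm (T ⊕ S)} (hc : IsGlue M N ι κ c) {y x : T ⊕ S}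
    (h : GlueRel M N ι κ y x) : c y = x :=
  GlueRel.unique_right M N ι κ (hc y) h

section Reduction

variable {c : Perm (T ⊕ S)}

theorem IsGlue.step_inr (hc : IsGlue M N ι κ c) (z : CycleChoice ρ) (w : CycleChoice σ)
    {x x' : S} (h : M.inn (turn ρ z x) = M.out x') :
    (c * turn (Equiv.sumCongr σ ρ) (sumChoice w z)) (.inr x) = .inr x' := by
  rw [Perm.mul_apply, turn_sumChoice_inr]
  exact hc.apply_eq h

theorem IsGlue.step_inl (hc : IsGlue M N ι κ c) (z : CycleChoice ρ) (w : CycleChoice σ)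
    {x x' : T} (h : N.inn (turn σ w x) = N.out x') :
    (c * turn (Equiv.sumCongr σ ρ) (sumChoice w z)) (.inl x) = .inl x' := by
  rw [Perm.mul_apply, turn_sumChoice_inl]
  exact hc.apply_eq h

theorem IsGlue.exit_inr (hc : IsGlue M N ι κ c) (z : CycleChoice ρ) (w : CycleChoice σ)
    {x : S} {d : F.Exit} (h : M.inn (turn ρ z x) = d.1) :
    (c * turn (Equiv.sumCongr σ ρ) (sumChoice w z)) (.inr x) = .inl (N.entrySlot (κ d)) := by
  rw [Perm.mul_apply, turn_sumChoice_inr]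
  exact hc.apply_eq ⟨d, h, N.out_entrySlot _⟩

theorem IsGlue.exit_inl (hc : IsGlue M N ι κ c) (z : CycleChoice ρ) (w : CycleChoice σ)
    {x : T} {d : H.Exit} (h : N.inn (turn σ w x) = d.1) :
    (c * turn (Equiv.sumCongr σ ρ) (sumChoice w z)) (.inl x) =
      .inr (M.entrySlot (ι.symm d)) := by
  rw [Perm.mul_apply, turn_sumChoice_inl]
  exact hc.apply_eq ⟨ι.symm d, by rw [ι.apply_symm_apply, h], M.out_entrySlot _⟩

/-- If the part of a factor in `F` has no cycles, with open route `r`, then `F` may be contracted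
along `r`: this changes neither the number of cycles of the factor nor their being a single one. -/
theorem IsGlue.orbit_reduction (hc : IsGlue M N ι κ c) {z : CycleChoice ρ} (w : CycleChoice σ)
    {r : F.Entry ≃ F.Exit} (hr : M.IsRoute z r) {d : Perm T}
    (hd : N.IsClosing (ι.symm.trans (r.trans κ)) d) :
    (c * turn (Equiv.sumCongr σ ρ) (sumChoice w z)).numOrbits = (d * turn σ w).numOrbits ∧
      ((c * turn (Equiv.sumCongr σ ρ) (sumChoice w z)).IsSingleOrbit ↔
        (d * turn σ w).IsSingleOrbit) := by
  choose X hX using hr.1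
  set Φ := c * turn (Equiv.sumCongr σ ρ) (sumChoice w z) with hΦ
  set π : T ⊕ S → T := Sum.elim id fun x => N.entrySlot (κ (X x)) with hπ
  have hE : ∀ x, Φ.SameCycle (.inr x) (.inl (N.entrySlot (κ (X x)))) := fun x =>
    (hX x).sameCycle Sum.inr (fun _ _ h => hc.step_inr z w h)
      (fun e => .inl (N.entrySlot (κ e))) (fun _ _ h => hc.exit_inr z w h)
  refine Perm.orbit_reduction Sum.inl π ?_ ?_ ?_ (fun _ => Perm.SameCycle.refl _ _)
  · rintro (y | x)
    · exact Perm.SameCycle.refl _ _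
    · exact hE x
  · rintro (y | x)
    · rcases N.exit_or_out (turn σ w y) with ⟨e, he⟩ | ⟨x', hx'⟩
      · rw [hc.exit_inl z w he]
        have h1 : π (.inr (M.entrySlot (ι.symm e))) = (d * turn σ w) y := by
          change N.entrySlot (κ (X _)) = _
          rw [(hX _).unique (hr.2 _), Perm.mul_apply, hd.apply_of_exit he]
          rfl
        rw [h1]
        exact Perm.sameCycle_apply_self _ _
      · rw [hc.step_inl z w hx']
        have h1 : π (.inl x') = (d * turn σ w) y := (hd.apply_of_eq hx').symm
        rw [h1]
        exact Perm.sameCycle_apply_self _ _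
    · rcases M.exit_or_out (turn ρ z x) with ⟨e, he⟩ | ⟨x', hx'⟩
      · rw [hc.exit_inr z w he, show π (.inr x) = N.entrySlot (κ (X x)) from rfl,
          (hX x).eq_of_exit he]
        exact Perm.SameCycle.refl _ _
      · rw [hc.step_inr z w hx', show π (.inr x) = N.entrySlot (κ (X x)) from rfl,
          ((hX x).of_step hx').unique (hX x')]
        exact Perm.SameCycle.refl _ _
  · intro y
    rcases N.exit_or_out (turn σ w y) with ⟨e, he⟩ | ⟨x', hx'⟩
    · refine (Perm.sameCycle_apply_self Φ _).trans ?_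
      rw [hc.exit_inl z w he]
      refine (hE _).trans ?_
      rw [(hX _).unique (hr.2 _), Perm.mul_apply, hd.apply_of_exit he]
      exact Perm.SameCycle.refl _ _
    · refine (Perm.sameCycle_apply_self Φ _).trans ?_
      rw [hc.step_inl z w hx', Perm.mul_apply, hd.apply_of_eq hx']

theorem IsGlue.isOpen_right [Finite S] [Finite T] (hc : IsGlue M N ι κ c) {z : CycleChoice ρ}
    {w : CycleChoice σ}
    (h : (c * turn (Equiv.sumCongr σ ρ) (sumChoice w z)).IsSingleOrbit) (d : F.Exit) :
    M.IsOpen z :=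
  isOpen_of_isSingleOrbit h Sum.inr Sum.inr_injective (fun _ _ hx => hc.step_inr z w hx) d

end Reduction

end SlotModel

/-! ### Identifying vertices -/

namespace SlotModel

variable {G : MultiDigraph V A} {ρ : Perm S} (M : SlotModel G ρ)

/-- Let `f` assign to every vertex an out-slot whose vertex it is identified with. If `f` is
compatible with the identification, the digraph obtained by identification is 2-diregular. -/
theorem exists_identify (R : V → V → Prop) (c : Perm S) (f : V → S) (hout : ∀ x, f (M.out x) = x)
    (hinn : ∀ y, f (M.inn y) = c y) (hR : ∀ u v, R u v → f u = f v)
    (hmk : ∀ v, Quot.mk R v = Quot.mk R (M.out (f v))) :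
    ∃ M' : SlotModel (G.identify R) ρ, M'.IsGluing c := by
  let g : Quot R → S := Quot.lift f hR
  have hg : ∀ v, g (Quot.mk R v) = f v := fun v => rfl
  refine ⟨{ out := fun x => Quot.mk R (M.out x)
            inn := fun y => Quot.mk R (M.inn y)
            arc := M.arc
            rot_three := M.rot_three
            rot_ne := M.rot_ne
            out_injective := fun x x' h => ?_
            inn_injective := fun x x' h => ?_
            src_arc := fun x b => congrArg (Quot.mk R) (M.src_arc x b)
            tgt_arc := fun x b => congrArg (Quot.mk R) (M.tgt_arc x b)
            cover := ?_ }, fun y => ?_⟩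
  · have := congrArg g h
    rwa [hg, hg, hout, hout] at this
  · have := congrArg g h
    rw [hg, hg, hinn, hinn] at this
    exact c.injective this
  · rintro ⟨v⟩
    exact Or.inl ⟨f v, (hmk v).symm⟩
  · have := hmk (M.inn y)
    rwa [hinn] at this

/-- Identifying the exit vertices with the entry vertices. -/
theorem exists_identify_closing [Finite S] (R : V → V → Prop) {b : G.Exit ≃ G.Entry} {c : Perm S}
    (hc : M.IsClosing b c) (hR : ∀ u v, R u v ↔ ∃ d : G.Exit, u = d.1 ∧ v = (b d).1) :
    ∃ M' : SlotModel (G.identify R) ρ, M'.IsGluing c := by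
  have hex : ∀ v, ∃ x, v = M.out x ∨ ∃ d : G.Exit, v = d.1 ∧ x = M.entrySlot (b d) := by
    intro v
    by_cases h : v ∈ Set.range M.out
    · obtain ⟨x, rfl⟩ := h
      exact ⟨x, Or.inl rfl⟩
    · have hv : G.IsExit 2 v := (M.isExit_iff v).2 ⟨(M.cover v).resolve_left h, h⟩
      exact ⟨_, Or.inr ⟨⟨v, hv⟩, rfl, rfl⟩⟩
  choose f hf using hex
  have hout : ∀ x, f (M.out x) = x := by
    intro x
    rcases hf (M.out x) with h | ⟨d, h, -⟩
    · exact (M.out_injective h).symm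
    · exact absurd h.symm (M.exit_ne_out _ _)
  have hexit : ∀ d : G.Exit, f d.1 = M.entrySlot (b d) := by
    intro d
    rcases hf d.1 with h | ⟨d', h, h'⟩
    · exact absurd h (M.exit_ne_out _ _)
    · rw [h', Subtype.ext h]
  refine M.exists_identify R c f hout (fun y => ?_) (fun u v h => ?_) (fun v => ?_)
  · rcases M.exit_or_out y with ⟨d, hd⟩ | ⟨x, hx⟩
    · rw [hd, hexit, hc.apply_of_exit hd]
    · rw [hx, hout, hc.apply_of_eq hx]
  · obtain ⟨d, rfl, rfl⟩ := (hR u v).1 h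
    rw [hexit, ← M.out_entrySlot, hout]
  · rcases hf v with h | ⟨d, h, h'⟩
    · rw [← h]
    · rw [h', M.out_entrySlot]
      exact Quot.sound ((hR _ _).2 ⟨d, h, rfl⟩)

/-- The disjoint union of two slot models. -/
def sum {F : MultiDigraph V A} {ρ : Perm S} (M : SlotModel F ρ)
    {H : MultiDigraph V' A'} {σ : Perm T} (N : SlotModel H σ) :
    SlotModel (H.disjUnion F) (Equiv.sumCongr σ ρ) where
  out := Sum.map N.out M.out
  inn := Sum.map N.inn M.inn
  arc := (Equiv.sumProdDistrib T S Bool).trans (Equiv.sumCongr N.arc M.arc)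
  rot_three := by rintro (x | x) <;> simp [M.rot_three, N.rot_three]
  rot_ne := by rintro (x | x) <;> simp [M.rot_ne, N.rot_ne]
  out_injective := N.out_injective.sumMap M.out_injective
  inn_injective := N.inn_injective.sumMap M.inn_injective
  src_arc := by
    rintro (x | x) b
    · exact congrArg Sum.inl (N.src_arc x b)
    · exact congrArg Sum.inr (M.src_arc x b)
  tgt_arc := by
    rintro (x | x) b
    · refine (congrArg Sum.inl (N.tgt_arc x b)).trans ?_
      cases b <;> rfl
    · refine (congrArg Sum.inr (M.tgt_arc x b)).trans ?_
      cases b <;> rfl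
  cover := by
    rintro (v | v)
    · rcases N.cover v with ⟨x, rfl⟩ | ⟨x, rfl⟩
      · exact Or.inl ⟨.inl x, rfl⟩
      · exact Or.inr ⟨.inl x, rfl⟩
    · rcases M.cover v with ⟨x, rfl⟩ | ⟨x, rfl⟩
      · exact Or.inl ⟨.inr x, rfl⟩
      · exact Or.inr ⟨.inr x, rfl⟩

variable {F : MultiDigraph V A} {ρ : Perm S} {M : SlotModel F ρ}
variable {H : MultiDigraph V' A'} {σ : Perm T} {N : SlotModel H σ}
variable {ι : F.Entry ≃ H.Exit} {κ : F.Exit ≃ H.Entry}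

/-- Identifying the entry and exit vertices of one 2-digraph with the exit and entry vertices of
another. -/
theorem IsGlue.exists_identify {c : Perm (T ⊕ S)} (hc : IsGlue M N ι κ c)
    (R : V' ⊕ V → V' ⊕ V → Prop)
    (hR : ∀ x y, R x y ↔ (∃ u : F.Entry, x = .inl (ι u).1 ∧ y = .inr u.1) ∨
      ∃ d : F.Exit, x = .inl (κ d).1 ∧ y = .inr d.1) :
    ∃ M' : SlotModel ((H.disjUnion F).identify R) (Equiv.sumCongr σ ρ), M'.IsGluing c := by
  have hex : ∀ v : V' ⊕ V, ∃ x : T ⊕ S, v = (M.sum N).out x ∨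
      (∃ u : F.Entry, v = .inl (ι u).1 ∧ x = .inr (M.entrySlot u)) ∨
      ∃ d : F.Exit, v = .inr d.1 ∧ x = .inl (N.entrySlot (κ d)) := by
    rintro (v | v)
    · by_cases h : v ∈ Set.range N.out
      · obtain ⟨x, rfl⟩ := h
        exact ⟨.inl x, Or.inl rfl⟩
      · have hv : H.IsExit 2 v := (N.isExit_iff v).2 ⟨(N.cover v).resolve_left h, h⟩
        exact ⟨_, Or.inr (Or.inl ⟨ι.symm ⟨v, hv⟩, by rw [ι.apply_symm_apply], rfl⟩)⟩
    · by_cases h : v ∈ Set.range M.out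
      · obtain ⟨x, rfl⟩ := h
        exact ⟨.inr x, Or.inl rfl⟩
      · have hv : F.IsExit 2 v := (M.isExit_iff v).2 ⟨(M.cover v).resolve_left h, h⟩
        exact ⟨_, Or.inr (Or.inr ⟨⟨v, hv⟩, rfl, rfl⟩)⟩
  choose f hf using hex
  have hoi : ∀ x, (M.sum N).out (.inl x) = .inl (N.out x) := fun _ => rfl
  have hor : ∀ x, (M.sum N).out (.inr x) = .inr (M.out x) := fun _ => rfl
  have hout : ∀ x, f ((M.sum N).out x) = x := by
    intro x
    rcases hf ((M.sum N).out x) with h | ⟨u, h, -⟩ | ⟨d, h, -⟩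
    · exact ((M.sum N).out_injective h).symm
    · rcases x with x | x
      · exact absurd (Sum.inl_injective h).symm (N.exit_ne_out _ _)
      · exact absurd h Sum.inr_ne_inl
    · rcases x with x | x
      · exact absurd h Sum.inl_ne_inr
      · exact absurd (Sum.inr_injective h).symm (M.exit_ne_out _ _)
  have hexitH : ∀ u : F.Entry, f (.inl (ι u).1) = .inr (M.entrySlot u) := by
    intro u
    rcases hf (.inl (ι u).1) with h | ⟨u', h, h'⟩ | ⟨d, h, -⟩
    · rcases hx : f (.inl (ι u).1) with x | x <;> rw [hx] at h
      · exact absurd (Sum.inl_injective h) (N.exit_ne_out _ _)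
      · exact absurd h Sum.inl_ne_inr
    · rw [h', ι.injective (Subtype.ext (Sum.inl_injective h))]
    · exact absurd h Sum.inl_ne_inr
  have hexitF : ∀ d : F.Exit, f (.inr d.1) = .inl (N.entrySlot (κ d)) := by
    intro d
    rcases hf (.inr d.1) with h | ⟨u', h, h'⟩ | ⟨d', h, h'⟩
    · rcases hx : f (.inr d.1) with x | x <;> rw [hx] at h
      · exact absurd h Sum.inr_ne_inl
      · exact absurd (Sum.inr_injective h) (M.exit_ne_out _ _)
    · exact absurd h Sum.inr_ne_inl
    · have : d = d' := Subtype.ext (Sum.inr_injective h)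
      rw [h', this]
  refine (M.sum N).exists_identify R c f hout (fun y => ?_) (fun x y h => ?_) (fun v => ?_)
  · rcases y with y | y
    · rcases N.exit_or_out y with ⟨d, hd⟩ | ⟨x, hx⟩
      · have h1 : (M.sum N).inn (.inl y) = .inl (ι (ι.symm d)).1 := by
          rw [ι.apply_symm_apply, ← hd]
          rfl
        rw [h1, hexitH]
        have h2 : GlueRel M N ι κ (.inl y) (.inr (M.entrySlot (ι.symm d))) :=
          ⟨ι.symm d, by rw [ι.apply_symm_apply, hd], M.out_entrySlot _⟩
        exact (hc.apply_eq h2).symm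
      · have h1 : (M.sum N).inn (.inl y) = (M.sum N).out (.inl x) := congrArg Sum.inl hx
        have h2 : GlueRel M N ι κ (.inl y) (.inl x) := hx
        rw [h1, hout]
        exact (hc.apply_eq h2).symm
    · rcases M.exit_or_out y with ⟨d, hd⟩ | ⟨x, hx⟩
      · have h1 : (M.sum N).inn (.inr y) = .inr d.1 := by
          rw [← hd]
          rfl
        rw [h1, hexitF]
        have h2 : GlueRel M N ι κ (.inr y) (.inl (N.entrySlot (κ d))) :=
          ⟨d, hd, N.out_entrySlot _⟩
        exact (hc.apply_eq h2).symm
      · have h1 : (M.sum N).inn (.inr y) = (M.sum N).out (.inr x) := congrArg Sum.inr hx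
        have h2 : GlueRel M N ι κ (.inr y) (.inr x) := hx
        rw [h1, hout]
        exact (hc.apply_eq h2).symm
  · rcases (hR x y).1 h with ⟨u, rfl, rfl⟩ | ⟨d, rfl, rfl⟩
    · rw [hexitH, ← M.out_entrySlot, ← hor, hout]
    · rw [hexitF, ← N.out_entrySlot, ← hoi, hout]
  · rcases hf v with h | ⟨u, rfl, h'⟩ | ⟨d, rfl, h'⟩
    · rw [← h]
    · rw [h', hor, M.out_entrySlot]
      exact Quot.sound ((hR _ _).2 (Or.inl ⟨u, rfl, rfl⟩))
    · rw [h', hoi, N.out_entrySlot]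
      exact (Quot.sound ((hR _ _).2 (Or.inr ⟨d, rfl, rfl⟩))).symm

end SlotModel
end MultiDigraph

/-! ### Residues -/

section Residue

variable {n : ℕ}

theorem mem_excludedSet_iff (P : Set (Perm (Fin n))) (x : Perm (Fin n)) :
    x ∈ excludedSet P ↔ ∃ p ∈ P, p * x ∈ cyclicPerms n := by
  constructor
  · rintro ⟨p, hp, c, hc, rfl⟩
    exact ⟨p, hp, by rwa [mul_inv_cancel_left]⟩
  · rintro ⟨p, hp, h⟩
    exact ⟨p, hp, _, h, by rw [inv_mul_cancel_left]⟩

theorem IsUniformSet.sign_eq {P : Set (Perm (Fin n))} (hP : IsUniformSet P) {p q : Perm (Fin n)}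
    (hp : p ∈ P) (hq : q ∈ P) : Perm.sign p = Perm.sign q := by
  rcases hP.2 with h | h <;> rw [h p hp, h q hq]

theorem isUniformSet_of_sign_eq {P : Set (Perm (Fin n))} {p : Perm (Fin n)} (hp : p ∈ P)
    (h : ∀ q ∈ P, Perm.sign q = Perm.sign p) : IsUniformSet P := by
  refine ⟨⟨p, hp⟩, ?_⟩
  rcases Int.units_eq_one_or (Perm.sign p) with h' | h'
  · exact Or.inl fun q hq => (h q hq).trans h'
  · exact Or.inr fun q hq => (h q hq).trans h'

/-- The residue consists of the permutations that have the parity of an `n`-cycle when composed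
with an element of `P`, but do not yield an `n`-cycle with any of them. -/
theorem mem_residue_iff {P : Set (Perm (Fin n))} (hP : IsUniformSet P) {p : Perm (Fin n)}
    (hp : p ∈ P) (x : Perm (Fin n)) :
    x ∈ residue P ↔ Perm.sign (p * x) = -(-1) ^ n ∧ x ∉ excludedSet P := by
  have hE : IsEvenSet P ↔ Perm.sign p = 1 := by
    constructor
    · intro h
      exact h p hp
    · intro h q hq
      rw [hP.sign_eq hq hp, h]
  have key : ∀ s t : ℤˣ, s = -1 * t ∨ s = 1 * t := by decide
  rw [residue, hE, Perm.sign_mul]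
  rcases Nat.even_or_odd n with hn | hn
  · rw [hn.neg_one_pow]
    rcases Int.units_eq_one_or (Perm.sign p) with h | h <;> rw [h]
    · simp [hn]
    · rw [if_neg (by simp [hn])]
      simp
  · rw [hn.neg_one_pow]
    have hn' : ¬ Even n := Nat.not_even_iff_odd.2 hn
    rcases Int.units_eq_one_or (Perm.sign p) with h | h <;> rw [h]
    · simp [hn']
    · rw [if_pos (by simp [hn'])]
      simp [neg_eq_iff_eq_neg]

theorem mul_mem_cyclicPerms_comm (a b : Perm (Fin n)) :
    a * b ∈ cyclicPerms n ↔ b * a ∈ cyclicPerms n := by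
  rw [mem_cyclicPerms_iff, mem_cyclicPerms_iff]
  exact (Perm.orbit_reduction_conj (φ := a * b) (ψ := b * a) b fun x => rfl).2

theorem isUniformSet_mul {P : Set (Perm (Fin n))} (hP : IsUniformSet P) (a b : Perm (Fin n)) :
    IsUniformSet {q | ∃ p ∈ P, q = a * p * b} := by
  obtain ⟨p, hp⟩ := hP.1
  refine isUniformSet_of_sign_eq (p := a * p * b) ⟨p, hp, rfl⟩ ?_
  rintro _ ⟨q, hq, rfl⟩
  simp only [Perm.sign_mul, hP.sign_eq hq hp]

/-- The effect of relabelling on residues. -/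
theorem mem_residue_mul_iff {P : Set (Perm (Fin n))} (hP : IsUniformSet P) (a b x : Perm (Fin n)) :
    x ∈ residue {q | ∃ p ∈ P, q = a * p * b} ↔ b * x * a ∈ residue P := by
  obtain ⟨p, hp⟩ := hP.1
  rw [mem_residue_iff (isUniformSet_mul hP a b) ⟨p, hp, rfl⟩, mem_residue_iff hP hp,
    mem_excludedSet_iff, mem_excludedSet_iff]
  refine and_congr ?_ (not_congr ?_)
  · simp only [Perm.sign_mul]
    rw [show Perm.sign a * Perm.sign p * Perm.sign b * Perm.sign x =
      Perm.sign p * (Perm.sign b * Perm.sign x * Perm.sign a) by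
        rw [mul_comm (Perm.sign b * Perm.sign x), ← mul_assoc, mul_comm (Perm.sign p)]
        simp only [mul_assoc]]
  · constructor
    · rintro ⟨_, ⟨q, hq, rfl⟩, h⟩
      refine ⟨q, hq, ?_⟩
      rw [mul_assoc, mul_assoc, mul_mem_cyclicPerms_comm] at h
      simpa only [mul_assoc] using h
    · rintro ⟨q, hq, h⟩
      refine ⟨_, ⟨q, hq, rfl⟩, ?_⟩
      rw [mul_assoc, mul_assoc, mul_mem_cyclicPerms_comm]
      simpa only [mul_assoc] using h

theorem eq_one_or_mem_cyclicPerms_three (g : Perm (Fin 3)) (h : Perm.sign g = 1) :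
    g = 1 ∨ g ∈ cyclicPerms 3 := by
  have key : ∀ g : Perm (Fin 3), Perm.sign g = 1 → g = 1 ∨
      ∀ x y, ∃ i : Fin 3, (g ^ (i : ℕ)) x = y := by
    decide +kernel
  refine (key g h).imp_right fun h => ?_
  rw [mem_cyclicPerms_iff]
  intro x y
  obtain ⟨i, hi⟩ := h x y
  exact ⟨(i : ℕ), by simpa using hi⟩

/-- For `n = 3`, a single element of the residue determines all elements of `P`. -/
theorem eq_inv_of_mem_residue {P : Set (Perm (Fin 3))} (hP : IsUniformSet P) {x : Perm (Fin 3)}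
    (hx : x ∈ residue P) {p : Perm (Fin 3)} (hp : p ∈ P) : p = x⁻¹ := by
  obtain ⟨h1, h2⟩ := (mem_residue_iff hP hp x).1 hx
  rw [mem_excludedSet_iff] at h2
  rcases eq_one_or_mem_cyclicPerms_three (p * x) (by rw [h1]; decide) with h | h
  · exact eq_inv_of_mul_eq_one_left h
  · exact absurd ⟨p, hp, h⟩ h2

theorem exists_two_perms_of_sign (hn : 3 ≤ n) (η : ℤˣ) :
    ∃ x y : Perm (Fin n), x ≠ y ∧ Perm.sign x = η ∧ Perm.sign y = η := by
  obtain ⟨m, rfl⟩ := Nat.exists_eq_add_of_le' hn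
  have h01 : (0 : Fin (m + 3)) ≠ 1 := by simp
  have h02 : (0 : Fin (m + 3)) ≠ 2 := fun h => by
    have := congrArg Fin.val h
    rw [Fin.val_two] at this
    exact absurd this (by simp)
  have h12 : (1 : Fin (m + 3)) ≠ 2 := fun h => by
    have := congrArg Fin.val h
    rw [Fin.val_two] at this
    exact absurd this (by simp)
  have hne : Equiv.swap (0 : Fin (m + 3)) 1 ≠ Equiv.swap 0 2 := by
    intro h
    have := congrArg (fun f => f 0) h
    simp only [Equiv.swap_apply_left] at this
    exact h12 this
  rcases Int.units_eq_one_or η with rfl | rfl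
  · refine ⟨Equiv.swap 0 1 * Equiv.swap 0 1, Equiv.swap 0 1 * Equiv.swap 0 2, ?_, ?_, ?_⟩
    · exact fun h => hne (mul_left_cancel h)
    · rw [Perm.sign_mul, Perm.sign_swap h01]
      decide
    · rw [Perm.sign_mul, Perm.sign_swap h01, Perm.sign_swap h02]
      decide
  · exact ⟨_, _, hne, Perm.sign_swap h01, Perm.sign_swap h02⟩

end Residue

namespace MultiDigraph

universe w₁ w₂ w₃ w₄ w₅ w₆ w₇ w₈ w₉

variable {V : Type w₁} {A : Type w₂} {S : Type w₃} {V' : Type w₄} {A' : Type w₅} {T : Type w₆}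
  {V'' : Type w₇} {A'' : Type w₈} {S'' : Type w₉}

namespace SlotModel

section Closing

variable {F : MultiDigraph V A} {ρ : Perm S} (M : SlotModel F ρ)
variable {n : ℕ} (ε : F.Entry ≃ Fin n) (δ : F.Exit ≃ Fin n)

theorem mem_routePerms_iff [Finite S] (p : Perm (Fin n)) :
    p ∈ F.routePerms ε δ ↔ ∃ z r, M.IsRoute z r ∧ p = ε.symm.trans (r.trans δ) := by
  constructor
  · rintro ⟨r, hr, rfl⟩
    obtain ⟨z, hz⟩ := (M.mem_openRoutes_iff r).1 hr
    exact ⟨z, r, hz, rfl⟩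
  · rintro ⟨z, r, hz, rfl⟩
    exact ⟨r, (M.mem_openRoutes_iff r).2 ⟨z, hz⟩, rfl⟩

/-- The identification of the exit vertices with the entry vertices that a permutation of the
labels describes. -/
abbrev _root_.MultiDigraph.labelClosing {F : MultiDigraph V A} {n : ℕ} (ε : F.Entry ≃ Fin n)
    (δ : F.Exit ≃ Fin n) (x : Perm (Fin n)) : F.Exit ≃ F.Entry := δ.trans (x.trans ε.symm)

variable {M ε δ}

/-- The cycles of a factor of the closed-up digraph are those of an open route followed by the closing. -/
theorem IsClosing.orbit_reduction_label {x : Perm (Fin n)} {c : Perm S}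
    (hc : M.IsClosing (labelClosing ε δ x) c) {z : CycleChoice ρ} {r : F.Entry ≃ F.Exit}
    (hr : M.IsRoute z r) :
    (c * turn ρ z).numOrbits = Perm.numOrbits (ε.symm.trans (r.trans δ) * x) ∧
      ((c * turn ρ z).IsSingleOrbit ↔ ε.symm.trans (r.trans δ) * x ∈ cyclicPerms n) := by
  have h₁ := hc.orbit_reduction hr
  have h₂ := Perm.orbit_reduction_conj (φ := (labelClosing ε δ x).trans r)
    (ψ := ε.symm.trans (r.trans δ) * x) δ fun d => by simp [labelClosing]
  rw [mem_cyclicPerms_iff]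
  exact ⟨h₁.1.trans h₂.1, h₁.2.trans h₂.2⟩

/-- The right parity of a closing is the one for which all factors have odd index. -/
theorem IsClosing.parity_iff_sign [Finite S] {x : Perm (Fin n)} {c : Perm S}
    (hc : M.IsClosing (labelClosing ε δ x) c) {p : Perm (Fin n)} (hp : p ∈ F.routePerms ε δ) :
    c.parity = -(-1) ^ Nat.card S ↔ Perm.sign (p * x) = -(-1) ^ n := by
  obtain ⟨z, r, hr, rfl⟩ := (M.mem_routePerms_iff ε δ p).1 hp
  have h := (hc.orbit_reduction_label hr).1
  rw [← parity_mul_turn M.rot_three c z, ← Perm.odd_numOrbits_iff, h, Perm.odd_numOrbits_iff,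
    Perm.parity_eq_sign, Nat.card_fin]

/-- All open routes have the same parity, for the parity of a closing does not depend on the
factor. -/
theorem isUniformSet_routePerms [Finite S] (M : SlotModel F ρ)
    (hne : (F.routePerms ε δ).Nonempty) : IsUniformSet (F.routePerms ε δ) := by
  obtain ⟨p, hp⟩ := hne
  obtain ⟨c, hc⟩ := M.exists_isClosing (labelClosing ε δ 1)
  refine isUniformSet_of_sign_eq hp fun q hq => ?_
  have h := (hc.parity_iff_sign hq).symm.trans (hc.parity_iff_sign hp)
  rw [mul_one, mul_one] at h
  have key : ∀ s t u : ℤˣ, (s = u ↔ t = u) → s = t := by decide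
  exact key _ _ _ h

/-- The excluded set describes the closings that have a Hamiltonian factor. -/
theorem IsClosing.mem_excludedSet_iff [Finite S] (hn : 0 < n) {x : Perm (Fin n)} {c : Perm S}
    (hc : M.IsClosing (labelClosing ε δ x) c) :
    x ∈ excludedSet (F.routePerms ε δ) ↔ ¬ NeverSingle ρ c := by
  rw [_root_.mem_excludedSet_iff, NeverSingle, not_forall]
  simp only [not_not]
  constructor
  · rintro ⟨p, hp, h⟩
    obtain ⟨z, r, hr, rfl⟩ := (M.mem_routePerms_iff ε δ p).1 hp
    exact ⟨z, (hc.orbit_reduction_label hr).2.2 h⟩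
  · rintro ⟨z, hz⟩
    obtain ⟨r, hr⟩ := (hc.isOpen hz (δ.symm ⟨0, hn⟩)).exists_isRoute
    exact ⟨_, (M.mem_routePerms_iff ε δ _).2 ⟨z, r, hr, rfl⟩, (hc.orbit_reduction_label hr).2.1 hz⟩

/-- The residue describes the closings of the right parity without Hamiltonian factors. -/
theorem IsClosing.mem_residue_iff [Finite S] (hn : 0 < n) (hne : (F.routePerms ε δ).Nonempty)
    {x : Perm (Fin n)} {c : Perm S} (hc : M.IsClosing (labelClosing ε δ x) c) :
    x ∈ residue (F.routePerms ε δ) ↔ c.parity = -(-1) ^ Nat.card S ∧ NeverSingle ρ c := by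
  obtain ⟨p, hp⟩ := hne
  rw [_root_.mem_residue_iff (M.isUniformSet_routePerms ⟨p, hp⟩) hp, hc.parity_iff_sign hp,
    hc.mem_excludedSet_iff hn, not_not]

theorem labelClosing_injective : Function.Injective (labelClosing ε δ) := by
  intro x y h
  ext1 i
  have := congrArg (fun f => ε (f (δ.symm i))) h
  simpa [labelClosing] using this

theorem parity_labelClosing (x y : Perm (Fin n)) :
    Perm.parity ((labelClosing ε δ y).trans (labelClosing ε δ x).symm) =
      Perm.sign x * Perm.sign y := by
  rw [← Perm.sign_inv x, ← Perm.sign_mul, ← Perm.parity_eq_sign]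
  exact Perm.parity_conj δ fun d => by simp [labelClosing]

variable (M ε δ)

/-- At most one closing of the right parity has no Hamiltonian factor. -/
def AtMostOneBad : Prop :=
  ∀ (b₁ b₂ : F.Exit ≃ F.Entry) (c₁ c₂ : Perm S), M.IsClosing b₁ c₁ → M.IsClosing b₂ c₂ →
    c₁.parity = -(-1) ^ Nat.card S → c₂.parity = -(-1) ^ Nat.card S →
    NeverSingle ρ c₁ → NeverSingle ρ c₂ → c₁ = c₂

variable {M}

/-- There are at least two closings of the right parity, hence one with a Hamiltonian factor. -/
theorem AtMostOneBad.routePerms_nonempty [Finite S] (h : M.AtMostOneBad) (hn : 3 ≤ n) :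
    (F.routePerms ε δ).Nonempty := by
  obtain ⟨c, hc⟩ := M.exists_isClosing (labelClosing ε δ 1)
  obtain ⟨x, y, hxy, hx, hy⟩ :=
    exists_two_perms_of_sign hn (c.parity * -(-1) ^ Nat.card S)
  obtain ⟨cx, hcx⟩ := M.exists_isClosing (labelClosing ε δ x)
  obtain ⟨cy, hcy⟩ := M.exists_isClosing (labelClosing ε δ y)
  have hpx := hc.parity_eq hcx
  have hpy := hc.parity_eq hcy
  have key : ∀ s t : ℤˣ, 1 * (s * t) * s = t := by decide
  rw [parity_labelClosing, hx, Perm.sign_one, key] at hpx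
  rw [parity_labelClosing, hy, Perm.sign_one, key] at hpy
  have hxy' : ¬ (NeverSingle ρ cx ∧ NeverSingle ρ cy) := by
    rintro ⟨h1, h2⟩
    have := h _ _ _ _ hcx hcy hpx hpy h1 h2
    subst this
    exact hxy (labelClosing_injective (hcx.eq_of_apply_eq hcy))
  have hn' : 0 < n := by omega
  rw [not_and_or, ← hcx.mem_excludedSet_iff hn', ← hcy.mem_excludedSet_iff hn'] at hxy'
  rcases hxy' with h | h <;> obtain ⟨p, hp, -⟩ := (mem_excludedSet_iff _ _).1 h <;> exact ⟨p, hp⟩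

theorem AtMostOneBad.subsingleton_residue [Finite S] (h : M.AtMostOneBad) (hn : 3 ≤ n) :
    (residue (F.routePerms ε δ)).Subsingleton := by
  have hne := h.routePerms_nonempty ε δ hn
  intro x hx y hy
  obtain ⟨cx, hcx⟩ := M.exists_isClosing (labelClosing ε δ x)
  obtain ⟨cy, hcy⟩ := M.exists_isClosing (labelClosing ε δ y)
  rw [hcx.mem_residue_iff (by omega) hne] at hx
  rw [hcy.mem_residue_iff (by omega) hne] at hy
  have := h _ _ _ _ hcx hcy hx.1 hy.1 hx.2 hy.2
  subst this
  exact labelClosing_injective (hcx.eq_of_apply_eq hcy)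

end Closing

/-! ### Hamiltonicity and parity of a glued digraph -/

section Glue

variable {F : MultiDigraph V A} {ρ : Perm S} {M : SlotModel F ρ}
variable {H : MultiDigraph V' A'} {σ : Perm T} {N : SlotModel H σ}
variable {ι : F.Entry ≃ H.Exit} {κ : F.Exit ≃ H.Entry} {c : Perm (T ⊕ S)}
variable {n : ℕ} {ε : F.Entry ≃ Fin n} {δ : F.Exit ≃ Fin n}

theorem IsGlue.orbit_reduction_routes [Finite S] [Finite T] (hc : IsGlue M N ι κ c)
    {z : CycleChoice ρ} {w : CycleChoice σ} {r : F.Entry ≃ F.Exit} (hr : M.IsRoute z r)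
    {q : H.Entry ≃ H.Exit} (hq : N.IsRoute w q) :
    (c * turn (Equiv.sumCongr σ ρ) (sumChoice w z)).numOrbits =
        Perm.numOrbits (ε.symm.trans (r.trans δ) *
          (κ.symm.trans δ).symm.trans (q.trans (ι.symm.trans ε))) ∧
      ((c * turn (Equiv.sumCongr σ ρ) (sumChoice w z)).IsSingleOrbit ↔
        ε.symm.trans (r.trans δ) *
          (κ.symm.trans δ).symm.trans (q.trans (ι.symm.trans ε)) ∈ cyclicPerms n) := by
  obtain ⟨d, hd⟩ := N.exists_isClosing (ι.symm.trans (r.trans κ))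
  have h₁ := hc.orbit_reduction w hr hd
  have h₂ := hd.orbit_reduction hq
  have h₃ := Perm.orbit_reduction_conj (φ := (ι.symm.trans (r.trans κ)).trans q)
    (ψ := ε.symm.trans (r.trans δ) * (κ.symm.trans δ).symm.trans (q.trans (ι.symm.trans ε)))
    (ι.symm.trans (r.trans δ)) fun d => by simp
  rw [mem_cyclicPerms_iff]
  exact ⟨h₁.1.trans (h₂.1.trans h₃.1), h₁.2.trans (h₂.2.trans h₃.2)⟩

/-- A Hamiltonian circuit of the glued digraph consists of open routes of the two parts. -/
theorem IsGlue.exists_isSingleOrbit_iff [Finite S] [Finite T] (hc : IsGlue M N ι κ c)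
    (ε : F.Entry ≃ Fin n) (δ : F.Exit ≃ Fin n) (hn : 0 < n) :
    (∃ z, (c * turn (Equiv.sumCongr σ ρ) z).IsSingleOrbit) ↔
      ∃ p ∈ F.routePerms ε δ, ∃ x ∈ H.routePerms (κ.symm.trans δ) (ι.symm.trans ε),
        p * x ∈ cyclicPerms n := by
  constructor
  · rintro ⟨z, hz⟩
    obtain ⟨w, z, rfl⟩ := exists_eq_sumChoice z
    let e := δ.symm ⟨0, hn⟩
    obtain ⟨r, hr⟩ := (hc.isOpen_right hz e).exists_isRoute
    obtain ⟨d, hd⟩ := N.exists_isClosing (ι.symm.trans (r.trans κ))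
    obtain ⟨q, hq⟩ := (hd.isOpen ((hc.orbit_reduction w hr hd).2.1 hz)
      (ι (r.symm e))).exists_isRoute
    exact ⟨_, (M.mem_routePerms_iff _ _ _).2 ⟨z, r, hr, rfl⟩, _,
      (N.mem_routePerms_iff _ _ _).2 ⟨w, q, hq, rfl⟩, (hc.orbit_reduction_routes hr hq).2.1 hz⟩
  · rintro ⟨p, hp, x, hx, h⟩
    obtain ⟨z, r, hr, rfl⟩ := (M.mem_routePerms_iff _ _ _).1 hp
    obtain ⟨w, q, hq, rfl⟩ := (N.mem_routePerms_iff _ _ _).1 hx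
    exact ⟨_, (hc.orbit_reduction_routes hr hq).2.2 h⟩

/-- In an odd digraph, two open routes of the parts compose to a permutation that has the parity of an
`n`-cycle. -/
theorem IsGlue.sign_mul [Finite S] [Finite T] (hc : IsGlue M N ι κ c)
    (hodd : ∀ z, Odd (c * turn (Equiv.sumCongr σ ρ) z).numOrbits) {p : Perm (Fin n)}
    (hp : p ∈ F.routePerms ε δ) {x : Perm (Fin n)}
    (hx : x ∈ H.routePerms (κ.symm.trans δ) (ι.symm.trans ε)) :
    Perm.sign (p * x) = -(-1) ^ n := by
  obtain ⟨z, r, hr, rfl⟩ := (M.mem_routePerms_iff _ _ _).1 hp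
  obtain ⟨w, q, hq, rfl⟩ := (N.mem_routePerms_iff _ _ _).1 hx
  have h := hodd (sumChoice w z)
  rw [(hc.orbit_reduction_routes (ε := ε) (δ := δ) hr hq).1, Perm.odd_numOrbits_iff,
    Perm.parity_eq_sign, Nat.card_fin] at h
  exact h

/-- In an odd 2-diregular digraph, Hamiltonicity only depends on the residue of the subgraph. -/
theorem IsGlue.exists_isSingleOrbit_iff_residue [Finite S] [Finite T] (hc : IsGlue M N ι κ c)
    (hodd : ∀ z, Odd (c * turn (Equiv.sumCongr σ ρ) z).numOrbits)
    (ε : F.Entry ≃ Fin n) (δ : F.Exit ≃ Fin n) (hn : 0 < n)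
    (hne : (F.routePerms ε δ).Nonempty) :
    (∃ z, (c * turn (Equiv.sumCongr σ ρ) z).IsSingleOrbit) ↔
      ∃ x ∈ H.routePerms (κ.symm.trans δ) (ι.symm.trans ε), x ∉ residue (F.routePerms ε δ) := by
  obtain ⟨p₀, hp₀⟩ := hne
  have key : ∀ x ∈ H.routePerms (κ.symm.trans δ) (ι.symm.trans ε),
      (x ∉ residue (F.routePerms ε δ) ↔ ∃ p ∈ F.routePerms ε δ, p * x ∈ cyclicPerms n) := by
    intro x hx
    rw [mem_residue_iff (M.isUniformSet_routePerms ⟨p₀, hp₀⟩) hp₀, mem_excludedSet_iff,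
      not_and, not_not]
    exact ⟨fun h => h (hc.sign_mul hodd hp₀ hx), fun h _ => h⟩
  rw [hc.exists_isSingleOrbit_iff ε δ hn]
  constructor
  · rintro ⟨p, hp, x, hx, h⟩
    exact ⟨x, hx, (key x hx).2 ⟨p, hp, h⟩⟩
  · rintro ⟨x, hx, h⟩
    obtain ⟨p, hp, h'⟩ := (key x hx).1 h
    exact ⟨p, hp, x, hx, h'⟩

/-- Contracting a subgraph along its only open route. -/
theorem IsGlue.collapse_spec [Finite S] [Finite T] (hc : IsGlue M N ι κ c)
    (hodd : ∀ z, Odd (c * turn (Equiv.sumCongr σ ρ) z).numOrbits) (d₀ : F.Exit)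
    {r : F.Entry ≃ F.Exit} (hr : F.openRoutes = {r}) {d : Perm T}
    (hd : N.IsClosing (ι.symm.trans (r.trans κ)) d) :
    (∀ w, Odd (d * turn σ w).numOrbits) ∧
      ((∃ z, (c * turn (Equiv.sumCongr σ ρ) z).IsSingleOrbit) ↔
        ∃ w, (d * turn σ w).IsSingleOrbit) := by
  obtain ⟨z₀, hz₀⟩ := (M.mem_openRoutes_iff r).1 (hr ▸ rfl)
  refine ⟨fun w => ?_, ?_, ?_⟩
  · rw [← (hc.orbit_reduction w hz₀ hd).1]
    exact hodd _
  · rintro ⟨z, hz⟩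
    obtain ⟨w, z, rfl⟩ := exists_eq_sumChoice z
    obtain ⟨r', hr'⟩ := (hc.isOpen_right hz d₀).exists_isRoute
    have : r' ∈ F.openRoutes := (M.mem_openRoutes_iff r').2 ⟨z, hr'⟩
    rw [hr] at this
    obtain rfl : r' = r := this
    exact ⟨w, (hc.orbit_reduction w hr' hd).2.1 hz⟩
  · rintro ⟨w, hw⟩
    exact ⟨_, (hc.orbit_reduction w hz₀ hd).2.2 hw⟩

variable {F' : MultiDigraph V'' A''} {ρ' : Perm S''} {M' : SlotModel F' ρ'}

/-- Replacing a subgraph by one with the same residue and the same parity of open routes. -/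
theorem IsGlue.replace_spec [Finite S] [Finite T] [Finite S''] (hc : IsGlue M N ι κ c)
    (hodd : ∀ z, Odd (c * turn (Equiv.sumCongr σ ρ) z).numOrbits)
    (ε : F.Entry ≃ Fin n) (δ : F.Exit ≃ Fin n) (hn : 0 < n)
    {α : F'.Entry ≃ F.Entry} {β : F'.Exit ≃ F.Exit} {c' : Perm (T ⊕ S'')}
    (hc' : IsGlue M' N (α.trans ι) (β.trans κ) c') {p p' : Perm (Fin n)}
    (hp : p ∈ F.routePerms ε δ) (hp' : p' ∈ F'.routePerms (α.trans ε) (β.trans δ))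
    (hpp : Perm.sign p = Perm.sign p')
    (hres : residue (F.routePerms ε δ) = residue (F'.routePerms (α.trans ε) (β.trans δ))) :
    (∀ z, Odd (c' * turn (Equiv.sumCongr σ ρ') z).numOrbits) ∧
      ((∃ z, (c * turn (Equiv.sumCongr σ ρ) z).IsSingleOrbit) ↔
        ∃ z, (c' * turn (Equiv.sumCongr σ ρ') z).IsSingleOrbit) := by
  have hodd' : ∀ z, Odd (c' * turn (Equiv.sumCongr σ ρ') z).numOrbits := by
    obtain ⟨z, r, hr, rfl⟩ := (M.mem_routePerms_iff _ _ _).1 hp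
    obtain ⟨z', r', hr', rfl⟩ := (M'.mem_routePerms_iff _ _ _).1 hp'
    let w : CycleChoice σ := ⟨fun _ => false, fun _ => rfl⟩
    obtain ⟨d, hd⟩ := N.exists_isClosing (ι.symm.trans (r.trans κ))
    obtain ⟨d', hd'⟩ := N.exists_isClosing ((α.trans ι).symm.trans (r'.trans (β.trans κ)))
    have h := hodd (sumChoice w z)
    rw [(hc.orbit_reduction w hr hd).1, Perm.odd_numOrbits_iff, parity_mul_turn N.rot_three] at h
    have h1 := hd.parity_eq hd'
    have h2 : Perm.parity (((α.trans ι).symm.trans (r'.trans (β.trans κ))).trans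
        (ι.symm.trans (r.trans κ)).symm) = 1 := by
      have : Perm.sign ((ε.symm.trans (r.trans δ) : Perm (Fin n))⁻¹ *
          (α.trans ε).symm.trans (r'.trans (β.trans δ))) = 1 := by
        rw [Perm.sign_mul, Perm.sign_inv, hpp]
        exact Int.units_mul_self _
      rw [← this, ← Perm.parity_eq_sign]
      refine Perm.parity_conj (ι.symm.trans ε) fun e => ?_
      apply (ε.symm.trans (r.trans δ)).injective
      rw [← Perm.mul_apply, mul_inv_cancel_left]
      simp
    rw [h2, one_mul, h] at h1
    have h3 : Odd (c' * turn (Equiv.sumCongr σ ρ') (sumChoice w z')).numOrbits := by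
      rw [(hc'.orbit_reduction w hr' hd').1, Perm.odd_numOrbits_iff,
        parity_mul_turn N.rot_three, h1]
    have hthree : ∀ x, (Equiv.sumCongr σ ρ') ((Equiv.sumCongr σ ρ')
        ((Equiv.sumCongr σ ρ') x)) = x := by
      rintro (x | x) <;> simp [M'.rot_three, N.rot_three]
    intro z
    rw [Perm.odd_numOrbits_iff, parity_mul_turn hthree] at h3 ⊢
    exact h3
  refine ⟨hodd', ?_⟩
  rw [hc.exists_isSingleOrbit_iff_residue hodd ε δ hn ⟨p, hp⟩,
    hc'.exists_isSingleOrbit_iff_residue hodd' (α.trans ε) (β.trans δ) hn ⟨p', hp'⟩, hres]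
  have e1 : (β.trans κ).symm.trans (β.trans δ) = κ.symm.trans δ := by
    ext1 x
    simp
  have e2 : (α.trans ι).symm.trans (α.trans ε) = ι.symm.trans ε := by
    ext1 x
    simp
  rw [e1, e2]

end Glue

end SlotModel
end MultiDigraph

namespace MultiDigraph

universe w₁ w₂

variable {V : Type w₁} {A : Type w₂}

/-! ### Alternating cycles of a 2-diregular digraph -/

section Involution

/-- A fibre with exactly two elements has no third one. -/
theorem eq_or_eq_of_ncard_fiber_eq_two {f : A → V} (h2 : ∀ v, {a | f a = v}.ncard = 2)
    {a b c : A} (hab : a ≠ b) (hb : f b = f a) (hc : f c = f a) : c = a ∨ c = b := by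
  have hfin : {x | f x = f a}.Finite := Set.finite_of_ncard_pos (by rw [h2]; exact two_pos)
  have h : ({a, b} : Set A) = {x | f x = f a} := by
    refine Set.eq_of_subset_of_ncard_le ?_ ?_ hfin
    · rintro x (rfl | rfl)
      · rfl
      · exact hb
    · rw [h2, Set.ncard_pair hab]
  have hc : c ∈ {x | f x = f a} := hc
  rw [← h] at hc
  exact hc

/-- If all fibres have two elements, exchanging the two is an involution without fixed points. -/
theorem exists_partner {f : A → V} (h2 : ∀ v, {a | f a = v}.ncard = 2) :
    ∃ σ : Perm A, (∀ a, σ (σ a) = a) ∧ (∀ a, σ a ≠ a) ∧ ∀ a, f (σ a) = f a := by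
  have hex : ∀ a, ∃ b, b ≠ a ∧ f b = f a := by
    intro a
    obtain ⟨b, hb, hba⟩ := Set.exists_ne_of_one_lt_ncard (by rw [h2 (f a)]; exact one_lt_two) a
    exact ⟨b, hba, hb⟩
  choose σ hne hf using hex
  have hσ : ∀ a, σ (σ a) = a := by
    intro a
    have := eq_or_eq_of_ncard_fiber_eq_two h2 (hne a).symm (hf a) ((hf (σ a)).trans (hf a))
    exact this.resolve_right (hne _)
  exact ⟨⟨σ, σ, hσ, hσ⟩, hσ, hne, hf⟩

/-- In the infinite dihedral group generated by two involutions without fixed points, no rotation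
agrees with a reflection at any point. -/
theorem zpow_ne_reflection {σ τ : Perm A} (hσ : ∀ a, σ (σ a) = a) (hσ' : ∀ a, σ a ≠ a)
    (hτ : ∀ a, τ (τ a) = a) (hτ' : ∀ a, τ a ≠ a) (i j : ℤ) (a : A) :
    ((τ * σ) ^ i) a ≠ σ (((τ * σ) ^ j) a) := by
  have hpow : ∀ (k : ℤ) b, ((τ * σ) ^ (k + 1)) b = τ (σ (((τ * σ) ^ k) b)) := by
    intro k b
    rw [add_comm, zpow_add, zpow_one]
    rfl
  have step : ∀ i j : ℤ, ((τ * σ) ^ i) a = σ (((τ * σ) ^ j) a) ↔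
      ((τ * σ) ^ (i + 1)) a = σ (((τ * σ) ^ (j - 1)) a) := by
    intro i j
    have := hpow (j - 1) a
    rw [sub_add_cancel] at this
    rw [hpow, this]
    constructor
    · intro h
      rw [h, hσ, hτ]
    · intro h
      have := congrArg τ h
      rw [hτ] at this
      rw [← this, hσ]
  have shift : ∀ (k : ℕ) (i j : ℤ), ((τ * σ) ^ i) a = σ (((τ * σ) ^ j) a) ↔
      ((τ * σ) ^ (i + k)) a = σ (((τ * σ) ^ (j - k)) a) := by
    intro k
    induction k with
    | zero => simp
    | succ k ih =>
      intro i j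
      rw [ih, step]
      push_cast
      rw [add_assoc, sub_sub]
  have hdiag : ∀ i j : ℤ, i ≤ j → ((τ * σ) ^ i) a ≠ σ (((τ * σ) ^ j) a) := by
    intro i j hij h
    obtain ⟨m, hm⟩ := Int.eq_ofNat_of_zero_le (sub_nonneg.2 hij)
    rcases Nat.even_or_odd' m with ⟨k, rfl | rfl⟩
    · rw [shift k, show j - k = i + k by push_cast at hm; omega] at h
      exact hσ' _ h.symm
    · rw [shift (k + 1), show i + ((k + 1 : ℕ) : ℤ) = (j - ((k + 1 : ℕ) : ℤ)) + 1 by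
        push_cast at hm ⊢; omega, hpow] at h
      exact hτ' _ h
  intro h
  rcases le_total i j with hij | hij
  · exact hdiag i j hij h
  · refine hdiag j i hij ?_
    rw [h, hσ]

end Involution

/-- A closed alternating walk with six arcs, extended periodically. -/
structure IsHexagon (G : MultiDigraph V A) (e : ℕ → A) : Prop where
  periodic : ∀ i, e (i + 6) = e i
  modEq : ∀ i j, e i = e j → i ≡ j [MOD 6]
  tgt_eq : ∀ i, Even i → G.tgt (e i) = G.tgt (e (i + 1))
  src_eq : ∀ i, Odd i → G.src (e i) = G.src (e (i + 1))

variable {G : MultiDigraph V A}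

theorem ncard_range_of_periodic {r : ℕ} {e : ℕ → A} (hr : 0 < r) (hper : ∀ i, e (i + r) = e i)
    (hinj : Set.InjOn e (Set.Iio r)) : (Set.range e).ncard = r := by
  have : Set.range e = e '' Set.Iio r := by
    refine Set.Subset.antisymm ?_ (Set.image_subset_range _ _)
    rintro _ ⟨i, rfl⟩
    exact ⟨i % r, Nat.mod_lt _ hr, Function.Periodic.map_mod_nat hper i⟩
  rw [this, hinj.ncard_image, ← Finset.coe_Iio, Set.ncard_coe_finset,
    Nat.card_Iio]

/-- An alternating cycle with six arcs, in the form used here. -/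
theorem exists_isHexagon (hG : G.AllACsHaveSize 6) {X : Set A} (hX : G.IsAC X) :
    ∃ e, G.IsHexagon e ∧ Set.range e = X := by
  have h6 := hG X hX
  obtain ⟨r, e, hr, hper, hinj, rfl, halt⟩ := hX
  rw [ncard_range_of_periodic (by omega) hper hinj] at h6
  rw [h6] at hper hinj
  refine ⟨e, ⟨hper, fun i j h => ?_, fun i => (halt i).1, fun i => (halt i).2⟩, rfl⟩
  have hper' : Function.Periodic e 6 := hper
  rw [← hper'.map_mod_nat i, ← hper'.map_mod_nat j] at h
  exact hinj (Nat.mod_lt i (by decide)) (Nat.mod_lt j (by decide)) h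

/-- Every arc lies on an alternating cycle: alternately pass to the other arc with the same end-vertex
and to the other arc with the same start-vertex. The arcs met before the first return are distinct
by `zpow_ne_reflection`. -/
theorem exists_mem_acs [Finite A] (hG : G.IsKDiregular 2) (a : A) : ∃ X ∈ G.acs, a ∈ X := by
  obtain ⟨σ, hσ, hσ', hσt⟩ := exists_partner (f := G.tgt) fun v => (hG v).1
  obtain ⟨τ, hτ, hτ', hτs⟩ := exists_partner (f := G.src) fun v => (hG v).2
  let p := τ * σ
  have hr : 0 < Function.minimalPeriod p a := Function.minimalPeriod_pos_of_mem_periodicPts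
    (Function.Injective.mem_periodicPts p.injective a)
  have hpow : ∀ i : ℕ, (p ^ i) a = p^[i] a := fun i => by rw [Perm.iterate_eq_pow]
  let e : ℕ → A := fun i => if Even i then (p ^ (i / 2)) a else σ ((p ^ (i / 2)) a)
  have h0 : ∀ k, e (2 * k) = (p ^ k) a := by
    intro k
    simp only [e, even_two_mul, if_true]
    rw [Nat.mul_div_cancel_left _ two_pos]
  have h1 : ∀ k, e (2 * k + 1) = σ ((p ^ k) a) := by
    intro k
    have : ¬ Even (2 * k + 1) := by simp
    simp only [e, this, if_false]
    rw [show (2 * k + 1) / 2 = k by omega]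
  have hne : ∀ i j : ℕ, (p ^ i) a ≠ σ ((p ^ j) a) := fun i j => by
    have := zpow_ne_reflection hσ hσ' hτ hτ' i j a
    rwa [zpow_natCast, zpow_natCast] at this
  have hpinj : ∀ i j, i < Function.minimalPeriod p a → j < Function.minimalPeriod p a →
      (p ^ i) a = (p ^ j) a → i = j := by
    intro i j hi hj h
    rw [hpow, hpow] at h
    exact (Function.iterate_eq_iterate_iff_of_lt_minimalPeriod hi hj).1 h
  have hper : ∀ i, (p ^ (i + Function.minimalPeriod p a)) a = (p ^ i) a := by
    intro i
    rw [hpow, hpow, Function.iterate_add_minimalPeriod_eq]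
  refine ⟨Set.range e, ⟨Function.minimalPeriod p a, e, hr, ?_, ?_, rfl, ?_⟩, ⟨0, by simp [e]⟩⟩
  · intro i
    rcases Nat.even_or_odd' i with ⟨k, rfl | rfl⟩
    · rw [← mul_add, h0, h0, hper]
    · rw [show 2 * k + 1 + 2 * Function.minimalPeriod p a =
        2 * (k + Function.minimalPeriod p a) + 1 by ring, h1, h1, hper]
  · intro i hi j hj hij
    simp only [Set.mem_Iio] at hi hj
    rcases Nat.even_or_odd' i with ⟨k, rfl | rfl⟩ <;>
      rcases Nat.even_or_odd' j with ⟨l, rfl | rfl⟩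
    · rw [h0, h0] at hij
      rw [hpinj k l (by omega) (by omega) hij]
    · rw [h0, h1] at hij
      exact absurd hij (hne _ _)
    · rw [h0, h1] at hij
      exact absurd hij.symm (hne _ _)
    · rw [h1, h1] at hij
      rw [hpinj k l (by omega) (by omega) (σ.injective hij)]
  · intro i
    rcases Nat.even_or_odd' i with ⟨k, rfl | rfl⟩
    · refine ⟨fun _ => ?_, fun h => absurd h (by simp)⟩
      rw [h0, h1, hσt]
    · refine ⟨fun h => absurd h (by simp), fun _ => ?_⟩
      have : e (2 * k + 1 + 1) = τ (σ ((p ^ k) a)) := by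
        rw [show 2 * k + 1 + 1 = 2 * (k + 1) by ring, h0, pow_succ']
        rfl
      rw [this, h1, hτs]

namespace IsHexagon

variable {e e' : ℕ → A}

theorem ne_succ (he : G.IsHexagon e) (i : ℕ) : e i ≠ e (i + 1) := fun h => by
  have := he.modEq _ _ h
  unfold Nat.ModEq at this
  omega

theorem eq_or_eq_of_tgt (hG : G.IsKDiregular 2) (he : G.IsHexagon e) {i : ℕ} (hi : Even i) {c : A}
    (hc : G.tgt c = G.tgt (e i)) : c = e i ∨ c = e (i + 1) :=
  eq_or_eq_of_ncard_fiber_eq_two (fun v => (hG v).1) (he.ne_succ i) (he.tgt_eq i hi).symm hc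

theorem eq_or_eq_of_src (hG : G.IsKDiregular 2) (he : G.IsHexagon e) {i : ℕ} (hi : Odd i) {c : A}
    (hc : G.src c = G.src (e i)) : c = e i ∨ c = e (i + 1) :=
  eq_or_eq_of_ncard_fiber_eq_two (fun v => (hG v).2) (he.ne_succ i) (he.src_eq i hi).symm hc

theorem mem_range_of_tgt (hG : G.IsKDiregular 2) (he : G.IsHexagon e) {i : ℕ} {c : A}
    (hc : G.tgt c = G.tgt (e i)) : c ∈ Set.range e := by
  rcases Nat.even_or_odd i with hi | hi
  · rcases he.eq_or_eq_of_tgt hG hi hc with h | h <;> exact ⟨_, h.symm⟩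
  · have h5 : Even (i + 5) := hi.add_odd (by decide)
    have := he.tgt_eq _ h5
    rw [show i + 5 + 1 = i + 6 from rfl, he.periodic] at this
    rcases he.eq_or_eq_of_tgt hG h5 (hc.trans this.symm) with h | h <;> exact ⟨_, h.symm⟩

theorem mem_range_of_src (hG : G.IsKDiregular 2) (he : G.IsHexagon e) {i : ℕ} {c : A}
    (hc : G.src c = G.src (e i)) : c ∈ Set.range e := by
  rcases Nat.even_or_odd i with hi | hi
  · have h5 : Odd (i + 5) := hi.add_odd (by decide)
    have := he.src_eq _ h5
    rw [show i + 5 + 1 = i + 6 from rfl, he.periodic] at this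
    rcases he.eq_or_eq_of_src hG h5 (hc.trans this.symm) with h | h <;> exact ⟨_, h.symm⟩
  · rcases he.eq_or_eq_of_src hG hi hc with h | h <;> exact ⟨_, h.symm⟩

/-- Two alternating cycles with a common arc coincide, as the next arc of an alternating cycle is
determined by the degrees. -/
theorem range_subset (hG : G.IsKDiregular 2) (he : G.IsHexagon e) (he' : G.IsHexagon e') {i : ℕ}
    (hi : e i ∈ Set.range e') : Set.range e ⊆ Set.range e' := by
  have step : ∀ m, e (i + m) ∈ Set.range e' := by
    intro m
    induction m with
    | zero => exact hi
    | succ m ih =>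
      obtain ⟨j, hj⟩ := ih
      rcases Nat.even_or_odd (i + m) with h | h
      · exact he'.mem_range_of_tgt hG (i := j) (by rw [hj]; exact (he.tgt_eq _ h).symm)
      · exact he'.mem_range_of_src hG (i := j) (by rw [hj]; exact (he.src_eq _ h).symm)
  have hper : Function.Periodic e 6 := he.periodic
  rintro _ ⟨j, rfl⟩
  have := step (5 * i + j)
  rwa [show i + (5 * i + j) = j + i * 6 by ring, show e (j + i * 6) = e j from hper.nat_mul i j]
    at this

theorem range_eq (hG : G.IsKDiregular 2) (he : G.IsHexagon e) (he' : G.IsHexagon e') {i j : ℕ}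
    (h : e i = e' j) : Set.range e = Set.range e' :=
  Set.Subset.antisymm (range_subset hG he he' ⟨j, h.symm⟩) (range_subset hG he' he ⟨i, h⟩)

theorem eq_mod (he : G.IsHexagon e) {i j : ℕ} (h : i % 6 = j % 6) : e i = e j := by
  have hper : Function.Periodic e 6 := he.periodic
  rw [← hper.map_mod_nat i, ← hper.map_mod_nat j, h]

end IsHexagon

/-- Every 2-diregular digraph whose alternating cycles have six arcs has a slot model, with one
row of three slots for every alternating cycle. -/
theorem exists_slotModel [Finite A] (hG : G.InFull6) :
    ∃ M : SlotModel G (rotRow G.acs), ∀ (X Y : G.acs) k b, M.arc ((X, k), b) ∈ Y.1 ↔ X = Y := by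
  obtain ⟨hreg, h6⟩ := hG
  have hex : ∀ X : G.acs, ∃ e, G.IsHexagon e ∧ Set.range e = X.1 := fun X => exists_isHexagon h6 X.2
  choose e he heX using hex
  have hX : ∀ {X Y i j}, e X i = e Y j → X = Y := by
    intro X Y i j h
    apply Subtype.ext
    rw [← heX X, ← heX Y]
    exact (he X).range_eq hreg (he Y) h
  let f : (G.acs × Fin 3) × Bool → A := fun x => e x.1.1 (2 * x.1.2 + 1 + x.2.toNat)
  have hf : Function.Bijective f := by
    constructor
    · rintro ⟨⟨X, k⟩, b⟩ ⟨⟨Y, l⟩, b'⟩ h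
      obtain rfl := hX h
      have h := (he X).modEq _ _ h
      unfold Nat.ModEq at h
      have := k.2
      have := l.2
      obtain rfl : k = l := by cases b <;> cases b' <;> simp at h <;> omega
      obtain rfl : b = b' := by cases b <;> cases b' <;> simp at h ⊢ <;> omega
      rfl
    · intro a
      obtain ⟨X, hXG, ha⟩ := exists_mem_acs hreg a
      have ha : a ∈ Set.range (e ⟨X, hXG⟩) := by rwa [heX]
      obtain ⟨i, rfl⟩ := ha
      refine ⟨((⟨X, hXG⟩, ⟨(i + 5) % 6 / 2, by omega⟩), decide ((i + 5) % 2 = 1)), ?_⟩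
      apply (he _).eq_mod
      rcases Nat.mod_two_eq_zero_or_one (i + 5) with h | h <;> simp [h] <;> omega
  have hsrc : ∀ x b, G.src (f (x, b)) = G.src (e x.1 (2 * x.2 + 1)) := by
    rintro ⟨X, k⟩ b
    cases b
    · rfl
    · exact ((he X).src_eq (2 * k + 1) (by simp)).symm
  have htgt : ∀ x b, G.tgt (f (x, b)) =
      G.tgt (e (bif b then rotRow G.acs x else x).1 (2 * (bif b then rotRow G.acs x else x).2)) := by
    rintro ⟨X, k⟩ b
    cases b
    · exact ((he X).tgt_eq (2 * k) (by simp)).symm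
    · refine congrArg G.tgt ((he X).eq_mod ?_)
      revert k
      exact (by decide : ∀ k : Fin 3, (2 * (k : ℕ) + 1 + 1) % 6 = 2 * ((k + 1 : Fin 3) : ℕ) % 6)
  refine ⟨⟨fun x => G.src (e x.1 (2 * x.2 + 1)), fun x => G.tgt (e x.1 (2 * x.2)),
    Equiv.ofBijective f hf, rotRow_three, ?_, ?_, ?_, hsrc, htgt, ?_⟩, ?_⟩
  · rintro ⟨X, k⟩ h
    exact (by decide : ∀ k : Fin 3, k + 1 ≠ k) k (congrArg Prod.snd h)
  · rintro ⟨X, k⟩ ⟨Y, l⟩ h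
    rcases (he X).eq_or_eq_of_src hreg (by simp) h.symm with h | h
    all_goals
      obtain rfl := hX h
      have h := (he _).modEq _ _ h
      simp only [Nat.ModEq] at h
      have := k.2
      have := l.2
    · rw [show k = l from Fin.ext (by omega)]
    · omega
  · rintro ⟨X, k⟩ ⟨Y, l⟩ h
    rcases (he X).eq_or_eq_of_tgt hreg (by simp) h.symm with h | h
    all_goals
      obtain rfl := hX h
      have h := (he _).modEq _ _ h
      simp only [Nat.ModEq] at h
      have := k.2
      have := l.2
    · rw [show k = l from Fin.ext (by omega)]
    · omega
  · intro v
    obtain ⟨a, ha⟩ := Set.nonempty_of_ncard_ne_zero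
      (show {a | G.src a = v}.ncard ≠ 0 by rw [show {a | G.src a = v}.ncard = 2 from (hreg v).2]; decide)
    obtain ⟨⟨x, b⟩, rfl⟩ := hf.2 a
    exact Or.inl ⟨x, by rw [← ha, hsrc]⟩
  · intro X Y k b
    rw [← heX Y]
    constructor
    · rintro ⟨i, hi⟩
      exact (hX hi).symm
    · rintro rfl
      exact ⟨_, rfl⟩

end MultiDigraph

namespace MultiDigraph

universe w₁ w₂ w₃ w₄

variable {V : Type w₁} {A : Type w₂} {S : Type w₃} {T : Type w₄}

namespace SlotModel

/-! ### Subgraphs -/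

section Restrict

variable {S₀ : Type*} {G : MultiDigraph V A} {ρ₀ : Perm S₀} (M : SlotModel G ρ₀)

/-- Renumbering the slots. -/
def reindex {ρ : Perm S} (e : S ≃ S₀) (he : ∀ x, e (ρ x) = ρ₀ (e x)) : SlotModel G ρ where
  out x := M.out (e x)
  inn x := M.inn (e x)
  arc := (Equiv.prodCongr e (Equiv.refl Bool)).trans M.arc
  rot_three x := e.injective (by rw [he, he, he, M.rot_three])
  rot_ne x h := M.rot_ne (e x) (by rw [← he, h])
  out_injective := M.out_injective.comp e.injective
  inn_injective := M.inn_injective.comp e.injective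
  src_arc x b := M.src_arc (e x) b
  tgt_arc x b := by
    refine (M.tgt_arc (e x) b).trans ?_
    cases b
    · rfl
    · exact congrArg M.inn (he x).symm
  cover v := by
    rcases M.cover v with ⟨x, rfl⟩ | ⟨x, rfl⟩
    · exact Or.inl ⟨e.symm x, congrArg M.out (e.apply_symm_apply x)⟩
    · exact Or.inr ⟨e.symm x, congrArg M.inn (e.apply_symm_apply x)⟩

/-- The slot model of the subgraph induced by the arcs of some of the alternating cycles, whose
slots are numbered through `i`. -/
noncomputable def restrict {ρ : Perm S} (i : S → S₀) (hi : Function.Injective i)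
    (hρ : ∀ x, i (ρ x) = ρ₀ (i x)) {B : Set A} (hB : ∀ x b, M.arc (x, b) ∈ B ↔ x ∈ Set.range i) :
    SlotModel (G.induced B) ρ where
  out x := ⟨M.out (i x), M.arc (i x, false), (hB _ _).2 ⟨x, rfl⟩, Or.inl (M.src_arc _ _)⟩
  inn x := ⟨M.inn (i x), M.arc (i x, false), (hB _ _).2 ⟨x, rfl⟩, Or.inr (M.tgt_arc _ _)⟩
  arc := Equiv.ofBijective (fun x => ⟨M.arc (i x.1, x.2), (hB _ _).2 ⟨x.1, rfl⟩⟩) (by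
    constructor
    · rintro ⟨x, b⟩ ⟨y, b'⟩ h
      have := M.arc.injective (congrArg Subtype.val h)
      simp only [Prod.mk.injEq] at this
      rw [hi this.1, this.2]
    · rintro ⟨a, ha⟩
      obtain ⟨⟨x, b⟩, rfl⟩ := M.arc.surjective a
      obtain ⟨x, rfl⟩ := (hB _ _).1 ha
      exact ⟨(x, b), rfl⟩)
  rot_three x := hi (by rw [hρ, hρ, hρ, M.rot_three])
  rot_ne x h := M.rot_ne (i x) (by rw [← hρ, h])
  out_injective x y h := hi (M.out_injective (congrArg Subtype.val h))
  inn_injective x y h := hi (M.inn_injective (congrArg Subtype.val h))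
  src_arc x b := Subtype.ext (M.src_arc (i x) b)
  tgt_arc x b := by
    refine Subtype.ext ((M.tgt_arc (i x) b).trans ?_)
    cases b
    · rfl
    · exact congrArg M.inn (hρ x).symm
  cover := by
    rintro ⟨v, a, ha, h⟩
    obtain ⟨⟨x, b⟩, rfl⟩ := M.arc.surjective a
    obtain ⟨x, rfl⟩ := (hB _ _).1 ha
    rcases h with rfl | rfl
    · exact Or.inl ⟨x, Subtype.ext (M.src_arc _ _).symm⟩
    · refine Or.inr ⟨bif b then ρ x else x, Subtype.ext ((M.tgt_arc _ _).trans ?_).symm⟩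
      cases b
      · rfl
      · exact congrArg M.inn (hρ x).symm

end Restrict

/-! ### Decomposition of a 2-diregular digraph into complementary subgraphs -/

theorem _root_.exists_equiv_of_range_eq {X Y Z : Type*} {f : X → Z} {g : Y → Z}
    (hf : Function.Injective f) (hg : Function.Injective g) (h : Set.range f = Set.range g) :
    ∃ e : X ≃ Y, ∀ x, g (e x) = f x := by
  refine ⟨(Equiv.ofInjective f hf).trans
    ((Equiv.setCongr h).trans (Equiv.ofInjective g hg).symm), fun x => ?_⟩
  exact Equiv.apply_ofInjective_symm hg _

variable {G : MultiDigraph V A} {ρ : Perm S} {σ : Perm T}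

/-- A 2-diregular digraph is glued from two complementary subgraphs, whose entry and exit vertices
are the same vertices. -/
theorem IsGluing.exists_isGlue {M₀ : SlotModel G (Equiv.sumCongr σ ρ)} {c : Perm (T ⊕ S)}
    (hc : M₀.IsGluing c) {B B' : Set A} {M : SlotModel (G.induced B) ρ}
    {N : SlotModel (G.induced B') σ} (hMo : ∀ x, (M.out x).1 = M₀.out (.inr x))
    (hMi : ∀ x, (M.inn x).1 = M₀.inn (.inr x)) (hNo : ∀ x, (N.out x).1 = M₀.out (.inl x))
    (hNi : ∀ x, (N.inn x).1 = M₀.inn (.inl x)) :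
    ∃ (ι : (G.induced B).Entry ≃ (G.induced B').Exit)
      (κ : (G.induced B).Exit ≃ (G.induced B').Entry),
      (∀ u, (ι u).1.1 = u.1.1) ∧ (∀ d, (κ d).1.1 = d.1.1) ∧ IsGlue M N ι κ c := by
  have hMM : ∀ y x, M.inn y = M.out x ↔ c (.inr y) = .inr x := by
    intro y x
    rw [Subtype.ext_iff, hMi, hMo, hc, M₀.out_injective.eq_iff]
  have hNN : ∀ y x, N.inn y = N.out x ↔ c (.inl y) = .inl x := by
    intro y x
    rw [Subtype.ext_iff, hNi, hNo, hc, M₀.out_injective.eq_iff]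
  have hι : ∃ ι : (G.induced B).Entry ≃ (G.induced B').Exit, ∀ u, (ι u).1.1 = u.1.1 := by
    refine exists_equiv_of_range_eq (f := fun u : (G.induced B).Entry => u.1.1)
      (g := fun u : (G.induced B').Exit => u.1.1) (fun u v h => Subtype.ext (Subtype.ext h))
      (fun u v h => Subtype.ext (Subtype.ext h)) ?_
    ext v
    constructor
    · rintro ⟨⟨u, hu⟩, rfl⟩
      obtain ⟨hu, x, rfl⟩ := (M.isEntry_iff _).1 hu
      rcases hy : c.symm (.inr x) with y | y <;> rw [Equiv.symm_apply_eq] at hy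
      · refine ⟨⟨N.inn y, (N.isExit_iff _).2 ⟨⟨y, rfl⟩, ?_⟩⟩, ?_⟩
        · rintro ⟨x', hx'⟩
          rw [eq_comm, hNN, ← hy] at hx'
          exact Sum.inr_ne_inl hx'
        · change (N.inn y).1 = (M.out x).1
          rw [hNi, hc, ← hy, hMo]
      · exact absurd ⟨y, (hMM y x).2 hy.symm⟩ hu
    · rintro ⟨⟨u, hu⟩, rfl⟩
      obtain ⟨⟨y, rfl⟩, hu⟩ := (N.isExit_iff _).1 hu
      rcases hx : c (.inl y) with x | x
      · exact absurd ⟨x, ((hNN y x).2 hx).symm⟩ hu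
      · refine ⟨⟨M.out x, (M.isEntry_iff _).2 ⟨?_, ⟨x, rfl⟩⟩⟩, ?_⟩
        · rintro ⟨y', hy'⟩
          rw [hMM, ← hx] at hy'
          exact Sum.inr_ne_inl (c.injective hy')
        · change (M.out x).1 = (N.inn y).1
          rw [hNi, hc, hx, hMo]
  have hκ : ∃ κ : (G.induced B).Exit ≃ (G.induced B').Entry, ∀ d, (κ d).1.1 = d.1.1 := by
    refine exists_equiv_of_range_eq (f := fun u : (G.induced B).Exit => u.1.1)
      (g := fun u : (G.induced B').Entry => u.1.1) (fun u v h => Subtype.ext (Subtype.ext h))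
      (fun u v h => Subtype.ext (Subtype.ext h)) ?_
    ext v
    constructor
    · rintro ⟨⟨u, hu⟩, rfl⟩
      obtain ⟨⟨y, rfl⟩, hu⟩ := (M.isExit_iff _).1 hu
      rcases hx : c (.inr y) with x | x
      · refine ⟨⟨N.out x, (N.isEntry_iff _).2 ⟨?_, ⟨x, rfl⟩⟩⟩, ?_⟩
        · rintro ⟨y', hy'⟩
          rw [hNN, ← hx] at hy'
          exact Sum.inl_ne_inr (c.injective hy')
        · change (N.out x).1 = (M.inn y).1
          rw [hMi, hc, hx, hNo]
      · exact absurd ⟨x, ((hMM y x).2 hx).symm⟩ hu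
    · rintro ⟨⟨u, hu⟩, rfl⟩
      obtain ⟨hu, x, rfl⟩ := (N.isEntry_iff _).1 hu
      rcases hy : c.symm (.inl x) with y | y <;> rw [Equiv.symm_apply_eq] at hy
      · exact absurd ⟨y, (hNN y x).2 hy.symm⟩ hu
      · refine ⟨⟨M.inn y, (M.isExit_iff _).2 ⟨⟨y, rfl⟩, ?_⟩⟩, ?_⟩
        · rintro ⟨x', hx'⟩
          rw [eq_comm, hMM, ← hy] at hx'
          exact Sum.inl_ne_inr hx'
        · change (M.inn y).1 = (N.out x).1
          rw [hMi, hc, ← hy, hNo]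
  obtain ⟨ι, hι⟩ := hι
  obtain ⟨κ, hκ⟩ := hκ
  refine ⟨ι, κ, hι, hκ, fun y => ?_⟩
  rcases y with y | y <;> rcases hx : c _ with x | x
  · exact (hNN y x).2 hx
  · refine ⟨ι.symm ⟨N.inn y, (N.isExit_iff _).2 ⟨⟨y, rfl⟩, ?_⟩⟩, ?_, ?_⟩
    · rintro ⟨x', hx'⟩
      rw [eq_comm, hNN, hx] at hx'
      exact Sum.inr_ne_inl hx'
    · rw [ι.apply_symm_apply]
    · apply Subtype.ext
      rw [← hι, ι.apply_symm_apply, hNi, hc, hx, hMo]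
  · refine ⟨⟨M.inn y, (M.isExit_iff _).2 ⟨⟨y, rfl⟩, ?_⟩⟩, rfl, ?_⟩
    · rintro ⟨x', hx'⟩
      rw [eq_comm, hMM, hx] at hx'
      exact Sum.inl_ne_inr hx'
    · apply Subtype.ext
      rw [hκ, hMi, hc, hx, hNo]
  · exact (hMM y x).2 hx

end SlotModel

/-! ### Subgraphs consisting of alternating cycles -/

section Sub

variable {G : MultiDigraph V A} {K : Set (Set A)} (hK : K ⊆ G.acs)

/-- The slots of the alternating cycles in `K`. -/
def slotInclusion (x : K × Fin 3) : G.acs × Fin 3 := (⟨x.1.1, hK x.1.2⟩, x.2)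

theorem mem_range_slotInclusion (x : G.acs × Fin 3) :
    x ∈ Set.range (slotInclusion hK) ↔ x.1.1 ∈ K := by
  constructor
  · rintro ⟨y, rfl⟩
    exact y.1.2
  · intro h
    exact ⟨(⟨x.1.1, h⟩, x.2), rfl⟩

theorem slotInclusion_injective : Function.Injective (slotInclusion hK) := by
  rintro ⟨⟨X, hX⟩, k⟩ ⟨⟨Y, hY⟩, l⟩ h
  simp only [slotInclusion, Prod.mk.injEq, Subtype.mk.injEq] at h
  obtain ⟨rfl, rfl⟩ := h
  rfl

variable (M : SlotModel G (rotRow G.acs))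
  (hM : ∀ (X Y : G.acs) k b, M.arc ((X, k), b) ∈ Y.1 ↔ X = Y)

/-- The slot model of a subgraph that consists of alternating cycles. -/
noncomputable def SlotModel.sub : SlotModel (G.sub K) (rotRow K) :=
  M.restrict (slotInclusion hK) (slotInclusion_injective hK) (fun _ => rfl) (B := ⋃₀ K) (by
    rintro ⟨X, k⟩ b
    rw [mem_range_slotInclusion]
    constructor
    · rintro ⟨Y, hY, h⟩
      obtain rfl := (hM X ⟨Y, hK hY⟩ k b).1 h
      exact hY
    · intro h
      exact ⟨X.1, h, (hM X X k b).2 rfl⟩)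

/-- In a clean alternating cycle, no end-vertex is a start-vertex. -/
theorem SlotModel.inn_ne_out_of_isClean (M : SlotModel G (rotRow G.acs))
    (hM : ∀ (X Y : G.acs) k b, M.arc ((X, k), b) ∈ Y.1 ↔ X = Y) (hclean : G.IsClean) (X : G.acs) (k l : Fin 3) :
    M.inn (X, k) ≠ M.out (X, l) := by
  intro h
  let N : SlotModel (G.induced X.1) (Equiv.addRight (1 : Fin 3)) :=
    M.restrict (fun k => (X, k)) (fun k l h => congrArg Prod.snd h) (fun _ => rfl) (by
      rintro ⟨Y, k⟩ b
      rw [hM]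
      constructor
      · rintro rfl
        exact ⟨k, rfl⟩
      · rintro ⟨l, hl⟩
        exact (congrArg Prod.fst hl).symm)
  exact (hclean X.1 X.2).false ⟨N.inn k, (N.isSat_iff _).2 ⟨⟨k, rfl⟩, ⟨l, Subtype.ext h.symm⟩⟩⟩

/-- Without a reducible subgraph, at most two glued vertices join the two alternating cycles other
than a given one. -/
theorem SlotModel.ncard_le_two_of_not_hasReducible [Finite A] (hK3 : K.ncard = 3)
    (hred : ¬ G.HasReducibleTwoACSubgraph K) (j : K) :
    {y : K × Fin 3 | y.1 ≠ j ∧ ∃ x : K × Fin 3, x.1 ≠ j ∧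
      (M.sub hK hM).inn y = (M.sub hK hM).out x}.ncard ≤ 2 := by
  have hsub : K \ {j.1} ⊆ K := Set.sdiff_subset
  have h2 : (K \ {j.1}).ncard = 2 := by
    rw [Set.ncard_sdiff_singleton_of_mem j.2, hK3]
  by_contra! h
  refine hred ⟨K \ {j.1}, hsub, h2, lt_of_lt_of_le h ?_⟩
  rw [(M.sub (hsub.trans hK) hM).card_sat]
  let f : ↑(K \ {j.1}) × Fin 3 → K × Fin 3 := fun x => (⟨x.1.1, hsub x.1.2⟩, x.2)
  refine le_trans (Set.ncard_le_ncard (t := f '' _) ?_) Set.ncard_image_le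
  rintro ⟨y, k⟩ ⟨hy, ⟨x, l⟩, hx, h⟩
  have hmem : ∀ y : K, y ≠ j → y.1 ∈ K \ {j.1} := fun y hy => ⟨y.2, fun h => hy (Subtype.ext h)⟩
  exact ⟨(⟨y.1, hmem y hy⟩, k), ⟨(⟨x.1, hmem x hx⟩, l), Subtype.ext (congrArg Subtype.val h).symm⟩,
    rfl⟩

end Sub

end MultiDigraph

namespace MultiDigraph

universe w₁ w₂ w₃ w₄ w₅ w₆

namespace SlotModel

/-! ### 2-digraphs with prescribed gluing -/

section Link

variable {S : Type w₁}

open Classical in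
/-- The 2-digraph on the alternating cycles given by `ρ` in which the in-slots `y ∈ L` are glued to
the out-slots `g y` and no others are glued. -/
noncomputable def linkGraph (ρ g : Perm S) (L : Set S) : MultiDigraph (S ⊕ ↥Lᶜ) (S × Bool) where
  src x := .inl x.1
  tgt x := if h : (bif x.2 then ρ x.1 else x.1) ∈ L then .inl (g (bif x.2 then ρ x.1 else x.1))
    else .inr ⟨_, h⟩

open Classical in
/-- The slot model of a 2-digraph with prescribed gluing. -/
noncomputable def linkModel (ρ g : Perm S) (L : Set S) (h3 : ∀ x, ρ (ρ (ρ x)) = x)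
    (hne : ∀ x, ρ x ≠ x) : SlotModel (linkGraph ρ g L) ρ where
  out x := .inl x
  inn x := if h : x ∈ L then .inl (g x) else .inr ⟨x, h⟩
  arc := Equiv.refl _
  rot_three := h3
  rot_ne := hne
  out_injective := Sum.inl_injective
  inn_injective := by
    intro x y h
    dsimp only at h
    split_ifs at h
    · exact g.injective (Sum.inl_injective h)
    · exact congrArg Subtype.val (Sum.inr_injective h)
  src_arc _ _ := rfl
  tgt_arc _ _ := rfl
  cover := by
    rintro (v | ⟨v, hv⟩)
    · exact Or.inl ⟨v, rfl⟩
    · exact Or.inr ⟨v, dif_neg hv⟩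

variable {ρ g : Perm S} {L : Set S} {h3 : ∀ x, ρ (ρ (ρ x)) = x} {hne : ∀ x, ρ x ≠ x}

theorem linkModel_inn_of_mem {y : S} (hy : y ∈ L) :
    (linkModel ρ g L h3 hne).inn y = (linkModel ρ g L h3 hne).out (g y) := dif_pos hy

theorem linkModel_inn_mem_range_iff (y : S) :
    (linkModel ρ g L h3 hne).inn y ∈ Set.range (linkModel ρ g L h3 hne).out ↔ y ∈ L := by
  constructor
  · rintro ⟨x, hx⟩
    by_contra hy
    have : (linkModel ρ g L h3 hne).inn y = .inr ⟨y, hy⟩ := dif_neg hy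
    rw [this] at hx
    exact Sum.inl_ne_inr hx
  · intro hy
    exact ⟨g y, (linkModel_inn_of_mem hy).symm⟩

theorem card_sat_linkGraph [Finite S] (h3 : ∀ x, ρ (ρ (ρ x)) = x) (hne : ∀ x, ρ x ≠ x) :
    Nat.card (linkGraph ρ g L).Sat = L.ncard := by
  rw [(linkModel ρ g L h3 hne).card_sat]
  simp only [linkModel_inn_mem_range_iff, Set.ofPred_mem_eq]

theorem IsClosing.apply_of_mem {b : (linkGraph ρ g L).Exit ≃ (linkGraph ρ g L).Entry} {c : Perm S}
    (hc : (linkModel ρ g L h3 hne).IsClosing b c) {y : S} (hy : y ∈ L) : c y = g y :=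
  hc.apply_of_eq (linkModel_inn_of_mem hy)

/-- Every permutation that extends the prescribed gluing is a closing. -/
theorem exists_isClosing_linkModel [Finite S] {c : Perm S} (hc : ∀ y ∈ L, c y = g y) :
    ∃ b, (linkModel ρ g L h3 hne).IsClosing b c := by
  have hM := linkModel_inn_mem_range_iff (ρ := ρ) (g := g) (L := L) (h3 := h3) (hne := hne)
  have hin : ∀ y ∈ L, (linkModel ρ g L h3 hne).inn y = (linkModel ρ g L h3 hne).out (g y) :=
    fun y hy => linkModel_inn_of_mem hy
  generalize linkModel ρ g L h3 hne = M at hM hin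
  have hentry : ∀ d, M.out (c (M.exitSlot d)) ∉ Set.range M.inn := by
    rintro d ⟨y, hy⟩
    have hyL : y ∈ L := (hM y).1 ⟨_, hy.symm⟩
    rw [hin y hyL] at hy
    have := M.out_injective hy
    rw [← hc y hyL] at this
    have := c.injective this
    rw [this, ← hM, M.inn_exitSlot] at hyL
    exact ((M.isExit_iff _).1 d.2).2 hyL
  let f : (linkGraph ρ g L).Exit → (linkGraph ρ g L).Entry := fun d =>
    ⟨M.out (c (M.exitSlot d)), (M.isEntry_iff _).2 ⟨hentry d, ⟨_, rfl⟩⟩⟩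
  have hf : Function.Injective f := fun d d' h =>
    M.exitSlot_injective (c.injective (M.out_injective (congrArg Subtype.val h)))
  have : Finite (linkGraph ρ g L).Entry := Finite.of_injective _ M.entrySlot_injective
  have hb : Function.Bijective f := by
    obtain ⟨b⟩ := M.nonempty_exit_equiv_entry
    have := Finite.of_equiv _ b.symm
    exact (Nat.bijective_iff_injective_and_card f).2 ⟨hf, Nat.card_congr b⟩
  refine ⟨Equiv.ofBijective f hb, fun y => ?_⟩
  by_cases hy : y ∈ L
  · exact Or.inl ((hin y hy).trans (by rw [hc y hy]))
  · rcases M.exit_or_out y with ⟨d, hd⟩ | ⟨x, hx⟩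
    · have : M.exitSlot d = y := M.inn_injective ((M.inn_exitSlot d).trans hd.symm)
      exact Or.inr ⟨d, hd, by rw [← this]; rfl⟩
    · exact absurd ((hM y).1 ⟨x, hx.symm⟩) hy

end Link

/-! ### Residues of the substitutes -/

section Substitute

theorem iterate_ne_of_isSingleOrbit {α : Type*} [Finite α] {φ : Perm α} (hφ : φ.IsSingleOrbit)
    (x : α) {k : ℕ} (hk : 0 < k) (hk' : k < Nat.card α) : φ^[k] x ≠ x := by
  intro h
  have hper : ∀ y, ∃ i : Fin k, φ^[(i : ℕ)] x = y := by
    intro y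
    obtain ⟨n, hn⟩ := hφ.exists_pow_eq x y
    refine ⟨⟨n % k, Nat.mod_lt _ hk⟩, ?_⟩
    have : Function.IsPeriodicPt φ k x := h
    rw [← hn, ← Perm.iterate_eq_pow]
    exact this.iterate_mod_apply n
  have := Nat.card_le_card_of_surjective _ hper
  rw [Nat.card_fin] at this
  omega

/-- Every even permutation of three slots becomes a 3-cycle by some turn. -/
theorem exists_turn_three_slots : ∀ c : Perm (Fin 1 × Fin 3), Perm.sign c = 1 →
    ∃ z : Fin 1 → Bool, ∀ k : Fin 2, (c * turn (rotRow _) (rowChoice z))^[k + 1] (0, 0) ≠ (0, 0) := by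
  decide +kernel

/-- Every odd permutation of six slots with the two given links becomes a 6-cycle by some turn. -/
theorem exists_turn_six_slots : ∀ c : Perm (Fin 2 × Fin 3), c (0, 0) = (1, 0) → c (0, 1) = (1, 1) →
    Perm.sign c = -1 →
    ∃ z : Fin 2 → Bool, ∀ k : Fin 5, (c * turn (rotRow _) (rowChoice z))^[k + 1] (0, 0) ≠ (0, 0) := by
  decide +kernel

/-- The only odd permutation of six slots with the links from `(0, 0)` to `(1, 0)` and back that does
not become a 6-cycle by any turn. -/
def exceptionalPerm : Perm (Fin 2 × Fin 3) :=
  Equiv.swap (0, 0) (1, 0) * (Equiv.swap (0, 1) (0, 2) * Equiv.swap (1, 1) (1, 2))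

theorem exceptionalPerm_spec :
    exceptionalPerm (0, 0) = (1, 0) ∧ exceptionalPerm (1, 0) = (0, 0) ∧
      Perm.sign exceptionalPerm = -1 ∧ ∀ z : Fin 2 → Bool, ∃ k : Fin 5,
        (exceptionalPerm * turn (rotRow _) (rowChoice z))^[k + 1] (0, 0) = (0, 0) := by
  decide +kernel

theorem eq_exceptionalPerm : ∀ c : Perm (Fin 2 × Fin 3), c (0, 0) = (1, 0) →
    c (1, 0) = (0, 0) → Perm.sign c = -1 →
    (∀ z : Fin 2 → Bool, ∃ k : Fin 5,
      (c * turn (rotRow _) (rowChoice z))^[k + 1] (0, 0) = (0, 0)) → c = exceptionalPerm := by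
  decide +kernel

/-- A choice for the cycles of the rotation is a choice for the rows. -/
theorem exists_eq_rowChoice {J : Type*} (z : CycleChoice (rotRow J)) : ∃ w, z = rowChoice w := by
  refine ⟨fun j => z.1 (j, 0), Subtype.ext (funext fun x => ?_)⟩
  obtain ⟨j, k⟩ := x
  have h0 := z.2 (j, 0)
  have h1 := z.2 (j, 1)
  change z.1 (j, k) = z.1 (j, 0)
  fin_cases k
  · rfl
  · exact h0
  · exact h1.trans h0

theorem not_neverSingle_of_iterate_ne {J : Type*} [Finite J] {c : Perm (J × Fin 3)} {n : ℕ}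
    (hJ : Nat.card (J × Fin 3) = n + 1) {z : J → Bool} (x : J × Fin 3)
    (h : ∀ k : Fin n, (c * turn (rotRow J) (rowChoice z))^[k + 1] x ≠ x) :
    ¬ NeverSingle (rotRow J) c := by
  refine fun hc => hc (rowChoice z) (Perm.isSingleOrbit_of_iterate_ne x fun k h0 hk => ?_)
  have := h ⟨k - 1, by omega⟩
  simpa only [Nat.sub_add_cancel h0] using this

theorem _root_.NeverSingle.exists_iterate_eq {J : Type*} [Finite J] {c : Perm (J × Fin 3)} {n : ℕ}
    (hJ : Nat.card (J × Fin 3) = n + 1) (x : J × Fin 3) (hc : NeverSingle (rotRow J) c)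
    (z : J → Bool) : ∃ k : Fin n, (c * turn (rotRow J) (rowChoice z))^[k + 1] x = x := by
  by_contra! h
  exact not_neverSingle_of_iterate_ne hJ x h hc

theorem neverSingle_of_iterate_eq {J : Type*} [Finite J] {c : Perm (J × Fin 3)} {n : ℕ}
    (hJ : Nat.card (J × Fin 3) = n + 1) (x : J × Fin 3)
    (h : ∀ z, ∃ k : Fin n, (c * turn (rotRow J) (rowChoice z))^[k + 1] x = x) :
    NeverSingle (rotRow J) c := by
  intro z hz
  obtain ⟨w, rfl⟩ := exists_eq_rowChoice z
  obtain ⟨k, hk⟩ := h w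
  exact iterate_ne_of_isSingleOrbit hz x k.val.succ_pos (by omega) hk

section NoBad

variable {V : Type w₁} {A : Type w₂} {S : Type w₃} {F : MultiDigraph V A} {ρ : Perm S}

/-- Every closing of the right parity has a Hamiltonian factor. -/
def NoneBad (M : SlotModel F ρ) : Prop :=
  ∀ (b : F.Exit ≃ F.Entry) (c : Perm S), M.IsClosing b c → c.parity = -(-1) ^ Nat.card S →
    ¬ NeverSingle ρ c

theorem NoneBad.atMostOneBad {M : SlotModel F ρ} (h : M.NoneBad) : M.AtMostOneBad :=
  fun _ _ _ _ hc _ hp _ hs _ => absurd hs (h _ _ hc hp)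

theorem NoneBad.residue_eq_empty [Finite S] {M : SlotModel F ρ} (h : M.NoneBad) {n : ℕ}
    (hn : 3 ≤ n) (ε : F.Entry ≃ Fin n) (δ : F.Exit ≃ Fin n) : residue (F.routePerms ε δ) = ∅ := by
  rw [Set.eq_empty_iff_forall_notMem]
  intro x hx
  obtain ⟨c, hc⟩ := M.exists_isClosing (labelClosing ε δ x)
  rw [hc.mem_residue_iff (by omega) (h.atMostOneBad.routePerms_nonempty ε δ hn)] at hx
  exact h _ _ hc hx.1 hx.2

theorem IsClosing.residue_nonempty [Finite S] {M : SlotModel F ρ} (h : M.AtMostOneBad)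
    {b : F.Exit ≃ F.Entry} {c : Perm S} (hc : M.IsClosing b c)
    (hp : c.parity = -(-1) ^ Nat.card S) (hs : NeverSingle ρ c) {n : ℕ} (hn : 3 ≤ n)
    (ε : F.Entry ≃ Fin n) (δ : F.Exit ≃ Fin n) : (residue (F.routePerms ε δ)).Nonempty := by
  have hb : labelClosing ε δ (δ.symm.trans (b.trans ε)) = b := by
    ext1 d
    simp [labelClosing]
  rw [← hb] at hc
  exact ⟨_, (hc.mem_residue_iff (by omega) (h.routePerms_nonempty ε δ hn)).2 ⟨hp, hs⟩⟩

end NoBad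

theorem rotRow_ne {J : Type*} (x : J × Fin 3) : rotRow J x ≠ x := fun h =>
  (by decide : ∀ k : Fin 3, k + 1 ≠ k) x.2 (congrArg Prod.snd h)

theorem card_linkGraph {m n l : ℕ} {g : Perm (Fin m × Fin 3)} {L : Set (Fin m × Fin 3)}
    (hL : L.ncard = l) (h : n + l = m * 3) :
    Nat.card (linkGraph (rotRow _) g L).Entry = n ∧ Nat.card (linkGraph (rotRow _) g L).Exit = n := by
  have h1 := (linkModel _ g L rotRow_three rotRow_ne).card_entry_add_card_sat
  have h2 := (linkModel _ g L rotRow_three rotRow_ne).card_exit_add_card_sat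
  rw [card_sat_linkGraph rotRow_three rotRow_ne, hL, Nat.card_prod, Nat.card_fin, Nat.card_fin]
    at h1 h2
  omega

/-- A single alternating cycle without saturated vertices has an empty residue. -/
theorem exists_noneBad_three : ∃ (V' A' : Type) (_ : Finite V') (_ : Finite A')
    (F' : MultiDigraph V' A') (M' : SlotModel F' (rotRow (Fin 1))),
    Nat.card F'.Entry = 3 ∧ Nat.card F'.Exit = 3 ∧ M'.NoneBad := by
  refine ⟨_, _, inferInstance, inferInstance, linkGraph (rotRow (Fin 1)) 1 ∅,
    linkModel _ _ _ rotRow_three rotRow_ne, ?_⟩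
  obtain ⟨h1, h2⟩ := card_linkGraph (m := 1) (n := 3) (g := 1) (L := ∅) (Set.ncard_empty _) rfl
  refine ⟨h1, h2, fun b c _ hp => ?_⟩
  rw [Perm.parity_eq_sign] at hp
  obtain ⟨z, hz⟩ := exists_turn_three_slots c (by rw [hp]; simp; decide)
  exact not_neverSingle_of_iterate_ne (by simp) _ hz

/-- Two alternating cycles glued from vertices of the first to vertices of the second, both times
in adjacent positions, have an empty residue. -/
theorem exists_noneBad_four : ∃ (V' A' : Type) (_ : Finite V') (_ : Finite A')
    (F' : MultiDigraph V' A') (M' : SlotModel F' (rotRow (Fin 2))),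
    Nat.card F'.Entry = 4 ∧ Nat.card F'.Exit = 4 ∧ M'.NoneBad := by
  refine ⟨_, _, inferInstance, inferInstance, linkGraph (rotRow (Fin 2))
    (Equiv.swap (0, 0) (1, 0) * Equiv.swap (0, 1) (1, 1)) {(0, 0), (0, 1)},
    linkModel _ _ _ rotRow_three rotRow_ne, ?_⟩
  obtain ⟨h1, h2⟩ := card_linkGraph (m := 2) (n := 4)
    (g := Equiv.swap (0, 0) (1, 0) * Equiv.swap (0, 1) (1, 1)) (L := {(0, 0), (0, 1)})
    (Set.ncard_pair (by decide)) rfl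
  refine ⟨h1, h2, fun b c hc hp => ?_⟩
  rw [Perm.parity_eq_sign] at hp
  obtain ⟨z, hz⟩ := exists_turn_six_slots c ((hc.apply_of_mem (Or.inl rfl)).trans (by decide))
    ((hc.apply_of_mem (Or.inr rfl)).trans (by decide)) (by rw [hp]; simp; decide)
  exact not_neverSingle_of_iterate_ne (by simp) _ hz

/-- Two alternating cycles glued at one vertex in either direction have a residue with exactly one
element. -/
theorem exists_oneBad_four : ∃ (V' A' : Type) (_ : Finite V') (_ : Finite A')
    (F' : MultiDigraph V' A') (M' : SlotModel F' (rotRow (Fin 2))),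
    Nat.card F'.Entry = 4 ∧ Nat.card F'.Exit = 4 ∧ M'.AtMostOneBad ∧
      ∃ b c, M'.IsClosing b c ∧ c.parity = -(-1) ^ Nat.card (Fin 2 × Fin 3) ∧
        NeverSingle (rotRow (Fin 2)) c := by
  refine ⟨_, _, inferInstance, inferInstance, linkGraph (rotRow (Fin 2))
    exceptionalPerm {(0, 0), (1, 0)}, linkModel _ _ _ rotRow_three rotRow_ne, ?_⟩
  obtain ⟨h1, h2⟩ := card_linkGraph (m := 2) (n := 4)
    (g := exceptionalPerm) (L := {(0, 0), (1, 0)}) (Set.ncard_pair (by decide)) rfl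
  obtain ⟨e1, e2, e3, e4⟩ := exceptionalPerm_spec
  have hcard : Nat.card (Fin 2 × Fin 3) = 5 + 1 := by simp
  have hpar : (-(-1) ^ (5 + 1) : ℤˣ) = -1 := by decide
  have key : ∀ (b : (linkGraph (rotRow (Fin 2)) exceptionalPerm {(0, 0), (1, 0)}).Exit ≃ _) c,
      (linkModel _ exceptionalPerm {(0, 0), (1, 0)} rotRow_three rotRow_ne).IsClosing b c →
      c.parity = -(-1) ^ Nat.card (Fin 2 × Fin 3) → NeverSingle (rotRow (Fin 2)) c →
      c = exceptionalPerm := by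
    intro b c hc hp hs
    rw [Perm.parity_eq_sign, hcard, hpar] at hp
    exact eq_exceptionalPerm c ((hc.apply_of_mem (Or.inl rfl)).trans e1)
      ((hc.apply_of_mem (Or.inr rfl)).trans e2) hp (hs.exists_iterate_eq hcard _)
  refine ⟨h1, h2, fun b₁ b₂ c₁ c₂ hc₁ hc₂ hp₁ hp₂ hs₁ hs₂ => ?_, ?_⟩
  · rw [key _ _ hc₁ hp₁ hs₁, key _ _ hc₂ hp₂ hs₂]
  · obtain ⟨b, hb⟩ := exists_isClosing_linkModel (ρ := rotRow (Fin 2)) (g := exceptionalPerm)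
      (L := {(0, 0), (1, 0)}) (h3 := rotRow_three) (hne := rotRow_ne) (c := exceptionalPerm)
      fun _ _ => rfl
    refine ⟨b, _, hb, ?_, neverSingle_of_iterate_eq hcard _ e4⟩
    rw [Perm.parity_eq_sign, hcard, hpar, e3]

end Substitute

/-! ### Matching the labels of a substitute -/

section Match

variable {V : Type w₁} {A : Type w₂} {S : Type w₃} {V' : Type w₄} {A' : Type w₅} {S' : Type w₆}
variable {F : MultiDigraph V A} {ρ : Perm S} {F' : MultiDigraph V' A'} {ρ' : Perm S'}

theorem _root_.MultiDigraph.routePerms_trans {n : ℕ} (ε : F.Entry ≃ Fin n) (δ : F.Exit ≃ Fin n)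
    (a b : Perm (Fin n)) :
    F.routePerms (ε.trans a) (δ.trans b) = {q | ∃ p ∈ F.routePerms ε δ, q = b * p * a⁻¹} := by
  ext q
  constructor
  · rintro ⟨r, hr, rfl⟩
    exact ⟨_, ⟨r, hr, rfl⟩, rfl⟩
  · rintro ⟨_, ⟨r, hr, rfl⟩, rfl⟩
    exact ⟨r, hr, rfl⟩

/-- Equality of residues does not depend on the labelling. -/
theorem sameResidue_of_residue_eq {n : ℕ} {ε : F.Entry ≃ Fin n} {δ : F.Exit ≃ Fin n}
    {α : F'.Entry ≃ F.Entry} {β : F'.Exit ≃ F.Exit} (hu : IsUniformSet (F.routePerms ε δ))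
    (hu' : IsUniformSet (F'.routePerms (α.trans ε) (β.trans δ)))
    (h : residue (F.routePerms ε δ) = residue (F'.routePerms (α.trans ε) (β.trans δ))) :
    SameResidue F F' α β := by
  intro m ε₂ δ₂
  obtain rfl : m = n := Fin.equiv_iff_eq.1 ⟨ε₂.symm.trans ε⟩
  obtain ⟨a, rfl⟩ : ∃ a : Perm (Fin m), ε₂ = ε.trans a := ⟨ε.symm.trans ε₂, by ext1; simp⟩
  obtain ⟨b, rfl⟩ : ∃ b : Perm (Fin m), δ₂ = δ.trans b := ⟨δ.symm.trans δ₂, by ext1; simp⟩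
  rw [← Equiv.trans_assoc, ← Equiv.trans_assoc, routePerms_trans, routePerms_trans]
  refine ⟨isUniformSet_mul hu _ _, isUniformSet_mul hu' _ _, ?_⟩
  ext x
  rw [mem_residue_mul_iff hu, mem_residue_mul_iff hu', h]

/-- If both residues have at most one element, and the same number of elements, then the labels of
the exit vertices can be permuted such that the residues and the parities of the open routes
agree. -/
theorem AtMostOneBad.exists_sameResidue [Finite S] [Finite S'] {M : SlotModel F ρ}
    {M' : SlotModel F' ρ'} (h : M.AtMostOneBad) (h' : M'.AtMostOneBad) {n : ℕ} (hn : 3 ≤ n)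
    (ε : F.Entry ≃ Fin n) (δ : F.Exit ≃ Fin n) (ε' : F'.Entry ≃ Fin n) (δ' : F'.Exit ≃ Fin n)
    (hres : (residue (F.routePerms ε δ)).Nonempty ↔ (residue (F'.routePerms ε' δ')).Nonempty) :
    ∃ (α : F'.Entry ≃ F.Entry) (β : F'.Exit ≃ F.Exit), SameResidue F F' α β ∧
      residue (F.routePerms ε δ) = residue (F'.routePerms (α.trans ε) (β.trans δ)) ∧
      ∃ p ∈ F.routePerms ε δ, ∃ p' ∈ F'.routePerms (α.trans ε) (β.trans δ),
        Perm.sign p = Perm.sign p' := by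
  have hne := h.routePerms_nonempty ε δ hn
  have hne' := h'.routePerms_nonempty ε' δ' hn
  have hu := M.isUniformSet_routePerms hne
  have hu' := M'.isUniformSet_routePerms hne'
  obtain ⟨p, hp⟩ := hne
  obtain ⟨p', hp'⟩ := hne'
  have hlabel : ∀ b : Perm (Fin n), F'.routePerms ε' (δ'.trans b) =
      {q | ∃ p ∈ F'.routePerms ε' δ', q = b * p * 1} := fun b => routePerms_trans ε' δ' 1 b
  have hmem : ∀ b x : Perm (Fin n),
      x ∈ residue (F'.routePerms ε' (δ'.trans b)) ↔ x * b ∈ residue (F'.routePerms ε' δ') := by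
    intro b x
    rw [hlabel, mem_residue_mul_iff hu', one_mul]
  have hpb : ∀ b, b * p' ∈ F'.routePerms ε' (δ'.trans b) := by
    intro b
    rw [hlabel]
    exact ⟨p', hp', (mul_one _).symm⟩
  obtain ⟨b, hb, hs⟩ : ∃ b : Perm (Fin n),
      residue (F.routePerms ε δ) = residue (F'.routePerms ε' (δ'.trans b)) ∧
        Perm.sign p = Perm.sign (b * p') := by
    rcases (residue (F.routePerms ε δ)).eq_empty_or_nonempty with h0 | ⟨x, hx⟩
    · have h0' : residue (F'.routePerms ε' δ') = ∅ := by
        rw [← Set.not_nonempty_iff_eq_empty, ← hres, h0]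
        exact Set.not_nonempty_empty
      obtain ⟨b, -, -, hb, -⟩ := exists_two_perms_of_sign hn (Perm.sign p * Perm.sign p')
      refine ⟨b, ?_, ?_⟩
      · rw [h0, eq_comm, Set.eq_empty_iff_forall_notMem]
        intro x
        rw [hmem, h0']
        exact Set.notMem_empty _
      · rw [Perm.sign_mul, hb, mul_assoc, Int.units_mul_self, mul_one]
    · obtain ⟨x', hx'⟩ := hres.1 ⟨x, hx⟩
      have hxb : x ∈ residue (F'.routePerms ε' (δ'.trans (x⁻¹ * x'))) := by
        rwa [hmem, mul_inv_cancel_left]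
      have heq : residue (F.routePerms ε δ) =
          residue (F'.routePerms ε' (δ'.trans (x⁻¹ * x'))) := by
        rw [(h.subsingleton_residue ε δ hn).eq_singleton_of_mem hx,
          (h'.subsingleton_residue ε' _ hn).eq_singleton_of_mem hxb]
      refine ⟨_, heq, ?_⟩
      have h1 := ((mem_residue_iff hu hp x).1 hx).1
      have h2 := ((mem_residue_iff (M'.isUniformSet_routePerms ⟨_, hpb _⟩) (hpb _) x).1 hxb).1
      rw [← h2, Perm.sign_mul, Perm.sign_mul _ x] at h1
      exact mul_right_cancel h1
  have hα : (ε'.trans ε.symm).trans ε = ε' := by ext1; simp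
  have hβ : ((δ'.trans b).trans δ.symm).trans δ = δ'.trans b := by ext1; simp
  refine ⟨ε'.trans ε.symm, (δ'.trans b).trans δ.symm, sameResidue_of_residue_eq hu ?_ ?_, ?_, p, hp,
    b * p', ?_, hs⟩ <;> rw [hα, hβ]
  · exact M'.isUniformSet_routePerms ⟨_, hpb b⟩
  · exact hb
  · exact hb
  · exact hpb b

end Match

end SlotModel
end MultiDigraph

namespace MultiDigraph

universe w₁ w₂ w₃ w₄ w₅

namespace SlotModel

/-! ### Subgraphs with three alternating cycles -/

section Three

variable {V : Type w₁} {A : Type w₂} {J : Type w₃} {F : MultiDigraph V A}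

theorem exists_ne_ne_of_card_eq_three [Finite J] (hJ : Nat.card J = 3) (a b : J) :
    ∃ j, a ≠ j ∧ b ≠ j := by
  by_contra! h
  have : (Set.univ : Set J) ⊆ {a, b} := fun j _ => by
    by_cases hj : a = j
    · exact Or.inl hj.symm
    · exact Or.inr (h j hj).symm
  have := Set.ncard_le_ncard this
  rw [Set.ncard_univ, hJ] at this
  have := Set.ncard_insert_le a {b}
  rw [Set.ncard_singleton] at this
  omega

/-- As every glued vertex avoids one of the three alternating cycles, there are at most six. -/
theorem card_sat_le_six [Finite J] (M : SlotModel F (rotRow J)) (hJ : Nat.card J = 3)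
    (hpair : ∀ j, {y : J × Fin 3 | y.1 ≠ j ∧ ∃ x : J × Fin 3, x.1 ≠ j ∧
      M.inn y = M.out x}.ncard ≤ 2) : Nat.card F.Sat ≤ 6 := by
  have := Fintype.ofFinite J
  have hsub : {y | M.inn y ∈ Set.range M.out} ⊆ ⋃ j ∈ (Finset.univ : Finset J),
      {y : J × Fin 3 | y.1 ≠ j ∧ ∃ x : J × Fin 3, x.1 ≠ j ∧ M.inn y = M.out x} := by
    rintro y ⟨x, hx⟩
    obtain ⟨j, hy, hx'⟩ := exists_ne_ne_of_card_eq_three hJ y.1 x.1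
    exact Set.mem_biUnion (Finset.mem_coe.2 (Finset.mem_univ j)) ⟨hy, x, hx', hx.symm⟩
  rw [M.card_sat]
  refine (Set.ncard_le_ncard hsub).trans ((Finset.set_ncard_biUnion_le _ _).trans ?_)
  refine (Finset.sum_le_card_nsmul _ _ 2 fun j _ => hpair j).trans ?_
  rw [Finset.card_univ, ← Nat.card_eq_fintype_card, hJ]
  decide

/-- Five glued vertices leave at most one closing of the right parity without a Hamiltonian factor. -/
theorem atMostOneBad_of_five_le [Finite J] (M : SlotModel F (rotRow J)) (hJ : Nat.card J = 3)
    (hclean : ∀ y x, M.inn y = M.out x → x.1 ≠ y.1)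
    (hpair : ∀ j, {y : J × Fin 3 | y.1 ≠ j ∧ ∃ x : J × Fin 3, x.1 ≠ j ∧
      M.inn y = M.out x}.ncard ≤ 2) (h5 : 5 ≤ Nat.card F.Sat) : M.AtMostOneBad := by
  intro b₁ b₂ c₁ c₂ h₁ h₂ hp₁ hp₂ hs₁ hs₂
  rw [M.card_sat] at h5
  have hone : (-(-1) ^ Nat.card (J × Fin 3) : ℤˣ) = 1 := by
    rw [Nat.card_prod, hJ, Nat.card_fin]
    decide
  rw [hone] at hp₁ hp₂
  have happ : ∀ y ∈ {y | M.inn y ∈ Set.range M.out}, M.inn y = M.out (c₁ y) := by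
    rintro y ⟨x, hx⟩
    rw [h₁.apply_of_eq hx.symm, hx]
  refine eq_of_neverSingle hJ hp₁ hp₂ hs₁ hs₂ {y | M.inn y ∈ Set.range M.out} ?_ ?_ ?_ h5
  · intro y hy
    exact h₂.apply_of_eq (happ y hy)
  · intro y hy
    exact hclean _ _ (happ y hy)
  · intro j
    refine (Set.ncard_le_ncard ?_).trans (hpair j)
    rintro y ⟨hy, hj, hj'⟩
    exact ⟨hj, _, hj', happ y hy⟩

end Three

end SlotModel

open SlotModel

section Decompose

variable {V : Type w₁} {A : Type w₂} {G : MultiDigraph V A} {K : Set (Set A)}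

/-- The slots of complementary subgraphs. -/
theorem exists_slotEquiv (hK : K ⊆ G.acs) :
    ∃ e : (↑(G.acs \ K) × Fin 3) ⊕ (K × Fin 3) ≃ G.acs × Fin 3,
      (∀ x, e (.inl x) = slotInclusion Set.sdiff_subset x) ∧
        ∀ x, e (.inr x) = slotInclusion hK x := by
  refine ⟨Equiv.ofBijective (Sum.elim (slotInclusion Set.sdiff_subset) (slotInclusion hK))
    ⟨?_, ?_⟩, fun _ => rfl, fun _ => rfl⟩
  · refine (slotInclusion_injective _).sumElim (slotInclusion_injective _) ?_
    rintro ⟨X, k⟩ ⟨Y, l⟩ h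
    have : X.1 = Y.1 := congrArg (fun x => x.1.1) h
    exact X.2.2 (this ▸ Y.2)
  · rintro ⟨X, k⟩
    by_cases hX : X.1 ∈ K
    · exact ⟨.inr (⟨X.1, hX⟩, k), rfl⟩
    · exact ⟨.inl (⟨X.1, X.2, hX⟩, k), rfl⟩

variable {M : SlotModel (G.sub K) (rotRow K)}
  {N : SlotModel (G.sub (G.acs \ K)) (rotRow ↑(G.acs \ K))}
  {M₀ : SlotModel G (Equiv.sumCongr (rotRow ↑(G.acs \ K)) (rotRow K))}
  {c : Perm ((↑(G.acs \ K) × Fin 3) ⊕ (K × Fin 3))}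
  {ι : (G.sub K).Entry ≃ (G.sub (G.acs \ K)).Exit} {κ : (G.sub K).Exit ≃ (G.sub (G.acs \ K)).Entry}

/-- If `r` is the only open route of `F`, every Hamiltonian circuit follows it through `F`, and it may be
shortened by the identifications along `r`. -/
theorem isOddHEquivalent_collapse [Finite A] (hc : M₀.IsGluing c) (hodd : G.IsOdd)
    (hι : ∀ u, (ι u).1.1 = u.1.1) (hκ : ∀ d, (κ d).1.1 = d.1.1) (hglue : IsGlue M N ι κ c)
    (d₀ : (G.sub K).Exit) {r : (G.sub K).Entry ≃ (G.sub K).Exit}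
    (hr : (G.sub K).openRoutes = {r}) : G.IsOddHEquivalent (G.collapse K r) := by
  obtain ⟨d, hd⟩ := N.exists_isClosing (ι.symm.trans (r.trans κ))
  have hspec := hglue.collapse_spec ((hc.isOdd_iff_forall).1 hodd) d₀ hr hd
  obtain ⟨M', hM'⟩ := N.exists_identify_closing
    (fun x y => ∃ u : (G.sub K).Entry, x.1 = u.1.1 ∧ y.1 = (r u).1.1) hd (by
      intro u v
      constructor
      · rintro ⟨w, hu, hv⟩
        refine ⟨ι w, Subtype.ext (hu.trans (hι w).symm), Subtype.ext (hv.trans ?_)⟩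
        simp [hκ]
      · rintro ⟨w, rfl, rfl⟩
        refine ⟨ι.symm w, ?_, ?_⟩
        · rw [← hι, ι.apply_symm_apply]
        · simp [hκ])
  have : Nonempty (↑(G.acs \ K) × Fin 3) := ⟨N.entrySlot (κ d₀)⟩
  refine ⟨hM'.inFull6, hM'.isOdd_iff_forall.2 hspec.1, ?_⟩
  rw [hc.isHamiltonian_iff, hspec.2]
  exact hM'.isHamiltonian_iff.symm

/-- A substitute whose residue is empty or nonempty along with that of `F` can be attached such that
residues and parities agree, which preserves oddness and Hamiltonicity. -/
theorem exists_isOddHEquivalent_replace [Finite A] (hc : M₀.IsGluing c) (hodd : G.IsOdd)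
    (hι : ∀ u, (ι u).1.1 = u.1.1) (hκ : ∀ d, (κ d).1.1 = d.1.1) (hglue : IsGlue M N ι κ c)
    (hM : M.AtMostOneBad) {n : ℕ} (hn : 3 ≤ n) (ε : (G.sub K).Entry ≃ Fin n)
    (δ : (G.sub K).Exit ≃ Fin n) {V' : Type w₃} {A' : Type w₄} {J : Type w₅} [Finite J]
    {F' : MultiDigraph V' A'} {M' : SlotModel F' (rotRow J)} (hM' : M'.AtMostOneBad)
    (ε' : F'.Entry ≃ Fin n) (δ' : F'.Exit ≃ Fin n)
    (hres : (residue ((G.sub K).routePerms ε δ)).Nonempty ↔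
      (residue (F'.routePerms ε' δ')).Nonempty) :
    ∃ (α : F'.Entry ≃ (G.sub K).Entry) (β : F'.Exit ≃ (G.sub K).Exit),
      (G.sub K).SameResidue F' α β ∧ G.IsOddHEquivalent (G.replace K F' α β) := by
  obtain ⟨α, β, hsame, hR, p, hp, p', hp', hpp⟩ := hM.exists_sameResidue hM' hn ε δ ε' δ' hres
  refine ⟨α, β, hsame, ?_⟩
  obtain ⟨c', hc'⟩ := exists_isGlue M' N (α.trans ι) (β.trans κ)
  have hspec := hglue.replace_spec ((hc.isOdd_iff_forall).1 hodd) ε δ (by omega) hc' hp hp' hpp hR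
  obtain ⟨M'', hM''⟩ := hc'.exists_identify (fun x y => ∃ z, x = Sum.inl z ∧
      ((∃ u, y = Sum.inr u.1 ∧ z.1 = (α u).1.1) ∨ (∃ w, y = Sum.inr w.1 ∧ z.1 = (β w).1.1))) (by
    intro x y
    constructor
    · rintro ⟨z, rfl, ⟨u, rfl, h⟩ | ⟨w, rfl, h⟩⟩
      · exact Or.inl ⟨u, congrArg Sum.inl (Subtype.ext (h.trans (hι _).symm)), rfl⟩
      · exact Or.inr ⟨w, congrArg Sum.inl (Subtype.ext (h.trans (hκ _).symm)), rfl⟩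
    · rintro (⟨u, rfl, rfl⟩ | ⟨w, rfl, rfl⟩)
      · exact ⟨_, rfl, Or.inl ⟨u, rfl, hι _⟩⟩
      · exact ⟨_, rfl, Or.inr ⟨w, rfl, hκ _⟩⟩)
  have : Nonempty ((↑(G.acs \ K) × Fin 3) ⊕ (K × Fin 3)) :=
    ⟨.inr (M.entrySlot (ε.symm ⟨0, by omega⟩))⟩
  have : Nonempty ((↑(G.acs \ K) × Fin 3) ⊕ (J × Fin 3)) :=
    ⟨.inr (M'.entrySlot (ε'.symm ⟨0, by omega⟩))⟩
  refine ⟨hM''.inFull6, hM''.isOdd_iff_forall.2 hspec.1, ?_⟩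
  rw [hc.isHamiltonian_iff, hspec.2]
  exact hM''.isHamiltonian_iff.symm

end Decompose

end MultiDigraph

/-! ### Reduction of subgraphs with three alternating cycles -/

open MultiDigraph MultiDigraph.SlotModel

theorem mainTheorem9 {V A : Type*} [Finite V] [Finite A] (G : MultiDigraph V A)
    (hG : G.InFull6) (hclean : G.IsClean) (hodd : G.IsOdd) (hconn : G.underlying.Connected)
    (hsplit : ¬ G.IsSplittable 2)
    (K : Set (Set A)) (hK : K ⊆ G.acs) (hK3 : K.ncard = 3)
    (s : ℕ) (hs : Nat.card (G.sub K).Sat = s) (hs4 : 4 < s)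
    (hred : ¬ G.HasReducibleTwoACSubgraph K) :
    ((∃ r : (G.sub K).Entry ≃ (G.sub K).Exit,
        (G.sub K).openRoutes = {r} ∧ G.IsOddHEquivalent (G.collapse K r)) ∨
      (∃ (V' A' : Type) (_ : Finite V') (_ : Finite A') (F' : MultiDigraph V' A')
        (α : F'.Entry ≃ (G.sub K).Entry) (β : F'.Exit ≃ (G.sub K).Exit),
        F'.InPartial6 ∧ (F'.acs.ncard = 1 ∨ F'.acs.ncard = 2) ∧
        (G.sub K).SameResidue F' α β ∧ G.IsOddHEquivalent (G.replace K F' α β))) ∧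
    (s = 5 → Nat.card (G.sub K).Entry = 4 ∧ Nat.card (G.sub K).Exit = 4 ∧
      ∀ (ε : (G.sub K).Entry ≃ Fin 4) (δ : (G.sub K).Exit ≃ Fin 4),
        IsUniformSet ((G.sub K).routePerms ε δ) ∧
        ((residue ((G.sub K).routePerms ε δ)).ncard = 0 ∨
          (residue ((G.sub K).routePerms ε δ)).ncard = 1)) := by
  obtain ⟨M₁, hM₁⟩ := exists_slotModel hG
  obtain ⟨e, he, he'⟩ := exists_slotEquiv hK
  -- the slots outside `F` on the left, those of `F` on the right
  let M₀ : SlotModel G (Equiv.sumCongr (rotRow ↑(G.acs \ K)) (rotRow K)) := M₁.reindex e (by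
    rintro (x | x)
    · rw [he, Equiv.sumCongr_apply, Sum.map_inl, he]
      rfl
    · rw [he', Equiv.sumCongr_apply, Sum.map_inr, he']
      rfl)
  obtain ⟨c, hc⟩ := M₀.exists_isGluing hG.1
  let M := M₁.sub hK hM₁
  let N := M₁.sub (K := G.acs \ K) Set.sdiff_subset hM₁
  obtain ⟨ι, κ, hι, hκ, hglue⟩ := hc.exists_isGlue (M := M) (N := N)
    (fun x => congrArg M₁.out (he' x).symm) (fun x => congrArg M₁.inn (he' x).symm)
    (fun x => congrArg M₁.out (he x).symm) (fun x => congrArg M₁.inn (he x).symm)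
  have hJ : Nat.card K = 3 := by rw [Nat.card_coe_set_eq, hK3]
  have hpair := M₁.ncard_le_two_of_not_hasReducible hK hM₁ hK3 hred
  have hcl : ∀ y x, M.inn y = M.out x → x.1 ≠ y.1 := by
    rintro ⟨X, k⟩ ⟨Y, l⟩ h rfl
    exact M₁.inn_ne_out_of_isClean hM₁ hclean ⟨_, hK Y.2⟩ k l (congrArg Subtype.val h)
  have h6 : s ≤ 6 := hs ▸ M.card_sat_le_six hJ hpair
  have hM : M.AtMostOneBad := M.atMostOneBad_of_five_le hJ hcl hpair (by omega)
  -- nine slots, `s` of which are glued, leave `9 - s` entry vertices and as many exit vertices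
  have hen := M.card_entry_add_card_sat
  have hex := M.card_exit_add_card_sat
  rw [Nat.card_prod, hJ, Nat.card_fin, hs] at hen hex
  have : Finite (G.sub K).Entry := Finite.of_injective _ M.entrySlot_injective
  have : Finite (G.sub K).Exit := Finite.of_injective _ M.exitSlot_injective
  have hlabel : ∀ {V' A' : Type} [Finite V'] {F' : MultiDigraph V' A'} {n : ℕ},
      Nat.card F'.Entry = n → Nat.card F'.Exit = n →
        Nonempty ((F'.Entry ≃ Fin n) × (F'.Exit ≃ Fin n)) := fun h h' =>
    ⟨Finite.equivFinOfCardEq h, Finite.equivFinOfCardEq h'⟩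
  constructor
  · obtain rfl | rfl : s = 5 ∨ s = 6 := by omega
    · let ε : (G.sub K).Entry ≃ Fin 4 := Finite.equivFinOfCardEq (by omega)
      let δ : (G.sub K).Exit ≃ Fin 4 := Finite.equivFinOfCardEq (by omega)
      right
      rcases (residue ((G.sub K).routePerms ε δ)).eq_empty_or_nonempty with h0 | h0
      · obtain ⟨V', A', hV', hA', F', M', h1, h2, hM'⟩ := exists_noneBad_four
        obtain ⟨ε', δ'⟩ := (hlabel h1 h2).some
        obtain ⟨α, β, h, h'⟩ := exists_isOddHEquivalent_replace hc hodd hι hκ hglue hM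
          (by decide) ε δ hM'.atMostOneBad ε' δ'
          (by rw [h0, hM'.residue_eq_empty (by decide)])
        exact ⟨V', A', hV', hA', F', α, β, M'.inPartial6,
          Or.inr (M'.ncard_acs.trans (Nat.card_fin 2)), h, h'⟩
      · obtain ⟨V', A', hV', hA', F', M', h1, h2, hM', b, d, hd, hp, hns⟩ := exists_oneBad_four
        obtain ⟨ε', δ'⟩ := (hlabel h1 h2).some
        obtain ⟨α, β, h, h'⟩ := exists_isOddHEquivalent_replace hc hodd hι hκ hglue hM
          (by decide) ε δ hM' ε' δ'
          (iff_of_true h0 (hd.residue_nonempty hM' hp hns (by decide) ε' δ'))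
        exact ⟨V', A', hV', hA', F', α, β, M'.inPartial6,
          Or.inr (M'.ncard_acs.trans (Nat.card_fin 2)), h, h'⟩
    · let ε : (G.sub K).Entry ≃ Fin 3 := Finite.equivFinOfCardEq (by omega)
      let δ : (G.sub K).Exit ≃ Fin 3 := Finite.equivFinOfCardEq (by omega)
      rcases (residue ((G.sub K).routePerms ε δ)).eq_empty_or_nonempty with h0 | ⟨x, hx⟩
      · right
        obtain ⟨V', A', hV', hA', F', M', h1, h2, hM'⟩ := exists_noneBad_three
        obtain ⟨ε', δ'⟩ := (hlabel h1 h2).some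
        obtain ⟨α, β, h, h'⟩ := exists_isOddHEquivalent_replace hc hodd hι hκ hglue hM
          (by decide) ε δ hM'.atMostOneBad ε' δ'
          (by rw [h0, hM'.residue_eq_empty (by decide)])
        exact ⟨V', A', hV', hA', F', α, β, M'.inPartial6,
          Or.inl (M'.ncard_acs.trans (Nat.card_fin 1)), h, h'⟩
      · -- a permutation in the residue determines the open route
        left
        have hne := hM.routePerms_nonempty ε δ (by decide)
        have hu := M.isUniformSet_routePerms hne
        obtain ⟨_, r, hr, rfl⟩ := hne
        have hr' : (G.sub K).openRoutes = {r} := by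
          refine Set.eq_singleton_iff_unique_mem.2 ⟨hr, fun r' hr' => ?_⟩
          have h1 := eq_inv_of_mem_residue hu hx ⟨r, hr, rfl⟩
          have h2 := eq_inv_of_mem_residue hu hx ⟨r', hr', rfl⟩
          have h3 := h2.trans h1.symm
          ext1 u
          have := congrArg (fun f : Perm (Fin 3) => δ.symm (f (ε u))) h3
          simpa using this
        exact ⟨r, hr', isOddHEquivalent_collapse hc hodd hι hκ hglue (δ.symm 0) hr'⟩
  · rintro rfl
    refine ⟨by omega, by omega, fun ε δ => ⟨?_, ?_⟩⟩
    · exact M.isUniformSet_routePerms (hM.routePerms_nonempty ε δ (by decide))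
    · rcases (hM.subsingleton_residue ε δ (by decide)).eq_empty_or_singleton with h | ⟨x, h⟩
      · exact Or.inl (by rw [h, Set.ncard_empty])
      · exact Or.inr (by rw [h, Set.ncard_singleton])
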